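/- Let $k$ be an algebraically closed field and let $V$ be a variety over $k$ (a separated scheme of finite type; reducedness is not needed) with an action of the multiplicative group $\mathbb{G}_m$. Suppose that $V$ is \emph{nearly projective}: $V$ is projective over its affinization $V_0=\operatorname{Spec}\Gamma(V,\mathcal O_V)$, the induced $\mathbb{G}_m$-action on $V_0$ has a unique fixed point, and $\mathbb{G}_m$ retracts $V_0$ to that point, i.e. the action map $\mathbb{G}_m\times V_0\to V_0$ extends to a morphism $\mathbb{A}^1\times V_0\to V_0$ that contracts $0\times V_0$ to the fixed point. Let $E_1,\dots,E_n$ be $\mathbb{G}_m$-equivariant vector bundles on $V$. For $r\in\mathbb{Z}$ let $A_{ij}^r\subseteq\operatorname{Hom}(E_i,E_j)$ be the $r$-eigenspace of $\mathbb{G}_m$, i.e. the space of those $\varphi$ with $(t\cdot x)^*\varphi=t^r\,x^*\varphi$ for all points $t$ of $\mathbb{G}_m$ and $x$ of $V$ (with respect to the identifications given by the equivariant structures). Suppose that the collection is \emph{decent}: for all $i$, $\operatorname{End}(E_i)\cong\Gamma(V,\mathcal O_V)$ as $\Gamma(V,\mathcal O_V)$-modules; $A_{ij}^r=0$ for all $i,j$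 and all $r<0$; and $A_{ij}^r=0$ whenever $j<i$ and $r\le 0$. Let $A=\operatorname{End}(E_1\oplus\cdots\oplus E_n)^{\mathrm{op}}$, and let $e_i\in A$ be the idempotent that acts on $E_j$ as $\delta_{ij}$ times the identity. Then $A=\bigoplus_{i,j,r}A_{ij}^r$, and giving $A_{ij}^r$ the degree $j-i+nr$ makes $A$ a graded $k$-algebra. This grading is non-negative (all pieces of negative degree vanish), all of its graded pieces are finite dimensional over $k$, and its degree zero part is spanned by $e_1,\dots,e_n$. -/

import Mathlib

open CategoryTheory AlgebraicGeometry Limits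

universe u

noncomputable section

namespace BondalQuiver

/-! ### Scalar multiplication on morphisms of sheaves of modules -/

/-- The restriction of a global function to an open set. -/
abbrev res {X : Scheme.{u}} (U : X.Opens) (g : Γ(X, ⊤)) : Γ(X, U) :=
  X.presheaf.map (homOfLE le_top : U ⟶ ⊤).op g

theorem map_res {X : Scheme.{u}} {U W : X.Opens} (i : W ⟶ U) (g : Γ(X, ⊤)) :
    X.presheaf.map i.op (res U g) = res W g := by
  rw [res, ← CommRingCat.comp_apply, ← Functor.map_comp]
  rfl

/-- The map `s ↦ g|_U • φ s` on sections over `U`. -/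
def globalSMulApp {X : Scheme.{u}} {M N : X.Modules} (g : Γ(X, ⊤)) (φ : M ⟶ N) (U : X.Opens) :
    Γ(M, U) →ₗ[Γ(X, U)] Γ(N, U) where
  toFun s := res U g • φ.app U s
  map_add' s t := by rw [map_add, smul_add]
  map_smul' r s := by rw [Scheme.Modules.Hom.app_smul, smul_comm]; rfl

theorem globalSMulApp_naturality {X : Scheme.{u}} {M N : X.Modules} (g : Γ(X, ⊤)) (φ : M ⟶ N)
    {U W : X.Opens} (i : W ⟶ U) (s : Γ(M, U)) :
    globalSMulApp g φ W (M.presheaf.map i.op s) = N.presheaf.map i.op (globalSMulApp g φ U s) := by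
  have h : N.presheaf.map i.op (φ.app U s) = φ.app W (M.presheaf.map i.op s) :=
    congr($(φ.mapPresheaf.naturality i.op).hom s).symm
  change res W g • φ.app W (M.presheaf.map i.op s) = N.presheaf.map i.op (res U g • φ.app U s)
  rw [Scheme.Modules.map_smul, map_res, h]

/-- Multiplication of a morphism of `𝒪_X`-modules by a global function: on sections over `U` it is
`s ↦ g|_U • φ s`. -/
def globalSMul {X : Scheme.{u}} {M N : X.Modules} (g : Γ(X, ⊤)) (φ : M ⟶ N) : M ⟶ N :=
  ⟨{ app := fun U => ModuleCat.ofHom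
        { toFun := globalSMulApp g φ U.unop
          map_add' := (globalSMulApp g φ U.unop).map_add
          map_smul' := (globalSMulApp g φ U.unop).map_smul }
     naturality := by
      intro U W i
      ext s
      exact globalSMulApp_naturality g φ i.unop s }⟩

theorem globalSMul_app {X : Scheme.{u}} {M N : X.Modules} (g : Γ(X, ⊤)) (φ : M ⟶ N)
    (U : X.Opens) (s : Γ(M, U)) :
    (globalSMul g φ).app U s = res U g • φ.app U s := rfl

theorem hom_ext_sections {X : Scheme.{u}} {M N : X.Modules} {φ ψ : M ⟶ N}
    (h : ∀ (U : X.Opens) (s : Γ(M, U)), φ.app U s = ψ.app U s) : φ = ψ := by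
  ext U s
  exact h U s

/-- Morphisms of `𝒪_X`-modules form a module over the ring of global functions. -/
instance homModule {X : Scheme.{u}} (M N : X.Modules) : Module Γ(X, ⊤) (M ⟶ N) where
  smul g φ := globalSMul g φ
  one_smul φ := hom_ext_sections fun U s => by
    change res U 1 • φ.app U s = _
    rw [res, map_one, one_smul]
  mul_smul g h φ := hom_ext_sections fun U s => by
    change res U (g * h) • φ.app U s = res U g • res U h • φ.app U s
    rw [res, map_mul, mul_smul]
  smul_zero g := hom_ext_sections fun U s => smul_zero (res U g)
  smul_add g φ ψ := hom_ext_sections fun U s => smul_add (res U g) (φ.app U s) (ψ.app U s)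
  add_smul g h φ := hom_ext_sections fun U s => by
    change res U (g + h) • φ.app U s = res U g • φ.app U s + res U h • φ.app U s
    rw [res, map_add, add_smul]
  zero_smul φ := hom_ext_sections fun U s => by
    change res U 0 • φ.app U s = 0
    rw [res, map_zero, zero_smul]

theorem smul_app {X : Scheme.{u}} {M N : X.Modules} (g : Γ(X, ⊤)) (φ : M ⟶ N)
    (U : X.Opens) (s : Γ(M, U)) :
    (g • φ).app U s = res U g • φ.app U s := rfl

/-- The category of `𝒪_X`-modules is linear over the ring of global functions. -/
instance modulesLinear (X : Scheme.{u}) : Linear Γ(X, ⊤) X.Modules where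
  homModule := homModule
  smul_comp _ _ _ g φ ψ := hom_ext_sections fun U s =>
    ψ.app_smul (res U g) (φ.app U s)
  comp_smul _ _ _ _ _ _ := hom_ext_sections fun _ _ => rfl

theorem pushforward_map_smul {X Y : Scheme.{u}} (f : X ⟶ Y) {M N : X.Modules} (g : Γ(Y, ⊤))
    (φ : M ⟶ N) :
    (Scheme.Modules.pushforward f).map (f.appTop g • φ) =
      g • (Scheme.Modules.pushforward f).map φ := by
  refine hom_ext_sections fun U s => ?_
  have h : res (f ⁻¹ᵁ U) (f.appTop g) = f.app U (res U g) :=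
    congr($(f.naturality (homOfLE le_top : U ⟶ ⊤).op).hom g).symm
  change res (f ⁻¹ᵁ U) (f.appTop g) • φ.app (f ⁻¹ᵁ U) s = _
  rw [h]
  rfl

theorem pullback_map_smul {X Y : Scheme.{u}} (f : X ⟶ Y) {M N : Y.Modules} (g : Γ(Y, ⊤))
    (φ : M ⟶ N) :
    (Scheme.Modules.pullback f).map (g • φ) =
      f.appTop g • (Scheme.Modules.pullback f).map φ := by
  apply ((Scheme.Modules.pullbackPushforwardAdjunction f).homEquiv _ _).injective
  rw [Adjunction.homEquiv_unit, Adjunction.homEquiv_unit, pushforward_map_smul,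
    Linear.comp_smul]
  erw [← (Scheme.Modules.pullbackPushforwardAdjunction f).unit.naturality,
    ← (Scheme.Modules.pullbackPushforwardAdjunction f).unit.naturality]
  exact Linear.smul_comp ..

/-! ### Schemes over a field -/

variable {k : Type u} [Field k]

/-- The ring homomorphism `k → Γ(V, 𝒪_V)` given by the structure morphism `V ⟶ Spec k`. -/
def constants (k : Type u) [Field k] (V : Scheme.{u}) [V.Over (Spec (.of k))] :
    k →+* Γ(V, ⊤) :=
  ((Scheme.ΓSpecIso (.of k)).inv ≫ (V ↘ Spec (.of k)).appTop).hom

/-- For a `k`-scheme `V`, the category of `𝒪_V`-modules is `k`-linear. -/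
instance modulesLinearOver (V : Scheme.{u}) [V.Over (Spec (.of k))] : Linear k V.Modules where
  homModule M N := Module.compHom (M ⟶ N) (constants k V)
  smul_comp M N K c φ ψ := Linear.smul_comp M N K (constants k V c) φ ψ
  comp_smul M N K φ c ψ := Linear.comp_smul M N K φ (constants k V c) ψ

theorem smul_eq_constants_smul (V : Scheme.{u}) [V.Over (Spec (.of k))] {M N : V.Modules}
    (c : k) (φ : M ⟶ N) : c • φ = constants k V c • φ := rfl

/-! ### Actions of the multiplicative group -/

/-- The homomorphism `𝔾ₘ(T) → 𝔾ₘ(T')` induced by a morphism `T' ⟶ T`, where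
`𝔾ₘ(T) = Γ(T, 𝒪_T)ˣ`. -/
abbrev unitsPullback {T' T : Scheme.{u}} (f : T' ⟶ T) : Γ(T, ⊤)ˣ →* Γ(T', ⊤)ˣ :=
  Units.map (f.appTop.hom : Γ(T, ⊤) →* Γ(T', ⊤))

variable (k) in
/-- An action of the multiplicative group `𝔾ₘ` over `k` on a `k`-scheme `V`, given on points:
`𝔾ₘ(T) = Γ(T, 𝒪_T)ˣ` acts on `V(T)`, by morphisms over `k` and functorially in `T`.  (A point
`x : T ⟶ V` makes `T` a `k`-scheme, so that `T` runs over all `k`-schemes.) -/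
structure GmAction (V : Scheme.{u}) [V.Over (Spec (.of k))] where
  /-- the point `t · x` -/
  act {T : Scheme.{u}} (t : Γ(T, ⊤)ˣ) (x : T ⟶ V) : T ⟶ V
  act_over {T : Scheme.{u}} (t : Γ(T, ⊤)ˣ) (x : T ⟶ V) :
    act t x ≫ (V ↘ Spec (.of k)) = x ≫ (V ↘ Spec (.of k))
  comp_act {T' T : Scheme.{u}} (f : T' ⟶ T) (t : Γ(T, ⊤)ˣ) (x : T ⟶ V) :
    f ≫ act t x = act (unitsPullback f t) (f ≫ x)
  one_act {T : Scheme.{u}} (x : T ⟶ V) : act 1 x = x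
  mul_act {T : Scheme.{u}} (s t : Γ(T, ⊤)ˣ) (x : T ⟶ V) : act (s * t) x = act s (act t x)

theorem appTop_constants {V : Scheme.{u}} [V.Over (Spec (.of k))] (σ : GmAction k V)
    {T : Scheme.{u}} (t : Γ(T, ⊤)ˣ) (x : T ⟶ V) (c : k) :
    (σ.act t x).appTop (constants k V c) = x.appTop (constants k V c) := by
  have h := congr_arg Scheme.Hom.appTop (σ.act_over t x)
  rw [Scheme.Hom.comp_appTop, Scheme.Hom.comp_appTop] at h
  exact congr($(h).hom ((Scheme.ΓSpecIso (.of k)).inv c))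

/-! ### Projectivity and nearly projective varieties -/

/-- Homogeneous polynomials grade the polynomial ring. -/
instance gradedPolynomials (m : ℕ) (B : CommRingCat.{u}) :
    GradedAlgebra (MvPolynomial.homogeneousSubmodule (Fin (m + 1)) B) :=
  MvPolynomial.gradedAlgebra

/-- Projective space `ℙᵐ` over `Spec B`, as `Proj B[x₀, …, xₘ]`. -/
abbrev ProjectiveSpace (m : ℕ) (B : CommRingCat.{u}) : Scheme.{u} :=
  Proj (MvPolynomial.homogeneousSubmodule (Fin (m + 1)) B)

/-- The structure morphism of projective space. -/
def ProjectiveSpace.toSpec (m : ℕ) (B : CommRingCat.{u}) : ProjectiveSpace m B ⟶ Spec B :=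
  Proj.toSpecZero (MvPolynomial.homogeneousSubmodule (Fin (m + 1)) B) ≫
    Spec.map (CommRingCat.ofHom
      (algebraMap B (MvPolynomial.homogeneousSubmodule (Fin (m + 1)) B 0)))

/-- A morphism to an affine scheme is projective if it factors through a closed immersion into
some projective space over the base. -/
def IsProjective {X : Scheme.{u}} {B : CommRingCat.{u}} (f : X ⟶ Spec B) : Prop :=
  ∃ (m : ℕ) (i : X ⟶ ProjectiveSpace m B), IsClosedImmersion i ∧
    i ≫ ProjectiveSpace.toSpec m B = f

/-- `ρ : Γ(V) → Γ(V)[X]` describes a morphism `𝔸¹ × V₀ ⟶ V₀`, where `V₀ = Spec Γ(V)`.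
It extends the action of `𝔾ₘ` if the image of `t · x` in `V₀` is the value of this morphism at
`(t, x)`. -/
def ExtendsAction {V : Scheme.{u}} [V.Over (Spec (.of k))] (σ : GmAction k V)
    (ρ : Γ(V, ⊤) →+* Polynomial Γ(V, ⊤)) : Prop :=
  ∀ {T : Scheme.{u}} (t : Γ(T, ⊤)ˣ) (x : T ⟶ V) (g : Γ(V, ⊤)),
    (σ.act t x).appTop g = (ρ g).eval₂ x.appTop.hom (t : Γ(T, ⊤))

/-- A `k`-point `p` of `V₀ = Spec Γ(V)`, given by a retraction `Γ(V) → k` of `k → Γ(V)`, that is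
fixed by the action of `𝔾ₘ` described by `ρ`: `t · p = p` for the universal `t`. -/
def IsFixedPoint {V : Scheme.{u}} [V.Over (Spec (.of k))]
    (ρ : Γ(V, ⊤) →+* Polynomial Γ(V, ⊤)) (p : Γ(V, ⊤) →+* k) : Prop :=
  (∀ c, p (constants k V c) = c) ∧ ∀ g, (ρ g).map p = Polynomial.C (p g)

/-- A `k`-scheme `V` with an action of `𝔾ₘ` is nearly projective if it is projective over its
affinization `V₀ = Spec Γ(V)`, the action of `𝔾ₘ` on `V₀` has a unique fixed point, and `𝔾ₘ`
retracts `V₀` to that point: the action map extends to `𝔸¹ × V₀ ⟶ V₀`, which contracts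
`0 × V₀` to the point. -/
structure IsNearlyProjective {V : Scheme.{u}} [V.Over (Spec (.of k))] (σ : GmAction k V) :
    Prop where
  projective : IsProjective V.toSpecΓ
  retracts : ∃ (ρ : Γ(V, ⊤) →+* Polynomial Γ(V, ⊤)) (p : Γ(V, ⊤) →+* k), ExtendsAction σ ρ ∧
    IsFixedPoint ρ p ∧ (∀ q : Γ(V, ⊤) →+* k, IsFixedPoint ρ q → q = p) ∧
    ∀ g, (ρ g).eval 0 = constants k V (p g)

/-! ### Equivariant vector bundles -/

/-- A vector bundle: a sheaf of modules that is locally isomorphic to `𝒪^m` for some `m`. -/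
def IsVectorBundle {V : Scheme.{u}} (M : V.Modules) : Prop :=
  ∀ x : V, ∃ (U : V.Opens) (_ : x ∈ U) (m : ℕ),
    Nonempty (M.restrict U.ι ≅
      (SheafOfModules.free (R := U.toScheme.ringCatSheaf) (ULift.{u} (Fin m)) :
        U.toScheme.Modules))

/-- A `𝔾ₘ`-equivariant structure on a sheaf `M` of modules on `V`: isomorphisms
`(t · x)^* M ≅ x^* M` for all `t ∈ 𝔾ₘ(T)` and `x ∈ V(T)`, functorial in `T` and satisfying the
cocycle condition. -/
structure EquivariantStructure {V : Scheme.{u}} [V.Over (Spec (.of k))] (σ : GmAction k V)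
    (M : V.Modules) where
  /-- the isomorphism `(t · x)^* M ≅ x^* M` -/
  iso {T : Scheme.{u}} (t : Γ(T, ⊤)ˣ) (x : T ⟶ V) :
    (Scheme.Modules.pullback (σ.act t x)).obj M ≅ (Scheme.Modules.pullback x).obj M
  iso_comp {T' T : Scheme.{u}} (f : T' ⟶ T) (t : Γ(T, ⊤)ˣ) (x : T ⟶ V) :
    (Scheme.Modules.pullback f).map (iso t x).hom ≫ (Scheme.Modules.pullbackComp f x).hom.app M =
      (Scheme.Modules.pullbackComp f (σ.act t x)).hom.app M ≫
        (Scheme.Modules.pullbackCongr (σ.comp_act f t x)).hom.app M ≫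
          (iso (unitsPullback f t) (f ≫ x)).hom
  iso_mul {T : Scheme.{u}} (s t : Γ(T, ⊤)ˣ) (x : T ⟶ V) :
    (iso (s * t) x).hom =
      (Scheme.Modules.pullbackCongr (σ.mul_act s t x)).hom.app M ≫
        (iso s (σ.act t x)).hom ≫ (iso t x).hom

/-- A `𝔾ₘ`-equivariant vector bundle on `V`. -/
structure EquivariantVectorBundle {V : Scheme.{u}} [V.Over (Spec (.of k))]
    (σ : GmAction k V) where
  /-- the underlying sheaf of modules -/
  sheaf : V.Modules
  isVectorBundle : IsVectorBundle sheaf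
  /-- the equivariant structure -/
  equivariant : EquivariantStructure σ sheaf

variable {V : Scheme.{u}} [V.Over (Spec (.of k))] {σ : GmAction k V}

/-- The `r`-eigenspace of `Hom(E, F)` under `𝔾ₘ`: the morphisms `φ` such that
`(t · x)^* φ` corresponds to `t ^ r • x^* φ` under the equivariant structures, for all points
`t` of `𝔾ₘ` and `x` of `V`. -/
def weightSpace (E F : EquivariantVectorBundle σ) (r : ℤ) : Submodule k (E.sheaf ⟶ F.sheaf) where
  carrier := { φ | ∀ {T : Scheme.{u}} (t : Γ(T, ⊤)ˣ) (x : T ⟶ V),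
    (Scheme.Modules.pullback (σ.act t x)).map φ ≫ (F.equivariant.iso t x).hom =
      (E.equivariant.iso t x).hom ≫
        (((t ^ r : Γ(T, ⊤)ˣ) : Γ(T, ⊤)) • (Scheme.Modules.pullback x).map φ) }
  add_mem' {φ ψ} hφ hψ T t x := by
    rw [Functor.map_add, Functor.map_add, Preadditive.add_comp, smul_add, Preadditive.comp_add,
      hφ t x, hψ t x]
  zero_mem' {T} t x := by
    rw [Functor.map_zero, Functor.map_zero, zero_comp, smul_zero, comp_zero]
  smul_mem' c φ hφ T t x := by
    rw [smul_eq_constants_smul, pullback_map_smul, pullback_map_smul, appTop_constants,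
      Linear.smul_comp, hφ t x, smul_comm]
    simp only [Linear.comp_smul]

/-- A collection `E₁, …, Eₙ` of equivariant vector bundles is decent if `End(Eᵢ) ≅ Γ(V, 𝒪_V)` for
all `i` (as modules over `Γ(V, 𝒪_V)`), `𝔾ₘ` acts on `Hom(Eᵢ, Eⱼ)` with non-negative weights, and
with positive weights if `j < i`. -/
structure IsDecent {n : ℕ} (E : Fin n → EquivariantVectorBundle σ) : Prop where
  end_iso (i : Fin n) : Nonempty (((E i).sheaf ⟶ (E i).sheaf) ≃ₗ[Γ(V, ⊤)] Γ(V, ⊤))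
  nonneg (i j : Fin n) (r : ℤ) : r < 0 → weightSpace (E i) (E j) r = ⊥
  pos (i j : Fin n) (r : ℤ) : j < i → r ≤ 0 → weightSpace (E i) (E j) r = ⊥

/-! ### The graded algebra of a collection -/

/-- Finite direct sums of `𝒪_V`-modules exist. -/
instance modulesHasFiniteBiproducts (V : Scheme.{u}) : HasFiniteBiproducts V.Modules :=
  Abelian.hasFiniteBiproducts

/-- The algebra `A = End(E₁ ⊕ ⋯ ⊕ Eₙ)ᵒᵖ`. -/
abbrev endAlgebra {n : ℕ} (E : Fin n → EquivariantVectorBundle σ) : Type u :=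
  (End (⨁ fun i => (E i).sheaf))ᵐᵒᵖ

/-- The inclusion of `Hom(Eᵢ, Eⱼ)` in `A`. -/
def homInclusion {n : ℕ} (E : Fin n → EquivariantVectorBundle σ) (i j : Fin n) :
    ((E i).sheaf ⟶ (E j).sheaf) →ₗ[k] endAlgebra E where
  toFun φ := MulOpposite.op (End.of
    (biproduct.π (fun i => (E i).sheaf) i ≫ φ ≫ biproduct.ι (fun i => (E i).sheaf) j))
  map_add' φ ψ := by
    rw [Preadditive.add_comp, Preadditive.comp_add]
    rfl
  map_smul' c φ := by
    rw [Linear.smul_comp, Linear.comp_smul]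
    rfl

/-- The subspace `A_{ij}^r` of `A`: the `r`-eigenspace of `Hom(Eᵢ, Eⱼ)`. -/
def component {n : ℕ} (E : Fin n → EquivariantVectorBundle σ) (i j : Fin n) (r : ℤ) :
    Submodule k (endAlgebra E) :=
  (weightSpace (E i) (E j) r).map (homInclusion E i j)

/-- The degree `d` part of `A`, where `A_{ij}^r` has degree `j - i + n r`. -/
def gradedPiece {n : ℕ} (E : Fin n → EquivariantVectorBundle σ) (d : ℤ) :
    Submodule k (endAlgebra E) :=
  ⨆ (i : Fin n) (j : Fin n) (r : ℤ) (_ : (j : ℤ) - (i : ℤ) + (n : ℤ) * r = d), component E i j r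

/-- The idempotent `eᵢ` of `A`, which acts on `Eⱼ` as `δᵢⱼ` times the identity. -/
def idempotent {n : ℕ} (E : Fin n → EquivariantVectorBundle σ) (i : Fin n) : endAlgebra E :=
  homInclusion E i i (𝟙 (E i).sheaf)

end BondalQuiver

end

/-! ### Finiteness of integral closures over a perfect field -/

/-! Three facts carry the theorem.

Each `Hom(Eᵢ, Eⱼ)` is the direct sum of its weight spaces. In local frames the universal translate
of a morphism `φ` has a matrix of Laurent polynomials in `t`, and by quasi-compactness finitely many
weights occur on all of `V`. Since `k` is infinite, some linear combination of evaluations at points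
`a` of `kˣ` sends the character `t ^ r` to `1` and the other characters that occur to `0`. The same
combination of the translates of `φ` by constants is a global morphism whose matrix in every frame
is the coefficient of `t ^ r`, so the weight components never have to be glued
(`exists_conj_eq_sum`, `weightPart_mem`, `iSupIndep_weightSpace`). Collecting the matrix entries
`(i, j)` decomposes `A`, and grouping the summands by degree gives the grading.

The weight spaces are finite dimensional. The retraction writes every global function as a constant
plus homogeneous functions of positive weight. Finitely many of the latter, together with constants
and coordinates, generate the rings of all standard charts, and `Hom(E, F)` is a finite module over
the polynomial ring in them (`finite_hom`). With homogeneous module generators, only finitely many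
products of a monomial and a generator have a given weight. The finiteness of `Hom` is the coherence
theorem for sections over a projective morphism, proved without cohomology: dévissage
(`Submodule.fg_of_fg_prime_subquotients`) reduces it to spaces of values in a residue field. Such
values have bounded denominators in every chart containing the point, because matrices in two charts
differ by transition matrices over the local ring (`exists_evalAt_mul_frameMatrix_eq`). A
homogeneous multiple of them is then integral over a homogeneous coordinate ring, whose
normalization is finite as `k` is perfect (`Submodule.fg_of_mul_mem_adjoin_div`).

Endomorphisms of weight zero are scalars (`weightSpace_zero_le`). All weights on `End(Eᵢ)` are
non-negative and the positive part of a function raises them, so on weight zero a function acts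
through its value at the fixed point. As `End(Eᵢ)` is generated by one element over the functions,
its weight zero part is at most a line, and it contains the identity.

The rest is arithmetic: since `|j - i| < n`, the degree `j - i + n r` is at most zero only if `r <
0`, or `r = 0` and `j ≤ i`. -/

theorem RingHom.Finite.of_comp_injective {P A C : Type*} [CommRing P] [CommRing A] [CommRing C]
    [IsNoetherianRing P] (α : P →+* A) (τ : A →+* C) (hτ : Function.Injective τ)
    (h : (τ.comp α).Finite) : α.Finite := by
  algebraize [α, τ, τ.comp α]
  exact Module.Finite.of_injective (IsScalarTower.toAlgHom P A C).toLinearMap hτ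

/-- Every `f` is a root of `T ^ (q ^ n) - f ^ (q ^ n)`, hence integral over the image. As Frobenius
is bijective on the constants, the variables generate the target over the image. -/
theorem MvPolynomial.finite_iterateFrobenius (k : Type*) [Field k] [PerfectField k] (s q n : ℕ)
    [ExpChar k q] [ExpChar (MvPolynomial (Fin s) k) q] :
    (iterateFrobenius (MvPolynomial (Fin s) k) q n).Finite := by
  refine RingHom.IsIntegral.to_finite (fun x => ?_) ?_
  · let := (iterateFrobenius (MvPolynomial (Fin s) k) q n).toAlgebra
    refine IsIntegral.of_pow (n := q ^ n) (pow_pos (expChar_pos k q) n) ?_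
    exact isIntegral_algebraMap (R := MvPolynomial (Fin s) k) (x := x)
  · refine RingHom.FiniteType.of_comp_finiteType (f := MvPolynomial.C) ?_
    have h : (iterateFrobenius (MvPolynomial (Fin s) k) q n).comp MvPolynomial.C =
        (MvPolynomial.C).comp (iterateFrobenius k q n) := by
      ext x
      simp [iterateFrobenius_def]
    rw [h]
    have : PerfectRing k q := PerfectField.toPerfectRing q
    have h2 : (iterateFrobenius k q n).FiniteType :=
      RingHom.FiniteType.of_surjective _ (bijective_iterateFrobenius k q n).2
    refine RingHom.FiniteType.comp ?_ h2
    exact RingHom.finiteType_algebraMap.mpr (inferInstanceAs (Algebra.FiniteType k (MvPolynomial (Fin s) k)))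

/-- For the separable part of `L` finiteness is classical. The rest is purely inseparable of bounded
exponent, so the power map `x ↦ x ^ (q ^ n)` embeds the integral closure in `L` into the one in the
separable part, semilinearly over a Frobenius of the polynomial ring, which is itself finite. -/
theorem MvPolynomial.finite_integralClosure (k : Type*) [Field k] [PerfectField k] (s : ℕ)
    (F L : Type*) [Field F] [Field L] [Algebra (MvPolynomial (Fin s) k) F]
    [IsFractionRing (MvPolynomial (Fin s) k) F] [Algebra F L] [Algebra (MvPolynomial (Fin s) k) L]
    [IsScalarTower (MvPolynomial (Fin s) k) F L] [FiniteDimensional F L] :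
    Module.Finite (MvPolynomial (Fin s) k) (integralClosure (MvPolynomial (Fin s) k) L) := by
  set P := MvPolynomial (Fin s) k
  obtain ⟨q, hq⟩ := ExpChar.exists k
  have : ExpChar P q := expChar_of_injective_ringHom (MvPolynomial.C_injective (Fin s) k) q
  have : ExpChar F q := expChar_of_injective_ringHom (IsFractionRing.injective P F) q
  have : ExpChar L q := expChar_of_injective_ringHom (algebraMap F L).injective q
  let E := separableClosure F L
  have : IsScalarTower P E L := IsScalarTower.of_algebraMap_eq fun x => by
    rw [IsScalarTower.algebraMap_apply P F L, IsScalarTower.algebraMap_apply P F E,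
      ← IsScalarTower.algebraMap_apply F E L]
  have : ExpChar E q := expChar_of_injective_ringHom (algebraMap F E).injective q
  have : FiniteDimensional E L := FiniteDimensional.right F E L
  obtain ⟨n, hn⟩ := (IsPurelyInseparable.hasExponent_iff' (K := E) (L := L) q).1 inferInstance
  have hfin : Module.Finite P (integralClosure P E) :=
    IsIntegralClosure.finite P F E (integralClosure P E)
  -- `g x` is `x ^ (q ^ n)`, viewed in the separable closure.
  choose! g hg using hn
  have hinj : Function.Injective (algebraMap E L) := (algebraMap E L).injective
  have hgint : ∀ x : L, IsIntegral P x → IsIntegral P (g x) := fun x hx => by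
    have := hx.pow (q ^ n)
    rw [← hg x] at this
    exact (isIntegral_algHom_iff (IsScalarTower.toAlgHom P E L) hinj).1 this
  have hg1 : g 1 = 1 := hinj (by rw [hg, one_pow, map_one])
  have hg0 : g 0 = 0 := hinj (by
    rw [hg, zero_pow (pow_pos (expChar_pos k q) n).ne', map_zero])
  have hgm : ∀ x y, g (x * y) = g x * g y := fun x y => hinj (by
    rw [hg, map_mul, hg, hg, mul_pow])
  have hga : ∀ x y, g (x + y) = g x + g y := fun x y => hinj (by
    rw [hg, map_add, hg, hg, add_pow_expChar_pow])
  let τ : integralClosure P L →+* integralClosure P E :=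
    { toFun x := ⟨g x.1, hgint x.1 x.2⟩
      map_one' := Subtype.ext hg1
      map_zero' := Subtype.ext hg0
      map_mul' x y := Subtype.ext (hgm x.1 y.1)
      map_add' x y := Subtype.ext (hga x.1 y.1) }
  have hτ : Function.Injective τ := fun x y hxy => by
    have h1 : g x.1 = g y.1 := congr_arg Subtype.val hxy
    have h2 := congr_arg (algebraMap E L) h1
    rw [hg, hg, ← iterateFrobenius_def, ← iterateFrobenius_def] at h2
    exact Subtype.ext (iterateFrobenius_inj L q n h2)
  refine RingHom.finite_algebraMap.1 (RingHom.Finite.of_comp_injective _ τ hτ ?_)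
  have h : τ.comp (algebraMap P (integralClosure P L)) =
      (algebraMap P (integralClosure P E)).comp (iterateFrobenius P q n) := by
    refine RingHom.ext fun x => Subtype.ext (hinj ?_)
    change algebraMap E L (g (algebraMap P L x)) = algebraMap E L (algebraMap P E (iterateFrobenius P q n x))
    rw [hg, iterateFrobenius_def, ← IsScalarTower.algebraMap_apply, map_pow]
  rw [h]
  exact RingHom.Finite.comp (RingHom.finite_algebraMap.2 hfin)
    (MvPolynomial.finite_iterateFrobenius k s q n)

/-- The normalization of a finitely generated domain over a perfect field is finite. -/
theorem finite_integralClosure_fractionRing (k D F : Type*) [Field k] [PerfectField k]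
    [CommRing D] [IsDomain D] [Algebra k D] [Algebra.FiniteType k D] [Field F] [Algebra D F]
    [IsFractionRing D F] : Module.Finite D (integralClosure D F) := by
  obtain ⟨s, g, hg, hfin⟩ := exists_finite_inj_algHom_of_fg k D
  set P := MvPolynomial (Fin s) k
  let : Algebra P D := g.toRingHom.toAlgebra
  let : Algebra P F := ((algebraMap D F).comp g.toRingHom).toAlgebra
  have : IsScalarTower P D F := IsScalarTower.of_algebraMap_eq fun _ => rfl
  have hPF : Function.Injective (algebraMap P F) := (IsFractionRing.injective D F).comp hg
  have : FaithfulSMul P F := (faithfulSMul_iff_algebraMap_injective P F).2 hPF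
  have : FaithfulSMul P D := (faithfulSMul_iff_algebraMap_injective P D).2 hg
  have : Module.Finite P D := hfin
  let : Algebra (FractionRing P) F := FractionRing.liftAlgebra P F
  have : FiniteDimensional (FractionRing P) F :=
    have : Algebra.IsIntegral P D := Algebra.IsIntegral.of_finite P D
    -- Every nonzero element of `D` divides a nonzero element of `P`, so inverting the latter
    -- already yields the fraction field.
    have : IsLocalization (Algebra.algebraMapSubmonoid D (nonZeroDivisors P)) F := by
      have hle : Algebra.algebraMapSubmonoid D (nonZeroDivisors P) ≤ nonZeroDivisors D := by
        rintro _ ⟨p, hp, rfl⟩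
        exact mem_nonZeroDivisors_of_ne_zero fun h => nonZeroDivisors.ne_zero hp (hg (by
          rw [map_zero]; exact h))
      refine (IsLocalization.iff_of_le_of_exists_dvd _ _ hle fun d hd => ?_).2
        (inferInstanceAs (IsLocalization (nonZeroDivisors D) F))
      obtain ⟨p, hp, hd'⟩ :=
        (Algebra.IsIntegral.isIntegral (R := P) d).isAlgebraic.exists_nonzero_dvd hd
      exact ⟨algebraMap P D p, ⟨p, mem_nonZeroDivisors_of_ne_zero hp, rfl⟩, hd'⟩
    Module.Finite.of_isLocalization P D (nonZeroDivisors P)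
  have h := MvPolynomial.finite_integralClosure k s (FractionRing P) F
  have hle : ∀ x : F, IsIntegral D x → IsIntegral P x := fun x hx => isIntegral_trans x hx
  let f : integralClosure P F →ₗ[P] integralClosure D F :=
    { toFun x := ⟨x.1, IsIntegral.tower_top x.2⟩
      map_add' _ _ := rfl
      map_smul' _ _ := by
        apply Subtype.ext
        change _ • _ = _ • _
        rfl }
  -- By transitivity, integrality over `D` and over `P` agree.
  have hf : Function.Surjective f := fun x => ⟨⟨x.1, hle _ x.2⟩, rfl⟩
  have := Module.Finite.of_surjective f hf
  exact Module.Finite.of_restrictScalars_finite P D _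

/-- The module generated by integral fractions over a finitely generated domain over a perfect field is
finitely generated. -/
theorem Submodule.fg_of_isIntegral_of_fraction (k : Type*) {D S : Type*} [Field k] [PerfectField k]
    [CommRing D] [IsDomain D] [Algebra k D] [Algebra.FiniteType k D] [CommRing S] [IsDomain S]
    [Algebra D S] [FaithfulSMul D S] (s : Set S)
    (hint : ∀ u ∈ s, IsIntegral D u)
    (hfrac : ∀ u ∈ s, ∃ d : D, d ≠ 0 ∧ d • u ∈ (algebraMap D S).range) :
    (Submodule.span D s).FG := by
  let L := FractionRing S
  have hDL : Function.Injective (algebraMap D L) := by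
    rw [IsScalarTower.algebraMap_eq D S L]
    exact (IsFractionRing.injective S L).comp (FaithfulSMul.algebraMap_injective D S)
  have : FaithfulSMul D L := (faithfulSMul_iff_algebraMap_injective D L).2 hDL
  let F := FractionRing D
  let : Algebra F L := FractionRing.liftAlgebra D L
  have h := finite_integralClosure_fractionRing k D F
  have : IsNoetherianRing D := Algebra.FiniteType.isNoetherianRing k D
  let f : integralClosure D F →ₗ[D] L :=
    ((IsScalarTower.toAlgHom D F L).comp (integralClosure D F).val).toLinearMap
  let j : S →ₗ[D] L := (IsScalarTower.toAlgHom D S L).toLinearMap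
  have hj : Function.Injective j := IsFractionRing.injective S L
  refine Submodule.fg_of_fg_map_injective j hj ?_
  -- Inside the fraction field of `S`, an integral fraction lies in the normalization of `D`, a
  -- Noetherian `D`-module.
  have hle : (Submodule.span D s).map j ≤ LinearMap.range f := by
    rw [Submodule.map_span, Submodule.span_le]
    rintro _ ⟨u, hu, rfl⟩
    obtain ⟨d, hd, e, he⟩ := hfrac u hu
    have hd' : algebraMap D F d ≠ 0 := by
      simpa using hd
    have hd'' : algebraMap D L d ≠ 0 := fun h0 => hd (hDL (by rw [h0, map_zero]))
    have hw : algebraMap F L (algebraMap D F e / algebraMap D F d) = j u := by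
      rw [map_div₀, ← IsScalarTower.algebraMap_apply, ← IsScalarTower.algebraMap_apply,
        div_eq_iff hd'', IsScalarTower.algebraMap_apply D S L, he, Algebra.smul_def, map_mul,
        ← IsScalarTower.algebraMap_apply, mul_comm]
      rfl
    refine ⟨⟨algebraMap D F e / algebraMap D F d, ?_⟩, hw⟩
    have hu' : IsIntegral D (j u) := (hint u hu).map (IsScalarTower.toAlgHom D S L)
    rw [← hw] at hu'
    exact (isIntegral_algHom_iff (IsScalarTower.toAlgHom D F L) (algebraMap F L).injective).1 hu'
  have : IsNoetherian D (LinearMap.range f) := isNoetherian_of_isNoetherianRing_of_finite _ _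
  exact (isNoetherian_submodule.1 this) _ hle

/-! ### Global sections of twists on projective integral schemes, algebraically -/

section ConeAlgebra

open Polynomial

variable (B : Type*) {K ι : Type*} [CommRing B] [Field K] [Algebra B K] (x : ι → K)

/-- The homogeneous coordinate ring `B[x_l X] ⊆ K[X]` of the point with homogeneous
coordinates `x`. -/
noncomputable def coneAlgebra : Subalgebra B K[X] := Algebra.adjoin B (Set.range fun l => C (x l) * X)

/-- The linear forms in the homogeneous coordinate ring. -/
noncomputable def coneSpan : Submodule B K[X] := Submodule.span B (Set.range fun l => C (x l) * X)

variable {B x}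

theorem mem_coneAlgebra (l : ι) : C (x l) * X ∈ coneAlgebra B x :=
  Algebra.subset_adjoin ⟨l, rfl⟩

theorem mem_coneSpan (l : ι) : C (x l) * X ∈ coneSpan B x :=
  Submodule.subset_span ⟨l, rfl⟩

/-- The generators are homogeneous of degree one, so the algebra is graded by the powers of `X`, and
its forms of degree `q` are products of `q` linear forms. -/
theorem coneAlgebra_coeff_mem : ∀ d ∈ coneAlgebra B x, ∀ q, C (d.coeff q) * X ^ q ∈ coneSpan B x ^ q := by
  intro d hd
  induction hd using Algebra.adjoin_induction with
  | mem d hd =>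
    obtain ⟨l, rfl⟩ := hd
    intro q
    by_cases hq : q = 1
    · subst hq
      simpa using mem_coneSpan (B := B) (x := x) l
    · have : (C (x l) * X).coeff q = 0 := by
        simp only [coeff_C_mul, coeff_X]
        rw [if_neg (Ne.symm hq), mul_zero]
      dsimp only
      rw [this, C_0, zero_mul]
      exact zero_mem _
  | algebraMap b =>
    intro q
    by_cases hq : q = 0
    · subst hq
      rw [pow_zero, pow_zero, mul_one]
      refine Submodule.mem_one.2 ⟨b, ?_⟩
      rw [Polynomial.algebraMap_apply, coeff_C_zero]
    · rw [Polynomial.algebraMap_apply, coeff_C_of_ne_zero hq, C_0, zero_mul]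
      exact zero_mem _
  | add d e _ _ h1 h2 =>
    intro q
    rw [coeff_add, C_add, add_mul]
    exact add_mem (h1 q) (h2 q)
  | mul d e _ _ h1 h2 =>
    intro q
    rw [coeff_mul, map_sum, Finset.sum_mul]
    refine sum_mem fun p hp => ?_
    rw [← Finset.HasAntidiagonal.mem_antidiagonal.1 hp, pow_add, pow_add, C_mul]
    convert Submodule.mul_mem_mul (h1 p.1) (h2 p.2) using 1
    ring

theorem mem_coneAlgebra_of_mem_pow : ∀ q, ∀ d ∈ coneSpan B x ^ q, d ∈ coneAlgebra B x := by
  intro q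
  induction q with
  | zero =>
    intro d hd
    obtain ⟨b, rfl⟩ := Submodule.mem_one.1 (by rwa [pow_zero] at hd)
    exact (coneAlgebra B x).algebraMap_mem b
  | succ q ih =>
    intro d hd
    rw [pow_succ] at hd
    refine Submodule.mul_induction_on hd (fun a ha b hb => mul_mem (ih a ha) ?_)
      fun a b ha hb => add_mem ha hb
    exact (Submodule.span_le (p := Subalgebra.toSubmodule (coneAlgebra B x))).2 (by
      rintro _ ⟨l, rfl⟩; exact mem_coneAlgebra l) hb

theorem eq_of_mem_coneSpan_pow : ∀ q, ∀ d ∈ coneSpan B x ^ q, d = C (d.coeff q) * X ^ q := by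
  intro q
  induction q with
  | zero =>
    intro d hd
    obtain ⟨b, rfl⟩ := Submodule.mem_one.1 (by rwa [pow_zero] at hd)
    rw [Polynomial.algebraMap_apply, coeff_C_zero, pow_zero, mul_one]
  | succ q ih =>
    intro d hd
    rw [pow_succ] at hd
    refine Submodule.mul_induction_on hd (fun a ha b hb => ?_) fun a b ha hb => ?_
    · rw [ih a ha]
      have hb' : b = C (b.coeff 1) * X := by
        refine Submodule.span_induction (p := fun b _ => b = C (b.coeff 1) * X)
          ?_ (by simp) (fun a b _ _ ha hb => ?_) (fun r b _ hb => ?_) hb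
        · rintro _ ⟨l, rfl⟩
          simp
        · conv_lhs => rw [ha, hb]
          rw [coeff_add, C_add, add_mul]
        · conv_lhs => rw [hb]
          rw [coeff_smul, ← smul_C, smul_mul_assoc]
      rw [hb']
      have : C (a.coeff q) * X ^ q * (C (b.coeff 1) * X) =
          C (a.coeff q * b.coeff 1) * X ^ (q + 1) := by
        rw [C_mul]; ring
      rw [this, coeff_C_mul, coeff_X_pow_self, mul_one]
    · conv_lhs => rw [ha, hb]
      rw [coeff_add, C_add, add_mul]

/-- Homogenization: a polynomial in the ratios `x l / x i` becomes a form once multiplied by a high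
enough power of `x i`. -/
theorem exists_mul_pow_mem_coneAlgebra : ∀ i, x i ≠ 0 →
    ∀ a ∈ Algebra.adjoin B (Set.range fun l => x l / x i),
      ∃ n₀, ∀ n, n₀ ≤ n → C (a * x i ^ n) * X ^ n ∈ coneAlgebra B x := by
  intro i hi a ha
  induction ha using Algebra.adjoin_induction with
  | mem a ha =>
    obtain ⟨l, rfl⟩ := ha
    refine ⟨1, fun n hn => ?_⟩
    obtain ⟨n, rfl⟩ := Nat.exists_eq_add_of_le hn
    have : C (x l / x i * x i ^ (1 + n)) * X ^ (1 + n) = (C (x l) * X) * (C (x i) * X) ^ n := by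
      have h : x l / x i * x i ^ (1 + n) = x l * x i ^ n := by
        field_simp
        ring
      rw [h, C_mul, C_pow]
      ring
    dsimp only
    rw [this]
    exact mul_mem (mem_coneAlgebra l) (pow_mem (mem_coneAlgebra i) n)
  | algebraMap b =>
    refine ⟨0, fun n _ => ?_⟩
    have : C (algebraMap B K b * x i ^ n) * X ^ n = algebraMap B K[X] b * (C (x i) * X) ^ n := by
      rw [C_mul, C_pow, Polynomial.algebraMap_apply]
      ring
    rw [this]
    exact mul_mem ((coneAlgebra B x).algebraMap_mem b) (pow_mem (mem_coneAlgebra i) n)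
  | add a b _ _ ha hb =>
    obtain ⟨n, hn⟩ := ha
    obtain ⟨m, hm⟩ := hb
    refine ⟨max n m, fun r hr => ?_⟩
    rw [add_mul, C_add, add_mul]
    exact add_mem (hn r ((le_max_left _ _).trans hr)) (hm r ((le_max_right _ _).trans hr))
  | mul a b _ _ ha hb =>
    obtain ⟨n, hn⟩ := ha
    obtain ⟨m, hm⟩ := hb
    refine ⟨n + m, fun r hr => ?_⟩
    obtain ⟨r, rfl⟩ := Nat.exists_eq_add_of_le hr
    have := mul_mem (hn (n + r) (by omega)) (hm m le_rfl)
    convert this using 1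
    simp only [C_mul, C_pow]
    ring

/-- Passes from linear forms to the irrelevant ideal, where containments between powers and radicals
are available. -/
theorem coneSpan_pow_le_ideal (q : ℕ) : ∀ d (hd : d ∈ coneSpan B x ^ q),
    (⟨d, mem_coneAlgebra_of_mem_pow q d hd⟩ : coneAlgebra B x) ∈ (Ideal.span
      (Set.range fun l => (⟨C (x l) * X, mem_coneAlgebra l⟩ : coneAlgebra B x))) ^ q := by
  set I := Ideal.span (Set.range fun l => (⟨C (x l) * X, mem_coneAlgebra l⟩ : coneAlgebra B x))
  let f : coneAlgebra B x →ₗ[B] K[X] := (coneAlgebra B x).val.toLinearMap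
  have h1 : coneSpan B x ≤ (I.restrictScalars B).map f := by
    refine Submodule.span_le.2 ?_
    rintro _ ⟨l, rfl⟩
    exact ⟨⟨C (x l) * X, mem_coneAlgebra l⟩, Ideal.subset_span ⟨l, rfl⟩, rfl⟩
  have h2 : coneSpan B x ^ q ≤ ((I ^ q).restrictScalars B).map f := by
    induction q with
    | zero =>
      intro d hd
      exact ⟨⟨d, mem_coneAlgebra_of_mem_pow 0 d hd⟩, by simp, rfl⟩
    | succ q ih =>
      rw [pow_succ, pow_succ]
      refine Submodule.mul_le.2 fun u hu v hv => ?_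
      obtain ⟨u', hu', rfl⟩ := ih hu
      obtain ⟨v', hv', rfl⟩ := h1 hv
      exact ⟨u' * v', Ideal.mul_mem_mul hu' hv', rfl⟩
  intro d hd
  obtain ⟨e, he, hed⟩ := h2 hd
  have : e = ⟨d, mem_coneAlgebra_of_mem_pow q d hd⟩ := Subtype.ext hed
  exact this ▸ he

/-- A homogeneous element that multiplies a power of each coordinate into the homogeneous
coordinate ring is integral over it. -/
theorem isIntegral_coneAlgebra [Finite ι] (a : K) (N m : ℕ) (hx : ∃ i, x i ≠ 0)
    (hm : ∀ i, C a * X ^ N * (C (x i) * X) ^ m ∈ coneAlgebra B x) :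
    IsIntegral (coneAlgebra B x) (C a * X ^ N) := by
  set u : K[X] := C a * X ^ N with hu
  obtain ⟨i₀, hi₀⟩ := hx
  let I : Ideal (coneAlgebra B x) :=
    Ideal.span (Set.range fun l => (⟨C (x l) * X, mem_coneAlgebra l⟩ : coneAlgebra B x))
  let J : Ideal (coneAlgebra B x) :=
    Ideal.span (Set.range fun l => (⟨C (x l) * X, mem_coneAlgebra l⟩ : coneAlgebra B x) ^ m)
  have hIJ : I ≤ J.radical := by
    refine Ideal.span_le.2 ?_
    rintro _ ⟨l, rfl⟩
    exact ⟨m, Ideal.subset_span ⟨l, rfl⟩⟩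
  -- All forms of a large degree `q` lie in the ideal generated by the `m`-th powers of the
  -- coordinates, which `u` multiplies into the coordinate ring.
  obtain ⟨q, hq⟩ := Ideal.exists_pow_le_of_le_radical_of_fg hIJ
    (Submodule.fg_span (Set.finite_range _))
  have hJ : ∀ d : coneAlgebra B x, d ∈ J → u * (d : K[X]) ∈ coneAlgebra B x := by
    intro d hd
    induction hd using Submodule.span_induction with
    | mem d hd =>
      obtain ⟨l, rfl⟩ := hd
      exact hm l
    | zero => simp
    | add d e _ _ hd he =>
      rw [AddMemClass.coe_add, mul_add]
      exact add_mem hd he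
    | smul r d _ hd =>
      rw [smul_eq_mul, MulMemClass.coe_mul, mul_left_comm]
      exact mul_mem r.2 hd
  -- The module generated by the forms of degree `q` is finitely generated, nonzero and stable under
  -- `u`, so the determinant trick applies.
  let M : Submodule (coneAlgebra B x) K[X] :=
    Submodule.span (coneAlgebra B x) ((coneSpan B x ^ q : Submodule B K[X]) : Set K[X])
  refine isIntegral_of_smul_mem_submodule (M := K[X]) M ?_ ?_ u ?_
  · intro h
    have : (C (x i₀) * X) ^ q ∈ M := Submodule.subset_span
      (Submodule.pow_mem_pow _ (mem_coneSpan i₀) q)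
    rw [h] at this
    exact pow_ne_zero q (mul_ne_zero (C_ne_zero.2 hi₀) X_ne_zero) ((Submodule.mem_bot _).1 this)
  · have hYfg : (coneSpan B x ^ q).FG := (Submodule.fg_span (Set.finite_range _)).pow q
    obtain ⟨T, hT⟩ := hYfg
    refine ⟨T, le_antisymm (Submodule.span_mono ?_) (Submodule.span_le.2 ?_)⟩
    · rw [← hT]; exact Submodule.subset_span
    · rw [← hT]
      exact Submodule.span_subset_span B (coneAlgebra B x) _
  · intro v hv
    rw [smul_eq_mul]
    induction hv using Submodule.span_induction with
    | mem d hd =>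
      have h0 : (⟨d, mem_coneAlgebra_of_mem_pow q d hd⟩ : coneAlgebra B x) ∈ I ^ q :=
        coneSpan_pow_le_ideal q d hd
      have h1 : u * d ∈ coneAlgebra B x := hJ ⟨d, mem_coneAlgebra_of_mem_pow q d hd⟩ (hq h0)
      have h2 : u * d = C (a * d.coeff q) * X ^ (N + q) := by
        rw [hu]
        conv_lhs => rw [eq_of_mem_coneSpan_pow q d hd]
        simp only [C_mul]
        ring
      have h3 := coneAlgebra_coeff_mem _ h1 (N + q)
      have h4 : C ((u * d).coeff (N + q)) * X ^ (N + q) = u * d := by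
        rw [h2, coeff_C_mul, coeff_X_pow_self, mul_one]
      -- The product is a form of degree `N + q`, hence a sum of products of forms of degrees `N`
      -- and `q`.
      rw [h4, pow_add] at h3
      refine Submodule.mul_induction_on h3 (fun w hw v hv => ?_) fun _ _ => add_mem
      exact M.smul_mem ⟨w, mem_coneAlgebra_of_mem_pow _ w hw⟩ (Submodule.subset_span hv)
    | zero => rw [mul_zero]; exact zero_mem _
    | add v w _ _ hv hw =>
      rw [mul_add]
      exact add_mem hv hw
    | smul d v _ hv =>
      have : u * d • v = d • (u * v) := by
        rw [Algebra.smul_def, Algebra.smul_def, mul_left_comm]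
      rw [this]
      exact M.smul_mem d hv

/-- The multiplier is the product of the homogenized denominators of all charts: in chart `i` the
factor with index `i` clears the denominator of `g`, and the other factors already lie in the
coordinate ring. -/
theorem exists_homogeneous_multiplier [Finite ι] (G : Submodule B K) (c : ι → K)
    (hc0 : ∀ i, x i ≠ 0 → c i ≠ 0)
    (hc : ∀ i, x i ≠ 0 → c i ∈ Algebra.adjoin B (Set.range fun l => x l / x i))
    (hG : ∀ i, x i ≠ 0 → ∀ g ∈ G, c i * g ∈ Algebra.adjoin B (Set.range fun l => x l / x i)) :
    ∃ (a : K) (N : ℕ), a ≠ 0 ∧ ∀ g ∈ G, ∀ i, ∃ n₀, ∀ n, n₀ ≤ n →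
      C (a * g) * X ^ N * (C (x i) * X) ^ n ∈ coneAlgebra B x := by
  classical
  cases nonempty_fintype ι
  let s : Finset ι := Finset.univ.filter fun i => x i ≠ 0
  have hs : ∀ i, i ∈ s ↔ x i ≠ 0 := fun i => by simp [s]
  obtain ⟨N, hN⟩ : ∃ N, ∀ i ∈ s, C (c i * x i ^ N) * X ^ N ∈ coneAlgebra B x := by
    have : ∀ i, ∃ n₀, ∀ n, n₀ ≤ n → i ∈ s → C (c i * x i ^ n) * X ^ n ∈ coneAlgebra B x := fun i => by
      by_cases hi : x i ≠ 0
      · obtain ⟨n, hn⟩ := exists_mul_pow_mem_coneAlgebra i hi _ (hc i hi)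
        exact ⟨n, fun m hm _ => hn m hm⟩
      · exact ⟨0, fun m _ h => absurd ((hs i).1 h) hi⟩
    choose n hn using this
    exact ⟨∑ i, n i, fun i hi => hn i _ (Finset.single_le_sum (fun _ _ => Nat.zero_le _)
      (Finset.mem_univ i)) hi⟩
  let P : K[X] := ∏ i ∈ s, (C (c i * x i ^ N) * X ^ N)
  let a : K := ∏ i ∈ s, (c i * x i ^ N)
  let N' : ℕ := N * s.card
  have hP : P = C a * X ^ N' := by
    simp only [P, a, N']
    rw [Finset.prod_mul_distrib, ← map_prod, Finset.prod_const, pow_mul]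
  have ha : a ≠ 0 := Finset.prod_ne_zero_iff.2 fun i hi =>
    mul_ne_zero (hc0 i ((hs i).1 hi)) (pow_ne_zero _ ((hs i).1 hi))
  have hmul : ∀ g ∈ G, ∀ i, ∃ n₀, ∀ n, n₀ ≤ n → P * C g * (C (x i) * X) ^ n ∈ coneAlgebra B x := by
    intro g hg i
    by_cases hi : x i ≠ 0
    · obtain ⟨n, hn⟩ := exists_mul_pow_mem_coneAlgebra i hi _ (hG i hi g hg)
      refine ⟨n, fun m hm => ?_⟩
      have : P * C g * (C (x i) * X) ^ m = (∏ j ∈ s.erase i, (C (c j * x j ^ N) * X ^ N)) *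
          (C (c i * g * x i ^ (N + m)) * X ^ (N + m)) := by
        simp only [P]
        rw [← Finset.prod_erase_mul _ _ ((hs i).2 hi)]
        simp only [C_mul, C_pow]
        ring
      rw [this]
      exact mul_mem (prod_mem fun j hj => hN j (Finset.mem_of_mem_erase hj)) (hn _ (by omega))
    -- If `x i = 0`, any positive power of the coordinate vanishes and nothing is claimed.
    · refine ⟨1, fun n hn => ?_⟩
      have : C (x i) * X = 0 := by rw [not_not.1 hi, C_0, zero_mul]
      rw [this, zero_pow (by omega), mul_zero]
      exact zero_mem _
  refine ⟨a, N', ha, fun g hg i => ?_⟩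
  obtain ⟨n, hn⟩ := hmul g hg i
  refine ⟨n, fun m hm => ?_⟩
  have : C (a * g) * X ^ N' = P * C g := by
    rw [hP, C_mul]
    ring
  rw [this]
  exact hn m hm

/-- The elements are integral over the coordinate ring by `isIntegral_coneAlgebra`, and a power of a
nonzero coordinate is a denominator for each, so they lie in its finite normalization. -/
theorem fg_span_coneAlgebra (k : Type*) [Field k] [PerfectField k]
    [Algebra k B] [Algebra.FiniteType k B] [Finite ι] (hx : ∃ i, x i ≠ 0) (s : Set K) (N : ℕ)
    (hs : ∀ g ∈ s, ∀ i, ∃ n₀, ∀ n, n₀ ≤ n →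
      C g * X ^ N * (C (x i) * X) ^ n ∈ coneAlgebra B x) :
    (Submodule.span (coneAlgebra B x) ((fun g => C g * X ^ N) '' s)).FG := by
  cases nonempty_fintype ι
  let _ : Algebra k (coneAlgebra B x) :=
    ((algebraMap B (coneAlgebra B x)).comp (algebraMap k B)).toAlgebra
  have : IsScalarTower k B (coneAlgebra B x) := IsScalarTower.of_algebraMap_eq fun _ => rfl
  have : Algebra.FiniteType B (coneAlgebra B x) :=
    (Subalgebra.fg_iff_finiteType _).1 (Subalgebra.fg_def.2 ⟨_, Set.finite_range _, rfl⟩)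
  have : Algebra.FiniteType k (coneAlgebra B x) :=
    Algebra.FiniteType.trans (S := B) inferInstance inferInstance
  have : FaithfulSMul (coneAlgebra B x) K[X] :=
    (faithfulSMul_iff_algebraMap_injective (coneAlgebra B x) K[X]).2 Subtype.val_injective
  refine Submodule.fg_of_isIntegral_of_fraction k _ ?_ ?_
  · rintro _ ⟨g, hg, rfl⟩
    choose n hn using hs g hg
    exact isIntegral_coneAlgebra g N (∑ i, n i) hx fun i =>
      hn i _ (Finset.single_le_sum (fun _ _ => Nat.zero_le _) (Finset.mem_univ i))
  · rintro _ ⟨g, hg, rfl⟩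
    obtain ⟨i₀, hi₀⟩ := hx
    obtain ⟨n, hn⟩ := hs g hg i₀
    refine ⟨⟨(C (x i₀) * X) ^ n, pow_mem (mem_coneAlgebra i₀) n⟩, fun h => ?_, ?_⟩
    · exact pow_ne_zero n (mul_ne_zero (C_ne_zero.2 hi₀) X_ne_zero) (congr_arg Subtype.val h)
    · have h := hn n le_rfl
      refine RingHom.mem_range.2 ⟨⟨_, h⟩, ?_⟩
      dsimp only
      rw [Algebra.smul_def]
      change C g * X ^ N * (C (x i₀) * X) ^ n = (C (x i₀) * X) ^ n * (C g * X ^ N)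
      ring

/-- All generators have the same degree `N`. In the coefficient of `X ^ N` of a relation only the
degree zero parts of the coefficients count, and these are constants from `B`. -/
theorem fg_of_fg_span_coneAlgebra (G : Submodule B K) (a : K) (ha : a ≠ 0) (N : ℕ)
    (hfg : (Submodule.span (coneAlgebra B x) ((fun g => C (a * g) * X ^ N) '' (G : Set K))).FG) :
    G.FG := by
  classical
  obtain ⟨T, hT, hTG⟩ := Submodule.fg_span_iff_fg_span_finset_subset _ |>.1 hfg
  obtain ⟨T', hT', rfl⟩ := Finset.subset_set_image_iff.1 hT
  refine ⟨T', le_antisymm (Submodule.span_le.2 hT') fun g hg => ?_⟩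
  have hmem : C (a * g) * X ^ N ∈ Submodule.span (coneAlgebra B x) (((T'.image fun g => C (a * g) * X ^ N : Finset K[X])) : Set K[X]) :=
    hTG ▸ Submodule.subset_span ⟨g, hg, rfl⟩
  rw [Finset.coe_image] at hmem
  obtain ⟨d, hd⟩ := (Submodule.mem_span_image_finset_iff_exists_fun (coneAlgebra B x)).1 hmem
  have h5 := congr_arg (fun v => v.coeff N) hd
  simp only [finsetSum_coeff] at h5
  have h6 : ∀ g : K, (C (a * g) * X ^ N).coeff N = a * g := fun g => by
    rw [coeff_C_mul, coeff_X_pow_self, mul_one]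
  have h7 : ∀ (d : coneAlgebra B x) (g : K), (d • (C (a * g) * X ^ N)).coeff N = (d : K[X]).coeff 0 * (a * g) := by
    intro d g
    rw [Algebra.smul_def, ← mul_assoc]
    change ((d : K[X]) * C (a * g) * X ^ N).coeff N = _
    have := coeff_mul_X_pow ((d : K[X]) * C (a * g)) N 0
    rw [zero_add] at this
    rw [this, coeff_mul_C]
  simp only [h6, h7] at h5
  have h8 : ∀ d : coneAlgebra B x, ∃ b : B, algebraMap B K b = (d : K[X]).coeff 0 := fun d => by
    have := coneAlgebra_coeff_mem _ d.2 0
    rw [pow_zero, pow_zero, mul_one] at this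
    obtain ⟨b, hb⟩ := Submodule.mem_one.1 this
    rw [Polynomial.algebraMap_apply] at hb
    exact ⟨b, C_injective hb⟩
  choose b hb using h8
  have h9 : g = ∑ t : T', b (d t) • (t : K) := by
    apply mul_left_cancel₀ ha
    rw [← h5, Finset.mul_sum]
    refine Finset.sum_congr rfl fun t _ => ?_
    rw [← hb, Algebra.smul_def]
    ring
  rw [h9]
  exact sum_mem fun t _ => Submodule.smul_mem _ _ (Submodule.subset_span t.2)

/-- If `G` is bounded, up to denominators, by the structure sheaf of a projective integral scheme
on each of its standard charts, then `G` is finitely generated. -/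
theorem Submodule.fg_of_mul_mem_adjoin_div (k : Type*) [Field k] [PerfectField k]
    [Algebra k B] [Algebra.FiniteType k B] [Finite ι]
    (hx : ∃ i, x i ≠ 0) (G : Submodule B K) (c : ι → K)
    (hc0 : ∀ i, x i ≠ 0 → c i ≠ 0)
    (hc : ∀ i, x i ≠ 0 → c i ∈ Algebra.adjoin B (Set.range fun l => x l / x i))
    (hG : ∀ i, x i ≠ 0 → ∀ g ∈ G, c i * g ∈ Algebra.adjoin B (Set.range fun l => x l / x i)) :
    G.FG := by
  obtain ⟨a, N, ha, h⟩ := exists_homogeneous_multiplier G c hc0 hc hG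
  refine fg_of_fg_span_coneAlgebra (x := x) G a ha N ?_
  have := fg_span_coneAlgebra (x := x) (B := B) k hx ((fun g => a * g) '' (G : Set K)) N (by
    rintro _ ⟨g, hg, rfl⟩
    exact h g hg)
  rwa [Set.image_image] at this

end ConeAlgebra

/-! ### Dévissage -/

/-- A subgroup of a finitely generated module over a Noetherian algebra is finitely generated if its
images in all prime cyclic subquotients are. -/
theorem Submodule.fg_of_fg_prime_subquotients {B C M : Type*} [CommRing B]
    [CommRing C] [IsNoetherianRing C] [Algebra B C] [AddCommGroup M] [Module C M] [Module B M]
    [IsScalarTower B C M] [Module.Finite C M] (G : Submodule B M)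
    (H : ∀ (P : Ideal C) (_ : P.IsPrime) (Y : Submodule C M) (l : Y →ₗ[C] C ⧸ P),
      ((G.comap (Y.subtype.restrictScalars B)).map (l.restrictScalars B)).FG) : G.FG := by
  have : IsNoetherian C M := isNoetherian_of_isNoetherianRing_of_finite C M
  -- Noetherian induction on the `C`-submodules whose intersection with `G` is finitely generated
  -- over `B`.
  obtain ⟨X, hX, hmax⟩ := WellFounded.has_min (wellFounded_gt : WellFounded
    ((· > ·) : Submodule C M → Submodule C M → Prop))
    {X | (G ⊓ X.restrictScalars B).FG} ⟨⊥, by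
      simp only [Set.mem_ofPred_eq, Submodule.restrictScalars_bot, inf_bot_eq]
      exact Submodule.fg_bot⟩
  by_cases htop : X = ⊤
  · subst htop
    simpa using hX
  exfalso
  have : Nontrivial (M ⧸ X) := Submodule.Quotient.nontrivial_iff.2 htop
  -- An associated prime of `M ⧸ X` gives a strictly larger `Y` with `Y / X ≅ C ⧸ P`. The hypothesis
  -- on `P` controls the new quotient and contradicts maximality.
  obtain ⟨P, hP⟩ := associatedPrimes.nonempty C (M ⧸ X)
  obtain ⟨hPp, f, hf⟩ := (isAssociatedPrime_iff_exists_injective_linearMap P (M ⧸ X)).1 hP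
  let Y : Submodule C M := (LinearMap.range f).comap X.mkQ
  let e := LinearEquiv.ofInjective f hf
  let l : Y →ₗ[C] C ⧸ P := e.symm.toLinearMap.comp
    ((X.mkQ.comp Y.subtype).codRestrict (LinearMap.range f) fun y => y.2)
  have hl : ∀ y : Y, f (l y) = X.mkQ y := fun y =>
    congr_arg Subtype.val (e.apply_symm_apply
      ((X.mkQ.comp Y.subtype).codRestrict (LinearMap.range f) (fun y => y.2) y))
  have hXY : X < Y := by
    refine lt_of_le_of_ne (fun x hx => ?_) fun h => ?_
    · refine ⟨0, ?_⟩
      rw [map_zero, eq_comm]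
      exact (Submodule.Quotient.mk_eq_zero X).2 hx
    · obtain ⟨m, hm⟩ := X.mkQ_surjective (f 1)
      have hmY : m ∈ Y := ⟨1, hm.symm⟩
      rw [← h] at hmY
      have h0 : f 1 = 0 := by
        rw [← hm]
        exact (Submodule.Quotient.mk_eq_zero X).2 hmY
      have : Nontrivial (C ⧸ P) := Ideal.Quotient.nontrivial_iff.2 hPp.ne_top
      exact one_ne_zero (hf (h0.trans (map_zero f).symm))
  refine hmax Y ?_ hXY
  have hfg : (G.comap (Y.subtype.restrictScalars B)).FG := by
    refine Submodule.fg_of_fg_map_of_fg_inf_ker (l.restrictScalars B) (H P hPp Y l) ?_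
    refine Submodule.fg_of_fg_map_injective (Y.subtype.restrictScalars B) Subtype.val_injective ?_
    have hX' : (G ⊓ X.restrictScalars B).FG := hX
    convert hX' using 1
    ext m
    constructor
    · rintro ⟨y, ⟨hyG, hyl⟩, rfl⟩
      refine ⟨hyG, ?_⟩
      have hyl' : l y = 0 := hyl
      have := hl y
      rw [hyl', map_zero, eq_comm] at this
      exact (Submodule.Quotient.mk_eq_zero X).1 this
    · rintro ⟨hmG, hmX⟩
      refine ⟨⟨m, hXY.le hmX⟩, ⟨hmG, ?_⟩, rfl⟩
      refine hf ?_
      change f (l ⟨m, hXY.le hmX⟩) = f 0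
      rw [hl, map_zero]
      exact (Submodule.Quotient.mk_eq_zero X).2 hmX
  change (G ⊓ Y.restrictScalars B).FG
  convert hfg.map (Y.subtype.restrictScalars B)
  ext m
  exact ⟨fun h => ⟨⟨m, h.2⟩, h.1, rfl⟩, by rintro ⟨y, hy, rfl⟩; exact ⟨hy, y.2⟩⟩

/-- A linear map from a submodule to a field extension of a residue field is bounded on every chart
containing the point. -/
theorem exists_fg_of_isLocalizedModule {C₀ C O κ M₀ Mx M : Type*} [CommRing C₀] [CommRing C]
    [CommRing O] [CommRing κ] [Algebra C₀ O] [Algebra C O] [Algebra O κ] [Algebra C₀ κ]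
    [Algebra C κ] [IsScalarTower C₀ O κ] [IsScalarTower C O κ] (S : Submonoid C₀)
    [IsLocalization S O] [AddCommGroup M₀] [Module C₀ M₀] [AddCommGroup Mx] [Module O Mx]
    [Module C₀ Mx] [Module C Mx] [IsScalarTower C₀ O Mx] [IsScalarTower C O Mx]
    (loc : M₀ →ₗ[C₀] Mx) [IsLocalizedModule S loc] [AddCommGroup M] [Module C M]
    [IsNoetherian C M] (τ : M →ₗ[C] Mx) (Y : Submodule C₀ M₀) (l : Y →ₗ[C₀] κ) :
    ∃ J : Submodule C κ, J.FG ∧ ∀ (v : M) (y : Y), τ v = loc y → l y ∈ J := by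
  -- Elements of `S` become units in `O`, hence act invertibly on `κ`; therefore `l` extends to the
  -- localization of `Y`.
  have hunit : ∀ s : S, IsUnit (algebraMap C₀ (Module.End C₀ κ) s) := fun s => by
    have h : IsUnit (algebraMap C₀ κ s) := by
      rw [IsScalarTower.algebraMap_apply C₀ O κ]
      exact (IsLocalization.map_units O s).map _
    rw [Module.End.isUnit_iff]
    have : ∀ x, algebraMap C₀ (Module.End C₀ κ) s x = algebraMap C₀ κ s * x := fun x => by
      rw [Module.algebraMap_end_apply, Algebra.smul_def]
    obtain ⟨w, hw⟩ := h
    refine ⟨fun x y hxy => ?_, fun x => ⟨↑w⁻¹ * x, ?_⟩⟩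
    · rw [this, this, ← hw] at hxy
      exact w.isUnit.mul_left_cancel hxy
    · rw [this, ← hw, ← mul_assoc, Units.mul_inv, one_mul]
  let L : Submodule O Mx := Y.localized' O S loc
  let g : Y →ₗ[C₀] L := Y.toLocalized' O S loc
  let l' : L →ₗ[O] κ := (IsLocalizedModule.lift S g l hunit).extendScalarsOfIsLocalization S O
  have hl' : ∀ y, l' (g y) = l y := fun y => IsLocalizedModule.lift_apply S g l hunit y
  -- The vectors of the second chart that land in the localized `Y` form a finitely generated
  -- module, as `M` is Noetherian. Its image in `κ` is the required bound.
  let K : Submodule C M := (L.restrictScalars C).comap τ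
  let f : K →ₗ[C] κ := (l'.restrictScalars C).comp
    ((τ.comp K.subtype).codRestrict (L.restrictScalars C) fun v => v.2)
  refine ⟨LinearMap.range f, (Submodule.FG.map f (Module.Finite.fg_top (R := C) (M := K)) |> fun h => by
    rwa [Submodule.map_top] at h), fun v y hvy => ?_⟩
  have hv : v ∈ K := by
    change τ v ∈ L
    rw [hvy]
    exact (g y).2
  refine ⟨⟨v, hv⟩, ?_⟩
  rw [← hl']
  change l' _ = l' _
  congr 1
  exact Subtype.ext hvy

theorem Submodule.FG.exists_common_denominator {C κ : Type*} [CommRing C] [Field κ] [Algebra C κ]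
    (hfrac : ∀ z : κ, ∃ a d : C, algebraMap C κ d ≠ 0 ∧ algebraMap C κ d * z = algebraMap C κ a)
    {J : Submodule C κ} (hJ : J.FG) :
    ∃ c : C, algebraMap C κ c ≠ 0 ∧
      ∀ z ∈ J, ∃ a : C, algebraMap C κ c * z = algebraMap C κ a := by
  induction J, hJ using Submodule.fg_induction with
  | singleton x =>
    obtain ⟨a, d, hd, h⟩ := hfrac x
    refine ⟨d, hd, fun z hz => ?_⟩
    obtain ⟨r, rfl⟩ := Submodule.mem_span_singleton.1 hz
    exact ⟨r * a, by rw [Algebra.smul_def, mul_left_comm, h, map_mul]⟩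
  | sup J₁ J₂ _ _ h₁ h₂ =>
    obtain ⟨c₁, hc₁, h₁⟩ := h₁
    obtain ⟨c₂, hc₂, h₂⟩ := h₂
    refine ⟨c₁ * c₂, by rw [map_mul]; exact mul_ne_zero hc₁ hc₂, fun z hz => ?_⟩
    obtain ⟨z₁, hz₁, z₂, hz₂, rfl⟩ := Submodule.mem_sup.1 hz
    obtain ⟨a₁, h₁⟩ := h₁ z₁ hz₁
    obtain ⟨a₂, h₂⟩ := h₂ z₂ hz₂
    refine ⟨c₂ * a₁ + c₁ * a₂, ?_⟩
    rw [map_add, map_mul, map_mul, map_mul, ← h₁, ← h₂]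
    ring

noncomputable section

namespace BondalQuiver

/-! ### Standard charts of projective schemes -/

namespace ProjectiveSpace

variable {m : ℕ} {B : CommRingCat.{u}}

theorem X_mem (i : Fin (m + 1)) :
    (MvPolynomial.X i : MvPolynomial (Fin (m + 1)) B) ∈
      MvPolynomial.homogeneousSubmodule (Fin (m + 1)) B 1 :=
  MvPolynomial.isHomogeneous_X B i

/-- The standard chart `D₊(xᵢ)`. -/
abbrev chart (m : ℕ) (B : CommRingCat.{u}) (i : Fin (m + 1)) : (ProjectiveSpace m B).Opens :=
  Proj.basicOpen (MvPolynomial.homogeneousSubmodule (Fin (m + 1)) B) (MvPolynomial.X i)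

/-- The fraction `x_l / xᵢ` in the homogeneous localization. -/
def ratio (i l : Fin (m + 1)) : HomogeneousLocalization.Away
    (MvPolynomial.homogeneousSubmodule (Fin (m + 1)) B) (MvPolynomial.X i) :=
  HomogeneousLocalization.Away.mk _ (X_mem i) 1 (MvPolynomial.X l) (by
    rw [smul_eq_mul, mul_one]
    exact X_mem l)

/-- The function `x_l / xᵢ` on the standard chart `D₊(xᵢ)`. -/
def coord (i l : Fin (m + 1)) : Γ(ProjectiveSpace m B, chart m B i) :=
  Proj.awayToSection (MvPolynomial.homogeneousSubmodule (Fin (m + 1)) B) (MvPolynomial.X i)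
    (ratio i l)

theorem isAffineOpen_chart (i : Fin (m + 1)) : IsAffineOpen (chart m B i) :=
  Proj.isAffineOpen_basicOpen _ _ (X_mem i) one_pos

theorem iSup_chart : ⨆ i, chart m B i = ⊤ := by
  refine Proj.iSup_basicOpen_eq_top' _ _ (fun i => ⟨1, X_mem i⟩) ?_
  refine eq_top_iff.2 fun p _ => ?_
  induction p using MvPolynomial.induction_on with
  | C a =>
    exact Subalgebra.algebraMap_mem _ (⟨MvPolynomial.C a, MvPolynomial.isHomogeneous_C _ a⟩ :
      MvPolynomial.homogeneousSubmodule (Fin (m + 1)) B 0)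
  | add p q hp hq => exact add_mem (hp trivial) (hq trivial)
  | mul_X p i hp => exact mul_mem (hp trivial) (Algebra.subset_adjoin ⟨i, rfl⟩)

theorem coord_self (i : Fin (m + 1)) : coord (B := B) i i = 1 := by
  have : ratio (B := B) i i = 1 := by
    apply HomogeneousLocalization.val_injective
    rw [ratio, HomogeneousLocalization.Away.val_mk, HomogeneousLocalization.val_one]
    convert Localization.mk_self (⟨MvPolynomial.X i, 1, pow_one _⟩ : Submonoid.powers
      (MvPolynomial.X i : MvPolynomial (Fin (m + 1)) B)) using 2
    exact Subtype.ext (pow_one _)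
  rw [coord, this, map_one]

theorem val_coord (i l : Fin (m + 1)) (p : ProjectiveSpace m B) (hp : p ∈ chart m B i) :
    ((coord (B := B) i l).1 ⟨p, hp⟩).val =
      Localization.mk (MvPolynomial.X l) ⟨MvPolynomial.X i, hp⟩ := by
  rw [coord]
  erw [ProjectiveSpectrum.Proj.awayToSection_apply]
  rw [ratio, HomogeneousLocalization.Away.val_mk, Localization.mk_eq_mk', IsLocalization.map_mk',
    ← Localization.mk_eq_mk']
  simp

theorem coord_mul (i j l : Fin (m + 1)) {W : (ProjectiveSpace m B).Opens}
    (hi : W ≤ chart m B i) (hj : W ≤ chart m B j) :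
    (ProjectiveSpace m B).presheaf.map (homOfLE hi).op (coord i l) =
      (ProjectiveSpace m B).presheaf.map (homOfLE hj).op (coord j l) *
        (ProjectiveSpace m B).presheaf.map (homOfLE hi).op (coord i j) := by
  apply Subtype.ext
  ext ⟨p, hp⟩
  change ((coord (B := B) i l).1 ⟨p, hi hp⟩).val =
    ((coord (B := B) j l).1 ⟨p, hj hp⟩ * (coord (B := B) i j).1 ⟨p, hi hp⟩).val
  rw [HomogeneousLocalization.val_mul]
  refine (val_coord i l p (hi hp)).trans (Eq.trans ?_
    (congrArg₂ (· * ·) (val_coord j l p (hj hp)) (val_coord i j p (hi hp))).symm)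
  rw [Localization.mk_mul]
  refine Localization.mk_eq_mk_iff.2 (Localization.r_iff_exists.2 ⟨1, ?_⟩)
  simp
  ring

/-- Where `x_j / x_i` is invertible, its numerator lies outside the prime of the point. -/
theorem basicOpen_coord_le (i j : Fin (m + 1)) :
    (ProjectiveSpace m B).basicOpen (coord i j) ≤ chart m B j := by
  intro p hp hpj
  have hpi : p ∈ chart m B i := (ProjectiveSpace m B).basicOpen_le _ hp
  have hu := RingedSpace.isUnit_res_basicOpen (ProjectiveSpace m B).toRingedSpace (coord i j)
  obtain ⟨w, hw⟩ := hu.exists_right_inv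
  have h1 := congr_fun (congr_arg Subtype.val hw) ⟨p, hp⟩
  change (coord (B := B) i j).1 ⟨p, hpi⟩ * w.1 ⟨p, hp⟩ = 1 at h1
  have h2 := congr_arg HomogeneousLocalization.val h1
  rw [HomogeneousLocalization.val_mul, val_coord, HomogeneousLocalization.val_one] at h2
  have h3 := IsUnit.of_mul_eq_one _ h2
  rw [Localization.mk_eq_mk'] at h3
  have hprime : p.asHomogeneousIdeal.toIdeal.IsPrime := p.isPrime
  exact (IsLocalization.AtPrime.isUnit_mk'_iff
    (Localization p.asHomogeneousIdeal.toIdeal.primeCompl) p.asHomogeneousIdeal.toIdeal _ _).1 h3 hpj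

/-- The constant functions on a standard chart. -/
theorem res_toSpec_appTop (i : Fin (m + 1)) (r : B) :
    res (chart m B i) ((toSpec m B).appTop ((Scheme.ΓSpecIso B).inv r)) =
      Proj.awayToSection (MvPolynomial.homogeneousSubmodule (Fin (m + 1)) B) (MvPolynomial.X i)
        (algebraMap (MvPolynomial.homogeneousSubmodule (Fin (m + 1)) B 0) _
          (algebraMap B _ r)) := by
  set 𝒜 := MvPolynomial.homogeneousSubmodule (Fin (m + 1)) B
  have h1 : (chart m B i).ι ≫ Proj.toSpecZero 𝒜 = Proj.basicOpenToSpec 𝒜 (MvPolynomial.X i) ≫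
      Spec.map (CommRingCat.ofHom (HomogeneousLocalization.fromZeroRingHom 𝒜 _)) := by
    rw [← Proj.awayι_toSpecZero 𝒜 _ (X_mem i) one_pos, ← Proj.basicOpenIsoSpec_hom 𝒜 _ (X_mem i) one_pos,
      Proj.awayι]
    simp
    rfl
  have h2 := congr_arg Scheme.Hom.appTop h1
  rw [Scheme.Hom.comp_appTop, Scheme.Hom.comp_appTop] at h2
  have h3 : (Proj.basicOpenToSpec 𝒜 (MvPolynomial.X i)).appTop = (Scheme.ΓSpecIso _).hom ≫
      Proj.awayToSection 𝒜 (MvPolynomial.X i) ≫ (chart m B i).topIso.inv :=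
    Proj.basicOpenToSpec_app_top 𝒜 (MvPolynomial.X i)
  have h4 : (toSpec m B).appTop ((Scheme.ΓSpecIso B).inv r) = (Proj.toSpecZero 𝒜).appTop
      ((Scheme.ΓSpecIso _).inv (algebraMap B (𝒜 0) r)) := by
    rw [toSpec, Scheme.Hom.comp_appTop, CommRingCat.comp_apply]
    congr 1
    exact congr($(Scheme.ΓSpecIso_inv_naturality (CommRingCat.ofHom (algebraMap B (𝒜 0)))).hom r).symm
  have h5 : (chart m B i).ι.appTop ≫ (chart m B i).topIso.hom =
      (ProjectiveSpace m B).presheaf.map (homOfLE le_top : chart m B i ⟶ ⊤).op := by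
    rw [Scheme.Opens.ι_appTop, Scheme.Opens.topIso_hom]
    exact ((ProjectiveSpace m B).presheaf.map_comp _ _).symm
  have h6 : (Scheme.ΓSpecIso (.of (𝒜 0))).inv ≫ (Proj.toSpecZero 𝒜).appTop ≫
      (ProjectiveSpace m B).presheaf.map (homOfLE le_top : chart m B i ⟶ ⊤).op =
      CommRingCat.ofHom (HomogeneousLocalization.fromZeroRingHom 𝒜 _) ≫
        Proj.awayToSection 𝒜 (MvPolynomial.X i) := by
    rw [← h5, ← Category.assoc (Proj.toSpecZero 𝒜).appTop, h2, h3]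
    simp only [Category.assoc, Iso.inv_hom_id, Category.comp_id]
    exact Scheme.ΓSpecIso_inv_naturality_assoc _ _ |>.symm.trans (by simp)
  rw [h4]
  exact congr($(h6).hom (algebraMap B (𝒜 0) r))

/-- Functions on a standard chart are polynomials in the coordinates over the base. -/
theorem mem_closure_coord (i : Fin (m + 1)) (s : Γ(ProjectiveSpace m B, chart m B i)) :
    s ∈ Subring.closure (Set.range (fun r : B => res (chart m B i)
      ((toSpec m B).appTop ((Scheme.ΓSpecIso B).inv r))) ∪ Set.range (coord i)) := by
  set 𝒜 := MvPolynomial.homogeneousSubmodule (Fin (m + 1)) B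
  have hbij : Function.Surjective (Proj.awayToSection 𝒜 (MvPolynomial.X i)) := by
    have := (Proj.basicOpenIsoAway 𝒜 (MvPolynomial.X i) (X_mem i) one_pos).commRingCatIsoToRingEquiv.surjective
    exact this
  obtain ⟨a, rfl⟩ := hbij s
  have htop := HomogeneousLocalization.Away.adjoin_mk_prod_pow_eq_top (𝒜 := 𝒜) (X_mem i)
    (Fin (m + 1)) MvPolynomial.X (by
      refine eq_top_iff.2 fun p _ => ?_
      induction p using MvPolynomial.induction_on with
      | C a =>
        exact Subalgebra.algebraMap_mem _ (⟨MvPolynomial.C a, MvPolynomial.isHomogeneous_C _ a⟩ :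
          MvPolynomial.homogeneousSubmodule (Fin (m + 1)) B 0)
      | add p q hp hq => exact add_mem (hp trivial) (hq trivial)
      | mul_X p i hp => exact mul_mem (hp trivial) (Algebra.subset_adjoin ⟨i, rfl⟩))
    (fun _ => 1) X_mem
  have ha : a ∈ (⊤ : Subalgebra (𝒜 0) _) := trivial
  rw [← htop] at ha
  induction ha using Algebra.adjoin_induction with
  | mem a ha =>
    -- A generator is a monomial of degree `d` over `X i ^ d`, hence a product of ratios.
    obtain ⟨d, ai, hai, -, rfl⟩ := ha
    have : HomogeneousLocalization.Away.mk 𝒜 (X_mem i) d (∏ l, MvPolynomial.X l ^ ai l)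
        (hai ▸ SetLike.prod_pow_mem_graded _ _ _ _ fun i _ ↦ X_mem i) =
        ∏ l, ratio (B := B) i l ^ ai l := by
      have hd : d = ∑ l, ai l := by simpa using hai.symm
      apply HomogeneousLocalization.val_injective
      rw [HomogeneousLocalization.Away.val_mk, ← HomogeneousLocalization.algebraMap_apply,
        map_prod, Localization.mk_eq_mk', IsLocalization.mk'_eq_iff_eq_mul]
      simp only [hd, ← Finset.prod_pow_eq_pow_sum, map_prod, map_pow, ← Finset.prod_mul_distrib,
        ← mul_pow]
      refine Finset.prod_congr rfl fun l _ => ?_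
      congr 1
      rw [HomogeneousLocalization.algebraMap_apply, ratio, HomogeneousLocalization.Away.val_mk,
        Localization.mk_eq_mk']
      have := IsLocalization.mk'_spec (Localization (Submonoid.powers
        (MvPolynomial.X i : MvPolynomial (Fin (m + 1)) B))) (MvPolynomial.X l)
        (⟨MvPolynomial.X i ^ 1, ⟨1, rfl⟩⟩ : Submonoid.powers
          (MvPolynomial.X i : MvPolynomial (Fin (m + 1)) B))
      rw [← this]
      congr 2
      exact pow_one _
    rw [this, map_prod]
    refine prod_mem fun l _ => ?_
    rw [map_pow]
    refine pow_mem (Subring.subset_closure ?_) _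
    exact Set.mem_union_right _ ⟨l, rfl⟩
  | algebraMap b =>
    obtain ⟨r, rfl⟩ : ∃ r, algebraMap B (𝒜 0) r = b := by
      refine ⟨MvPolynomial.coeff 0 b.1, Subtype.ext ?_⟩
      have h0 : b.1.totalDegree = 0 := (MvPolynomial.totalDegree_zero_iff_isHomogeneous _).2 b.2
      exact (MvPolynomial.totalDegree_eq_zero_iff_eq_C.1 h0).symm
    rw [← res_toSpec_appTop]
    exact Subring.subset_closure (Or.inl ⟨r, rfl⟩)
  | add a b _ _ ha hb => rw [map_add]; exact add_mem ha hb
  | mul a b _ _ ha hb => rw [map_mul]; exact mul_mem ha hb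

end ProjectiveSpace

/-- The standard charts of a scheme that is projective over its affinization. -/
theorem IsProjective.exists_charts {X : Scheme.{u}} (h : IsProjective X.toSpecΓ) :
    ∃ (m : ℕ) (U : Fin (m + 1) → X.Opens) (y : ∀ i, Fin (m + 1) → Γ(X, U i)),
      (∀ i, IsAffineOpen (U i)) ∧ ⨆ i, U i = ⊤ ∧ (∀ i, y i i = 1) ∧
      (∀ i j l (W : X.Opens) (hi : W ≤ U i) (hj : W ≤ U j),
        X.presheaf.map (homOfLE hi).op (y i l) =
          X.presheaf.map (homOfLE hj).op (y j l) * X.presheaf.map (homOfLE hi).op (y i j)) ∧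
      (∀ i j, X.basicOpen (y i j) ≤ U j) ∧
      ∀ i (s : Γ(X, U i)), s ∈ Subring.closure (Set.range (res (U i)) ∪ Set.range (y i)) := by
  obtain ⟨m, f, hf, hfac⟩ := h
  refine ⟨m, fun i => f ⁻¹ᵁ ProjectiveSpace.chart m _ i,
    fun i l => f.app _ (ProjectiveSpace.coord i l), fun i => ?_, ?_, fun i => ?_, ?_, ?_, ?_⟩
  · exact (ProjectiveSpace.isAffineOpen_chart i).preimage f
  · rw [← Scheme.Hom.preimage_iSup, ProjectiveSpace.iSup_chart]
    rfl
  · dsimp only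
    rw [ProjectiveSpace.coord_self, map_one]
  · intro i j l W hi hj
    let D := ProjectiveSpace.chart m Γ(X, ⊤) i ⊓ ProjectiveSpace.chart m Γ(X, ⊤) j
    have hWD : W ≤ f ⁻¹ᵁ D := le_inf hi hj
    have key : ∀ i' l' (hD : D ≤ ProjectiveSpace.chart m Γ(X, ⊤) i'),
        X.presheaf.map (homOfLE (hWD.trans (f.preimage_mono hD))).op
          (f.app _ (ProjectiveSpace.coord i' l')) = X.presheaf.map (homOfLE hWD).op
            (f.app D ((ProjectiveSpace m Γ(X, ⊤)).presheaf.map (homOfLE hD).op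
              (ProjectiveSpace.coord i' l'))) := by
      intro i' l' hD
      have h1 := congr($(f.naturality (homOfLE hD).op).hom (ProjectiveSpace.coord i' l'))
      refine Eq.trans ?_ (congr_arg (X.presheaf.map (homOfLE hWD).op) h1).symm
      exact congr($(X.presheaf.map_comp
        ((TopologicalSpace.Opens.map f.base).map (homOfLE hD)).op (homOfLE hWD).op).hom
          (f.app _ (ProjectiveSpace.coord i' l')))
    have h2 := congr_arg (fun z => X.presheaf.map (homOfLE hWD).op (f.app D z))
      (ProjectiveSpace.coord_mul (B := Γ(X, ⊤)) i j l (W := D) inf_le_left inf_le_right)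
    dsimp only at h2
    rw [map_mul, map_mul] at h2
    exact (key i l inf_le_left).trans (h2.trans (congrArg₂ (· * ·)
      (key j l inf_le_right).symm (key i j inf_le_left).symm))
  · intro i j
    rw [← Scheme.preimage_basicOpen]
    exact f.preimage_mono (ProjectiveSpace.basicOpen_coord_le i j)
  · intro i s
    -- Along a closed immersion functions on an affine chart lift to the ambient chart, so
    -- generators map to generators.
    obtain ⟨t, rfl⟩ := f.app_surjective _ (ProjectiveSpace.isAffineOpen_chart i) s
    have ht : f.app _ t ∈ (Subring.closure _).map (f.app (ProjectiveSpace.chart m _ i)).hom :=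
      ⟨t, ProjectiveSpace.mem_closure_coord i t, rfl⟩
    rw [RingHom.map_closure] at ht
    refine Subring.closure_mono ?_ ht
    rintro _ ⟨_, ⟨r, rfl⟩ | ⟨l, rfl⟩, rfl⟩
    · refine Or.inl ⟨r, ?_⟩
      have h1 := congr($(f.naturality (homOfLE (le_top : ProjectiveSpace.chart m Γ(X, ⊤) i ≤ ⊤)).op).hom
        ((ProjectiveSpace.toSpec m Γ(X, ⊤)).appTop ((Scheme.ΓSpecIso Γ(X, ⊤)).inv r)))
      refine Eq.trans ?_ h1.symm
      -- The composite to `Spec Γ(X)` is the canonical morphism, so base constants pull back to the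
      -- global functions themselves.
      have h2 : f.appTop ((ProjectiveSpace.toSpec m Γ(X, ⊤)).appTop
          ((Scheme.ΓSpecIso Γ(X, ⊤)).inv r)) = r := by
        rw [← CommRingCat.comp_apply (ProjectiveSpace.toSpec m Γ(X, ⊤)).appTop,
          ← Scheme.Hom.comp_appTop, hfac, ← CommRingCat.comp_apply]
        simp
      exact congr_arg (res _) h2.symm
    · exact Or.inr ⟨l, rfl⟩

end BondalQuiver

end

noncomputable section

namespace BondalQuiver

/-! ### Sections, restrictions and pullbacks of sections -/

section Sections

variable {X Y Z : Scheme.{u}}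

/-- Restriction of functions. -/
def resO {U W : X.Opens} (h : W ≤ U) : Γ(X, U) →+* Γ(X, W) := (X.presheaf.map (homOfLE h).op).hom

/-- Restriction of sections of a sheaf of modules. -/
def resM (M : X.Modules) {U W : X.Opens} (h : W ≤ U) : Γ(M, U) →+ Γ(M, W) :=
  (M.presheaf.map (homOfLE h).op).hom

variable {M N : X.Modules} {U V W : X.Opens}

theorem resM_resM (h : V ≤ U) (h' : W ≤ V) (s : Γ(M, U)) :
    resM M h' (resM M h s) = resM M (h'.trans h) s := by
  exact congr($(M.presheaf.map_comp (homOfLE h).op (homOfLE h').op).hom s).symm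

theorem resM_self (h : U ≤ U) (s : Γ(M, U)) : resM M h s = s :=
  congr($(M.presheaf.map_id (.op U)).hom s)

theorem resM_smul (h : W ≤ U) (a : Γ(X, U)) (s : Γ(M, U)) :
    resM M h (a • s) = resO h a • resM M h s :=
  Scheme.Modules.map_smul M (homOfLE h) a s

theorem app_resM (φ : M ⟶ N) (h : W ≤ U) (s : Γ(M, U)) :
    φ.app W (resM M h s) = resM N h (φ.app U s) :=
  congr($(φ.mapPresheaf.naturality (homOfLE h).op).hom s)

theorem resM_ext {ι : Type*} (V : ι → X.Opens) (hV : ∀ i, V i ≤ U) (hcov : U ≤ ⨆ i, V i)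
    (s t : Γ(M, U)) (h : ∀ i, resM M (hV i) s = resM M (hV i) t) : s = t :=
  (TopCat.Sheaf.eq_of_locally_eq' ⟨M.presheaf, M.isSheaf⟩ V U (fun i => homOfLE (hV i)) hcov s t h)

theorem hom_ext_of_cover {α β : M ⟶ N}
    (h : ∀ x : X, ∃ U : X.Opens, x ∈ U ∧ ∀ (W : X.Opens), W ≤ U → ∀ s : Γ(M, W),
      α.app W s = β.app W s) : α = β := by
  choose U hxU hU using h
  refine hom_ext_sections fun W s => ?_
  refine resM_ext (fun x : W => W ⊓ U x.1) (fun _ => inf_le_left) (fun x hx => ?_) _ _ fun x => ?_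
  · exact TopologicalSpace.Opens.mem_iSup.2 ⟨⟨x, hx⟩, hx, hxU x⟩
  · rw [← app_resM, ← app_resM]
    exact hU x _ inf_le_right _

/-- The pullback of a section. -/
def pull (f : Y ⟶ X) (M : X.Modules) {U : X.Opens} :
    Γ(M, U) →+ Γ((Scheme.Modules.pullback f).obj M, f ⁻¹ᵁ U) :=
  (((Scheme.Modules.pullbackPushforwardAdjunction f).unit.app M).app U).hom

theorem pull_smul (f : Y ⟶ X) (a : Γ(X, U)) (s : Γ(M, U)) :
    pull f M (a • s) = f.app U a • pull f M s :=
  Scheme.Modules.Hom.app_smul ((Scheme.Modules.pullbackPushforwardAdjunction f).unit.app M) a s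

theorem pull_resM (f : Y ⟶ X) (h : W ≤ U) (s : Γ(M, U)) :
    pull f M (resM M h s) = resM _ (f.preimage_mono h) (pull f M s) :=
  app_resM ((Scheme.Modules.pullbackPushforwardAdjunction f).unit.app M) h s

theorem map_pull (f : Y ⟶ X) (φ : M ⟶ N) (s : Γ(M, U)) :
    ((Scheme.Modules.pullback f).map φ).app (f ⁻¹ᵁ U) (pull f M s) = pull f N (φ.app U s) := by
  have h := (Scheme.Modules.pullbackPushforwardAdjunction f).unit.naturality φ
  have h2 := congr_arg (fun ψ => Scheme.Modules.Hom.app ψ U s) h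
  exact h2.symm

/-- The comparison isomorphism is the conjugate of the identification of pushforwards, so it is
compatible with the units of the adjunctions, which define the pullback of sections. -/
theorem pullbackComp_pull (f : Z ⟶ Y) (g : Y ⟶ X) (s : Γ(M, U)) :
    ((Scheme.Modules.pullbackComp f g).hom.app M).app (f ⁻¹ᵁ g ⁻¹ᵁ U) (pull f _ (pull g M s)) =
      pull (f ≫ g) M s := by
  have h := unit_conjugateEquiv ((Scheme.Modules.pullbackPushforwardAdjunction g).comp
    (Scheme.Modules.pullbackPushforwardAdjunction f))
      (Scheme.Modules.pullbackPushforwardAdjunction (f ≫ g)) (Scheme.Modules.pullbackComp f g).inv M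
  rw [Scheme.Modules.conjugateEquiv_pullbackComp_inv] at h
  have h1 : pull f _ (pull g M s) =
      ((Scheme.Modules.pullbackComp f g).inv.app M).app (f ⁻¹ᵁ g ⁻¹ᵁ U) (pull (f ≫ g) M s) := by
    have h2 := congr_arg (fun ψ => Scheme.Modules.Hom.app ψ U s) h
    rw [Adjunction.comp_unit_app] at h2
    exact h2
  rw [h1]
  exact congr_arg (fun ψ => Scheme.Modules.Hom.app ψ (f ⁻¹ᵁ g ⁻¹ᵁ U) (pull (f ≫ g) M s))
    ((Scheme.Modules.pullbackComp f g).inv_hom_id_app M)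

end Sections

/-! ### Frames -/

section Frames

variable {X Y Z : Scheme.{u}} {M N : X.Modules} {U V W : X.Opens} {m : ℕ}

/-- A frame of `M` over `U`: sections that form a basis over every open subset of `U`. -/
def IsFrame (M : X.Modules) (U : X.Opens) (e : Fin m → Γ(M, U)) : Prop :=
  ∀ (W : X.Opens) (h : W ≤ U), Function.Bijective
    fun a : Fin m → Γ(X, W) => ∑ j, a j • resM M h (e j)

theorem IsFrame.mono {e : Fin m → Γ(M, U)} (he : IsFrame M U e) (h : W ≤ U) :
    IsFrame M W fun j => resM M h (e j) := by
  intro W' h'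
  simp only [resM_resM]
  exact he W' _

theorem IsFrame.exists_eq {e : Fin m → Γ(M, U)} (he : IsFrame M U e) (h : W ≤ U) (s : Γ(M, W)) :
    ∃ a : Fin m → Γ(X, W), s = ∑ j, a j • resM M h (e j) := by
  obtain ⟨a, ha⟩ := (he W h).2 s
  exact ⟨a, ha.symm⟩

theorem IsFrame.eq_of_app_eq {e : Fin m → Γ(M, U)} (he : IsFrame M U e) {α β : M ⟶ N}
    (h : ∀ j, α.app U (e j) = β.app U (e j)) (hW : W ≤ U) (s : Γ(M, W)) :
    α.app W s = β.app W s := by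
  obtain ⟨a, rfl⟩ := he.exists_eq hW s
  simp only [map_sum, Scheme.Modules.Hom.app_smul, app_resM, h]

/-- The coordinates in a frame. -/
def IsFrame.equiv {e : Fin m → Γ(M, U)} (he : IsFrame M U e) (h : W ≤ U) :
    (Fin m → Γ(X, W)) ≃ₗ[Γ(X, W)] Γ(M, W) :=
  LinearEquiv.ofBijective
    { toFun := fun a => ∑ j, a j • resM M h (e j)
      map_add' := fun a b => by simp [add_smul, Finset.sum_add_distrib]
      map_smul' := fun r a => by simp [mul_smul, Finset.smul_sum] } (he W h)

theorem IsFrame.equiv_apply {e : Fin m → Γ(M, U)} (he : IsFrame M U e) (h : W ≤ U)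
    (a : Fin m → Γ(X, W)) : he.equiv h a = ∑ j, a j • resM M h (e j) := rfl

theorem IsFrame.equiv_symm_resM {e : Fin m → Γ(M, U)} (he : IsFrame M U e) (h : W ≤ U)
    (h' : V ≤ W) (s : Γ(M, W)) (j : Fin m) :
    (he.equiv (h'.trans h)).symm (resM M h' s) j = resO h' ((he.equiv h).symm s j) := by
  have : (he.equiv (h'.trans h)).symm (resM M h' s) =
      fun j => resO h' ((he.equiv h).symm s j) := by
    rw [LinearEquiv.symm_apply_eq, he.equiv_apply]
    conv_lhs => rw [← (he.equiv h).apply_symm_apply s, he.equiv_apply, map_sum]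
    simp only [resM_smul, resM_resM]
  rw [this]

/-- A morphism from a module with a frame over `U` to a module whose sections are determined by
those over `U` can be prescribed on the frame. -/
theorem IsFrame.exists_hom {e : Fin m → Γ(M, U)} (he : IsFrame M U e)
    (hN : ∀ W : X.Opens, Function.Bijective (resM N (inf_le_left : W ⊓ U ≤ W)))
    (p : Fin m → Γ(N, U)) : ∃ ψ : M ⟶ N, ∀ j, ψ.app U (e j) = p j := by
  -- It suffices to define the morphism after restriction to `W ⊓ U`, where sections of `M` have
  -- coordinates in the frame.
  let E (W : X.Opens) : Γ(N, W) ≃+ Γ(N, W ⊓ U) := AddEquiv.ofBijective _ (hN W)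
  have hE : ∀ (W : X.Opens) s, resM N (inf_le_left : W ⊓ U ≤ W) ((E W).symm s) = s :=
    fun W s => (E W).apply_symm_apply s
  let g (W : X.Opens) (s : Γ(M, W)) : Γ(N, W ⊓ U) :=
    ∑ j, (he.equiv (inf_le_right : W ⊓ U ≤ U)).symm (resM M inf_le_left s) j • resM N inf_le_right (p j)
  let f (W : X.Opens) : Γ(M, W) →ₗ[Γ(X, W)] Γ(N, W) :=
    { toFun s := (E W).symm (g W s)
      map_add' s t := by
        rw [← map_add]
        congr 1
        simp only [g, map_add, Pi.add_apply, add_smul, Finset.sum_add_distrib]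
      map_smul' r s := by
        rw [AddEquiv.symm_apply_eq]
        change _ = resM N _ (r • _)
        rw [resM_smul, hE]
        simp only [g, resM_smul, map_smul, Pi.smul_apply, Finset.smul_sum, smul_eq_mul, mul_smul] }
  have hf : ∀ {W V : X.Opens} (h : V ≤ W) (s : Γ(M, W)), f V (resM M h s) = resM N h (f W s) := by
    intro W V h s
    refine (E V).injective ?_
    change resM N _ ((E V).symm _) = resM N _ (resM N _ ((E W).symm _))
    rw [hE, resM_resM]
    have h' : V ⊓ U ≤ W ⊓ U := inf_le_inf_right _ h
    rw [← resM_resM inf_le_left h', hE]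
    simp only [g, map_sum, resM_smul, resM_resM, ← he.equiv_symm_resM]
  let ψ : M ⟶ N :=
    ⟨{ app := fun W => ModuleCat.ofHom
          { toFun := f W.unop
            map_add' := (f W.unop).map_add
            map_smul' := (f W.unop).map_smul }
       naturality := by
        intro W V i
        ext s
        exact hf (leOfHom i.unop) s }⟩
  refine ⟨ψ, fun j => ?_⟩
  change f U (e j) = p j
  refine (E U).injective ?_
  change resM N _ ((E U).symm _) = resM N _ _
  rw [hE]
  have : (he.equiv (inf_le_right : U ⊓ U ≤ U)).symm (resM M inf_le_left (e j)) = Pi.single j 1 := by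
    rw [LinearEquiv.symm_apply_eq, he.equiv_apply, Finset.sum_eq_single j]
    · rw [Pi.single_eq_same, one_smul]
    · intro b _ hb
      rw [Pi.single_eq_of_ne hb, zero_smul]
    · simp
  simp only [g, this]
  rw [Finset.sum_eq_single j]
  · rw [Pi.single_eq_same, one_smul]
  · intro b _ hb
    rw [Pi.single_eq_of_ne hb, zero_smul]
  · simp

end Frames

end BondalQuiver

end

/-! ### Frames of vector bundles and of their pullbacks -/

noncomputable section

namespace BondalQuiver

section LocalFrames

variable {X Y Z : Scheme.{u}} {M N : X.Modules} {U V W : X.Opens} {m : ℕ}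

theorem resM_bijective_of_eq (N : X.Modules) (h : W ≤ U) (h' : U = W) :
    Function.Bijective (resM N h) := by
  subst h'
  have : resM N h = AddMonoidHom.id _ := AddMonoidHom.ext fun s => resM_self h s
  rw [this]
  exact Function.bijective_id

/-- The structure sheaf as a module over itself. -/
abbrev unitModule (X : Scheme.{u}) : X.Modules := SheafOfModules.unit X.ringCatSheaf

/-- The free module of rank `m`. -/
abbrev freeModule (X : Scheme.{u}) (m : ℕ) : X.Modules :=
  SheafOfModules.free (R := X.ringCatSheaf) (ULift.{u} (Fin m))

/-- The inclusion of a summand of a free module. -/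
def freeι (X : Scheme.{u}) {m : ℕ} (j : Fin m) : unitModule X ⟶ freeModule X m :=
  SheafOfModules.ιFree (ULift.up j)

/-- The projection to a summand of a free module. -/
def freeπ (X : Scheme.{u}) {m : ℕ} (j : Fin m) : freeModule X m ⟶ unitModule X :=
  Sigma.desc (f := fun _ : ULift.{u} (Fin m) => unitModule X)
    fun i => if i.down = j then 𝟙 _ else 0

theorem freeι_freeπ (i j : Fin m) :
    freeι X i ≫ freeπ X j = if i = j then 𝟙 (unitModule X) else 0 :=
  Sigma.ι_desc (f := fun _ : ULift.{u} (Fin m) => unitModule X)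
    (fun i => if i.down = j then 𝟙 (unitModule X) else 0) (ULift.up i)

theorem sum_freeπ_freeι : ∑ j, freeπ X j ≫ freeι X j = 𝟙 (freeModule X m) := by
  refine Sigma.hom_ext (f := fun _ : ULift.{u} (Fin m) => unitModule X) _ _ fun i => ?_
  change freeι X i.down ≫ _ = freeι X i.down ≫ _
  rw [Category.comp_id, Preadditive.comp_sum, Finset.sum_eq_single i.down]
  · rw [← Category.assoc, freeι_freeπ, if_pos rfl, Category.id_comp]
  · intro b _ hb
    rw [← Category.assoc, freeι_freeπ, if_neg hb.symm, zero_comp]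
  · simp

/-- The constant section `1` of the structure sheaf. -/
def unitSection (W : X.Opens) : Γ(unitModule X, W) := (1 : Γ(X, W))

theorem resM_unitSection (h : W ≤ U) :
    resM (unitModule X) h (unitSection U) = unitSection W :=
  map_one (X.presheaf.map (homOfLE h).op).hom

theorem smul_unitSection (a : Γ(unitModule X, W)) :
    (show Γ(X, W) from a) • unitSection W = a :=
  mul_one (show Γ(X, W) from a)

/-- The standard sections of a free module. -/
def freeBasis (X : Scheme.{u}) (m : ℕ) (j : Fin m) : Γ(freeModule X m, ⊤) :=
  (freeι X j).app ⊤ (unitSection ⊤)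

theorem app_sum {ι : Type*} (s : Finset ι) (φ : ι → (M ⟶ N)) (x : Γ(M, U)) :
    (∑ i ∈ s, φ i).app U x = ∑ i ∈ s, (φ i).app U x := by
  classical
  induction s using Finset.induction_on with
  | empty => simp only [Finset.sum_empty]; rfl
  | insert a s ha ih => rw [Finset.sum_insert ha, Finset.sum_insert ha, ← ih]; rfl

theorem isFrame_freeBasis : IsFrame (freeModule X m) ⊤ (freeBasis X m) := by
  intro W h
  have hb : ∀ j, resM _ h (freeBasis X m j) = (freeι X j).app W (unitSection W) := by
    intro j
    rw [freeBasis, ← app_resM, resM_unitSection]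
  have hπ : ∀ i j : Fin m, (freeπ X j).app W ((freeι X i).app W (unitSection W)) =
      if i = j then unitSection W else 0 := by
    intro i j
    have := congr_arg (fun ψ => Scheme.Modules.Hom.app ψ W (unitSection W))
      (freeι_freeπ (X := X) i j)
    refine Eq.trans this ?_
    split_ifs <;> rfl
  constructor
  · intro a b hab
    funext i
    have key : ∀ a : Fin m → Γ(X, W), (freeπ X i).app W
        (∑ j, a j • resM _ h (freeBasis X m j)) = a i • unitSection W := by
      intro a
      rw [map_sum, Finset.sum_eq_single i]
      · rw [Scheme.Modules.Hom.app_smul, hb, hπ, if_pos rfl]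
      · intro b _ hb'
        rw [Scheme.Modules.Hom.app_smul, hb, hπ, if_neg hb', smul_zero]
      · simp
    have h1 := congr_arg (fun s => (freeπ X i).app W s) hab
    have h2 := (key a).symm.trans (h1.trans (key b))
    exact (smul_unitSection (a i)).symm.trans (h2.trans (smul_unitSection (b i)))
  · intro s
    refine ⟨fun j => (freeπ X j).app W s, ?_⟩
    have := congr_arg (fun ψ => Scheme.Modules.Hom.app ψ W s) (sum_freeπ_freeι (X := X) (m := m))
    refine Eq.trans ?_ this
    simp only [app_sum, hb]
    refine Finset.sum_congr rfl fun j _ => ?_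
    refine Eq.trans (Scheme.Modules.Hom.app_smul (freeι X j)
      (show Γ(X, W) from (freeπ X j).app W s) (unitSection W)).symm ?_
    rw [smul_unitSection]
    rfl

theorem IsFrame.of_iso {e : Fin m → Γ(M, U)} (he : IsFrame M U e) (α : M ≅ N) :
    IsFrame N U fun j => α.hom.app U (e j) := by
  intro W h
  have h1 : ∀ s : Γ(M, W), α.inv.app W (α.hom.app W s) = s := fun s =>
    congr_arg (fun ψ => Scheme.Modules.Hom.app ψ W s) α.hom_inv_id
  have h2 : ∀ s : Γ(N, W), α.hom.app W (α.inv.app W s) = s := fun s =>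
    congr_arg (fun ψ => Scheme.Modules.Hom.app ψ W s) α.inv_hom_id
  have hα : Function.Bijective (fun s : Γ(M, W) => α.hom.app W s) :=
    Function.bijective_iff_has_inverse.2 ⟨fun s => α.inv.app W s, h1, h2⟩
  have := hα.comp (he W h)
  convert this using 1
  funext a
  simp only [Function.comp, map_sum, Scheme.Modules.Hom.app_smul, app_resM]

theorem restrict_smul (W : U.toScheme.Opens) (a : Γ(U.toScheme, W)) (s : Γ(M.restrict U.ι, W)) :
    (M.restrictAppIso U.ι W).hom (a • s) =
      (show Γ(X, U.ι ''ᵁ W) from a) • (M.restrictAppIso U.ι W).hom s := by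
  have := congr($(Scheme.Modules.smul_restrictAppIso_hom U.ι M W a).hom s)
  simp only [Scheme.Opens.ι_appIso] at this
  exact this

theorem restrictAppIso_resM {W W' : U.toScheme.Opens} (h : W' ≤ W) (s : Γ(M.restrict U.ι, W)) :
    (M.restrictAppIso U.ι W').hom (resM (M.restrict U.ι) h s) =
      resM M (U.ι.image_mono h) ((M.restrictAppIso U.ι W).hom s) := rfl

theorem restrictAppIso_bijective (W : U.toScheme.Opens) :
    Function.Bijective (M.restrictAppIso U.ι W).hom := Function.bijective_id

theorem IsFrame.of_restrict {e : Fin m → Γ(M.restrict U.ι, ⊤)}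
    (he : IsFrame (M.restrict U.ι) ⊤ e) {e' : Fin m → Γ(M, U)}
    (hee : ∀ j, (M.restrictAppIso U.ι ⊤).hom (e j) = resM M (by simp) (e' j)) :
    IsFrame M U e' := by
  intro W h
  obtain ⟨W', rfl⟩ : ∃ W' : U.toScheme.Opens, W = U.ι ''ᵁ W' := by
    refine ⟨U.ι ⁻¹ᵁ W, ?_⟩
    rw [Scheme.Hom.image_preimage_eq_opensRange_inf]
    simp [h]
  have key : ∀ a : Fin m → Γ(U.toScheme, W'),
      (M.restrictAppIso U.ι W').hom (∑ j, a j • resM (M.restrict U.ι) le_top (e j)) =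
        ∑ j, (show Γ(X, U.ι ''ᵁ W') from a j) • resM M h (e' j) := by
    intro a
    rw [map_sum]
    refine Finset.sum_congr rfl fun j _ => ?_
    rw [restrict_smul, restrictAppIso_resM, hee, resM_resM]
  exact (congr_arg Function.Bijective (funext key)).mp
    ((restrictAppIso_bijective W').comp (he W' le_top))

/-- A vector bundle has frames locally. -/
theorem IsVectorBundle.exists_isFrame (h : IsVectorBundle M) (x : X) :
    ∃ (U : X.Opens) (_ : x ∈ U) (m : ℕ) (e : Fin m → Γ(M, U)), IsFrame M U e := by
  obtain ⟨U, hx, m, ⟨α⟩⟩ := h x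
  have he := isFrame_freeBasis (X := U.toScheme) (m := m).of_iso α.symm
  refine ⟨U, hx, m, fun j => resM M (by simp) ((M.restrictAppIso U.ι ⊤).hom
    (α.symm.hom.app ⊤ (freeBasis _ m j))), he.of_restrict fun j => ?_⟩
  rw [resM_resM, resM_self]

theorem IsFrame.hom_ext_of_bijective {e : Fin m → Γ(M, U)} (he : IsFrame M U e)
    (hN : ∀ W : X.Opens, Function.Bijective (resM N (inf_le_left : W ⊓ U ≤ W)))
    {α β : M ⟶ N} (h : ∀ j, α.app U (e j) = β.app U (e j)) : α = β := by
  refine hom_ext_sections fun W s => (hN W).1 ?_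
  rw [← app_resM, ← app_resM]
  exact he.eq_of_app_eq h inf_le_right _

end LocalFrames

section PullbackFrames

variable {X Y : Scheme.{u}} {M : X.Modules} {U : X.Opens} {m : ℕ}

/-- The sections of the restriction of a pullback induced by sections of a sheaf. -/
def pullRestrict (f : Y ⟶ X) (M : X.Modules) {U : X.Opens} (s : Γ(M, U)) :
    Γ(((Scheme.Modules.pullback f).obj M).restrict (f ⁻¹ᵁ U).ι, ⊤) :=
  (((Scheme.Modules.pullback f).obj M).restrictAppIso (f ⁻¹ᵁ U).ι ⊤).inv
    (resM ((Scheme.Modules.pullback f).obj M) (by simp) (pull f M s))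

variable (f : Y ⟶ X) (N : (f ⁻¹ᵁ U).toScheme.Modules)

/-- Morphisms from the restriction of a pullback, by adjunction. -/
def pullRestrictEquiv (M : X.Modules) :
    (((Scheme.Modules.pullback f).obj M).restrict (f ⁻¹ᵁ U).ι ⟶ N) ≃
      (M ⟶ (Scheme.Modules.pushforward f).obj
        ((Scheme.Modules.pushforward (f ⁻¹ᵁ U).ι).obj N)) :=
  ((Scheme.Modules.restrictAdjunction (f ⁻¹ᵁ U).ι).homEquiv _ _).trans
    ((Scheme.Modules.pullbackPushforwardAdjunction f).homEquiv _ _)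

theorem restrictAdjunction_unit_app (P : Y.Modules) (U : Y.Opens) (s : Γ(P, U)) :
    ((Scheme.Modules.restrictAdjunction U.ι).unit.app P).app U s =
      resM (P.restrict U.ι) (U := ⊤) (W := U.ι ⁻¹ᵁ U) le_top
        ((P.restrictAppIso U.ι ⊤).inv (resM P (by simp) s)) := by
  rw [Scheme.Modules.restrictAdjunction_unit_app_app]
  apply (restrictAppIso_bijective (M := P) (U := U) (U.ι ⁻¹ᵁ U)).1
  rw [restrictAppIso_resM]
  have h := congr($((P.restrictAppIso U.ι ⊤).inv_hom_id).hom (resM P (by simp) s))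
  refine Eq.trans ?_ (congr_arg (resM P _) h.symm)
  exact (resM_resM (M := P) _ _ s).symm

theorem pullRestrictEquiv_app
    (ψ : ((Scheme.Modules.pullback f).obj M).restrict (f ⁻¹ᵁ U).ι ⟶ N) (s : Γ(M, U)) :
    (pullRestrictEquiv f N M ψ).app U s =
      resM N (U := ⊤) (W := (f ⁻¹ᵁ U).ι ⁻¹ᵁ f ⁻¹ᵁ U) le_top (ψ.app ⊤ (pullRestrict f M s)) := by
  rw [pullRestrictEquiv, Equiv.trans_apply, Adjunction.homEquiv_unit, Adjunction.homEquiv_unit,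
    ← app_resM]
  refine congr_arg (fun z => ψ.app ((f ⁻¹ᵁ U).ι ⁻¹ᵁ f ⁻¹ᵁ U) z) ?_
  exact restrictAdjunction_unit_app ((Scheme.Modules.pullback f).obj M) (f ⁻¹ᵁ U) (pull f M s)

theorem resM_pushforward_bijective (W : X.Opens) :
    Function.Bijective (resM ((Scheme.Modules.pushforward f).obj
        ((Scheme.Modules.pushforward (f ⁻¹ᵁ U).ι).obj N)) (inf_le_left : W ⊓ U ≤ W)) := by
  refine resM_bijective_of_eq N ((f ⁻¹ᵁ U).ι.preimage_mono (f.preimage_mono inf_le_left)) ?_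
  ext y
  simp
  intro _
  exact y.2

variable {f N}

/-- By adjunction these are morphisms from `M` to a pushforward whose sections depend only on their
restrictions to `U`, so they can be prescribed on the frame. The restricted pullback thus has the
universal property of a free module. -/
theorem IsFrame.exists_hom_pull {e : Fin m → Γ(M, U)} (he : IsFrame M U e)
    (p : Fin m → Γ(N, ⊤)) :
    ∃ ψ : ((Scheme.Modules.pullback f).obj M).restrict (f ⁻¹ᵁ U).ι ⟶ N,
      ∀ j, ψ.app ⊤ (pullRestrict f M (e j)) = p j := by
  obtain ⟨ψ, hψ⟩ := he.exists_hom (resM_pushforward_bijective f N)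
    fun j => resM N (U := ⊤) (W := (f ⁻¹ᵁ U).ι ⁻¹ᵁ f ⁻¹ᵁ U) le_top (p j)
  refine ⟨(pullRestrictEquiv f N M).symm ψ, fun j => ?_⟩
  have h := pullRestrictEquiv_app f N ((pullRestrictEquiv f N M).symm ψ) (e j)
  rw [Equiv.apply_symm_apply, hψ] at h
  exact (resM_bijective_of_eq N le_top (by simp)).1 h.symm

theorem IsFrame.hom_ext_pull {e : Fin m → Γ(M, U)} (he : IsFrame M U e)
    {ψ ψ' : ((Scheme.Modules.pullback f).obj M).restrict (f ⁻¹ᵁ U).ι ⟶ N}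
    (h : ∀ j, ψ.app ⊤ (pullRestrict f M (e j)) = ψ'.app ⊤ (pullRestrict f M (e j))) : ψ = ψ' := by
  refine (pullRestrictEquiv f N M).injective
    (he.hom_ext_of_bijective (resM_pushforward_bijective f N) fun j => ?_)
  rw [pullRestrictEquiv_app, pullRestrictEquiv_app, h]

/-- The pullback of a frame is a frame. -/
theorem IsFrame.pull {e : Fin m → Γ(M, U)} (he : IsFrame M U e) (f : Y ⟶ X) :
    IsFrame ((Scheme.Modules.pullback f).obj M) (f ⁻¹ᵁ U) fun j => pull f M (e j) := by
  let F := freeModule (f ⁻¹ᵁ U).toScheme m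
  have hF : IsFrame F ⊤ (freeBasis _ m) := isFrame_freeBasis
  have htop : ∀ (N : (f ⁻¹ᵁ U).toScheme.Modules) (W : (f ⁻¹ᵁ U).toScheme.Opens),
      Function.Bijective (resM N (inf_le_left : W ⊓ ⊤ ≤ W)) :=
    fun N W => resM_bijective_of_eq N _ (by simp)
  obtain ⟨α, hα⟩ := he.exists_hom_pull (f := f) (N := F) (freeBasis _ m)
  obtain ⟨β, hβ⟩ := hF.exists_hom
    (htop (((Scheme.Modules.pullback f).obj M).restrict (f ⁻¹ᵁ U).ι))
    (fun j => pullRestrict f M (e j))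
  -- Both modules are free on their given sections, so the maps that exchange these sections are
  -- mutually inverse.
  let γ : F ≅ ((Scheme.Modules.pullback f).obj M).restrict (f ⁻¹ᵁ U).ι :=
    { hom := β
      inv := α
      hom_inv_id := hF.hom_ext_of_bijective (htop F) fun j => by
        change α.app ⊤ (β.app ⊤ _) = freeBasis _ m j
        rw [hβ, hα]
      inv_hom_id := he.hom_ext_pull fun j => by
        change β.app ⊤ (α.app ⊤ _) = pullRestrict f M (e j)
        rw [hα, hβ] }
  exact (hF.of_iso γ).of_restrict fun j => congr_arg _ (hβ j)

end PullbackFrames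

end BondalQuiver

end

/-! ### Bounded denominators in a residue field -/

/-- Sections in one chart that are carried to sections in another chart by invertible transition
matrices over a local ring have bounded denominators in the residue field. -/
theorem exists_denominator_of_transition {C₀ C O κ : Type*} [CommRing C₀] [CommRing C]
    [CommRing O] [Field κ] [Algebra C₀ O] [Algebra C O] [Algebra O κ] [Algebra C₀ κ]
    [Algebra C κ] [IsScalarTower C₀ O κ] [IsScalarTower C O κ] (S : Submonoid C₀)
    [IsLocalization S O] [IsNoetherianRing C] {ι₀ ι₀' ι ι' : Type*} [Finite ι₀] [Finite ι₀']
    [Fintype ι] [Fintype ι'] (A : Matrix ι₀ ι O) (A' : Matrix ι' ι₀' O)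
    (hfrac : ∀ z : κ, ∃ a d : C, algebraMap C κ d ≠ 0 ∧ algebraMap C κ d * z = algebraMap C κ a)
    (Y : Submodule C₀ (ι₀ → ι₀' → C₀)) (l : Y →ₗ[C₀] κ) :
    ∃ c : C, algebraMap C κ c ≠ 0 ∧ ∀ (v : Matrix ι ι' C) (y : Y),
      A * v.map (algebraMap C O) * A' = Matrix.map (y : ι₀ → ι₀' → C₀) (algebraMap C₀ O) →
        ∃ a : C, algebraMap C κ c * l y = algebraMap C κ a := by
  let loc : (ι₀ → ι₀' → C₀) →ₗ[C₀] (ι₀ → ι₀' → O) := .pi fun i =>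
    (.pi fun j => Algebra.linearMap C₀ O ∘ₗ .proj j : (ι₀' → C₀) →ₗ[C₀] (ι₀' → O)) ∘ₗ .proj i
  -- Change of frames on matrices of morphisms, with values in the local ring.
  let τ : (ι → ι' → C) →ₗ[C] (ι₀ → ι₀' → O) :=
    { toFun v := A * (Matrix.of v).map (algebraMap C O) * A'
      map_add' v w := by
        change _ = A * (Matrix.of v).map (algebraMap C O) * A' +
          A * (Matrix.of w).map (algebraMap C O) * A'
        rw [← Matrix.add_mul, ← Matrix.mul_add, ← Matrix.map_add _ (map_add _)]
        rfl
      map_smul' r v := by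
        have h : (Matrix.of (r • v)).map (algebraMap C O) =
            algebraMap C O r • (Matrix.of v).map (algebraMap C O) := by
          ext i j
          simp
        funext i j
        change (A * (Matrix.of (r • v)).map (algebraMap C O) * A') i j =
          r • (A * (Matrix.of v).map (algebraMap C O) * A') i j
        rw [h, Matrix.mul_smul, Matrix.smul_mul, Matrix.smul_apply, smul_eq_mul,
          Algebra.smul_def] }
  obtain ⟨J, hJ, h⟩ := exists_fg_of_isLocalizedModule (O := O) (κ := κ) S loc τ Y l
  obtain ⟨c, hc, hcJ⟩ := hJ.exists_common_denominator hfrac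
  exact ⟨c, hc, fun v y hvy => hcJ _ (h v y hvy)⟩

/-- A denominator that works after inverting each member of a family that generates the unit ideal
can be chosen to work before localizing. -/
theorem exists_mul_mem_range_of_span_eq_top {A κ : Type*} [CommRing A] [Field κ] (ev : A →+* κ)
    (hfrac : ∀ z : κ, ∃ a d : A, ev d ≠ 0 ∧ ev d * z = ev a) (s : Set A)
    (hs : Ideal.span s = ⊤) (G : Set κ)
    (h : ∀ f ∈ s, ev f ≠ 0 → ∃ c : κ, c ≠ 0 ∧ ∀ g ∈ G, ∃ (n : ℕ) (a : A), ev f ^ n * (c * g) = ev a) :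
    ∃ c : A, ev c ≠ 0 ∧ ∀ g ∈ G, ∃ a : A, ev c * g = ev a := by
  classical
  obtain ⟨t, hts, ht⟩ := (Ideal.span_eq_top_iff_finite s).1 hs
  have h1 : ∀ f ∈ t, ∃ c : A, ev c ≠ 0 ∧ ∀ g ∈ G, ∃ (n : ℕ) (a : A),
      ev f ^ n * (ev c * g) = ev a := by
    intro f hf
    by_cases hf0 : ev f = 0
    -- A function vanishing at the point imposes no condition: its first power already kills
    -- everything.
    · exact ⟨1, by simp, fun g _ => ⟨1, 0, by simp [hf0]⟩⟩
    · obtain ⟨c, hc, hcG⟩ := h f (hts hf) hf0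
      obtain ⟨a, d, hd, hda⟩ := hfrac c
      refine ⟨a, by rw [← hda]; exact mul_ne_zero hd hc, fun g hg => ?_⟩
      obtain ⟨n, b, hb⟩ := hcG g hg
      refine ⟨n, d * b, ?_⟩
      rw [map_mul, ← hb, ← hda]
      ring
  choose! c hc hcG using h1
  refine ⟨∏ f ∈ t, c f, ?_, fun g hg => ?_⟩
  · rw [map_prod]
    exact Finset.prod_ne_zero_iff.2 hc
  -- The elements that together with the product of all denominators make `g` regular. They include
  -- a power of each member of `t`, so they form the unit ideal.
  let I : Ideal A :=
    { carrier := {x | ev (x * ∏ f ∈ t, c f) * g ∈ ev.range}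
      add_mem' := fun {x y} hx hy => by
        simp only [Set.mem_ofPred_eq, add_mul, map_add] at hx hy ⊢
        exact add_mem hx hy
      zero_mem' := ⟨0, by simp⟩
      smul_mem' := fun r x hx => by
        have := ev.range.mul_mem (ev.mem_range_self r) hx
        simpa only [Set.mem_ofPred_eq, smul_eq_mul, map_mul, mul_assoc] using this }
  have hI : I = ⊤ := by
    have hpow : ∀ f : t, ∃ n : ℕ, (f : A) ^ n ∈ I := by
      rintro ⟨f, hf⟩
      obtain ⟨n, a, ha⟩ := hcG f hf g hg
      refine ⟨n, (∏ f' ∈ t.erase f, c f') * a, ?_⟩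
      rw [map_mul, ← ha, ← Finset.mul_prod_erase t c hf]
      simp only [map_mul, map_pow]
      ring
    choose n hn using hpow
    have hrad : Ideal.span (t : Set A) ≤ I.radical :=
      Ideal.span_le.2 fun f hf => ⟨n ⟨f, hf⟩, hn ⟨f, hf⟩⟩
    rw [ht, top_le_iff, Ideal.radical_eq_top] at hrad
    exact hrad
  obtain ⟨a, ha⟩ : (1 : A) ∈ I := hI ▸ trivial
  exact ⟨a, by rw [ha, one_mul]⟩

/-! ### Matrices of morphisms in frames -/

noncomputable section

namespace BondalQuiver

variable {X Y Z : Scheme.{u}} {M N P : X.Modules} {U V T W W' : X.Opens} {m n p : ℕ}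
  {e : Fin m → Γ(M, U)} {f : Fin n → Γ(N, V)} {g : Fin p → Γ(P, T)}

/-- The matrix of a morphism with respect to frames, over an open subset. -/
def frameMatrix (_ : IsFrame M U e) (hf : IsFrame N V f) (hU : W ≤ U) (hV : W ≤ V) (α : M ⟶ N) :
    Matrix (Fin m) (Fin n) Γ(X, W) :=
  Matrix.of fun j => (hf.equiv hV).symm (α.app W (resM M hU (e j)))

variable (he : IsFrame M U e) (hf : IsFrame N V f) (hg : IsFrame P T g) (hU : W ≤ U) (hV : W ≤ V)
  (hT : W ≤ T)

theorem app_eq_sum_frameMatrix (α : M ⟶ N) (j : Fin m) :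
    α.app W (resM M hU (e j)) = ∑ i, frameMatrix he hf hU hV α j i • resM N hV (f i) := by
  rw [← hf.equiv_apply hV]
  exact ((hf.equiv hV).apply_symm_apply _).symm

theorem eq_frameMatrix {α : M ⟶ N} {A : Matrix (Fin m) (Fin n) Γ(X, W)}
    (h : ∀ j, α.app W (resM M hU (e j)) = ∑ i, A j i • resM N hV (f i)) :
    frameMatrix he hf hU hV α = A := by
  funext j
  change (hf.equiv hV).symm _ = _
  rw [LinearEquiv.symm_apply_eq, h, hf.equiv_apply]

/-- The images of the frame are the rows, so diagrammatic composition is multiplication in the same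
order. -/
theorem frameMatrix_comp (α : M ⟶ N) (β : N ⟶ P) :
    frameMatrix he hg hU hT (α ≫ β) =
      frameMatrix he hf hU hV α * frameMatrix hf hg hV hT β := by
  refine eq_frameMatrix he hg hU hT fun j => ?_
  change β.app W (α.app W _) = _
  rw [app_eq_sum_frameMatrix he hf hU hV, map_sum]
  simp only [Scheme.Modules.Hom.app_smul, app_eq_sum_frameMatrix hf hg hV hT, Finset.smul_sum,
    smul_smul, Matrix.mul_apply, Finset.sum_smul]
  exact Finset.sum_comm

theorem frameMatrix_add (α β : M ⟶ N) :
    frameMatrix he hf hU hV (α + β) = frameMatrix he hf hU hV α + frameMatrix he hf hU hV β := by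
  refine eq_frameMatrix he hf hU hV fun j => ?_
  change α.app W _ + β.app W _ = _
  simp only [Matrix.add_apply, add_smul, Finset.sum_add_distrib, app_eq_sum_frameMatrix he hf hU hV]

theorem frameMatrix_smul (c : Γ(X, ⊤)) (α : M ⟶ N) :
    frameMatrix he hf hU hV (c • α) = res W c • frameMatrix he hf hU hV α := by
  refine eq_frameMatrix he hf hU hV fun j => ?_
  rw [smul_app]
  simp only [Matrix.smul_apply, smul_eq_mul, mul_smul, ← Finset.smul_sum,
    app_eq_sum_frameMatrix he hf hU hV]

theorem frameMatrix_res (h : W' ≤ W) (α : M ⟶ N) :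
    frameMatrix he hf (h.trans hU) (h.trans hV) α = (frameMatrix he hf hU hV α).map (resO h) := by
  refine eq_frameMatrix he hf _ _ fun j => ?_
  rw [← resM_resM hU h, app_resM, app_eq_sum_frameMatrix he hf hU hV, map_sum]
  simp only [resM_smul, resM_resM, Matrix.map_apply]

theorem app_eq_of_frameMatrix_eq {α β : M ⟶ N}
    (h : frameMatrix he hf hU hV α = frameMatrix he hf hU hV β) (hW : W' ≤ W) (s : Γ(M, W')) :
    α.app W' s = β.app W' s := by
  refine (he.mono hU).eq_of_app_eq (fun j => ?_) hW s
  rw [app_eq_sum_frameMatrix he hf hU hV, app_eq_sum_frameMatrix he hf hU hV, h]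

theorem frameMatrix_pullback (q : Y ⟶ X) (α : M ⟶ N) :
    frameMatrix (he.pull q) (hf.pull q) (q.preimage_mono hU) (q.preimage_mono hV)
      ((Scheme.Modules.pullback q).map α) = (frameMatrix he hf hU hV α).map (q.app W) := by
  refine eq_frameMatrix _ _ _ _ fun j => ?_
  rw [← pull_resM q hU, map_pull, app_eq_sum_frameMatrix he hf hU hV, map_sum]
  simp only [pull_smul, pull_resM, Matrix.map_apply]

end BondalQuiver

end

/-! ### Values at points and denominators of morphisms -/

noncomputable section

namespace BondalQuiver

section Evaluation

variable {X : Scheme.{u}} {U W : X.Opens}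

/-- The value of a function at a point. -/
def evalAt {x : X} (hx : x ∈ U) : Γ(X, U) →+* X.residueField x := (X.evaluation U x hx).hom

theorem evalAt_resO {x : X} (h : W ≤ U) (hx : x ∈ W) (a : Γ(X, U)) :
    evalAt hx (resO h a) = evalAt (h hx) a := by
  have := X.presheaf.germ_res (homOfLE h) x hx
  exact congr_arg (X.residue x).hom congr($(this).hom a)

theorem evalAt_ne_zero_iff {x : X} (hx : x ∈ U) (a : Γ(X, U)) :
    evalAt hx a ≠ 0 ↔ x ∈ X.basicOpen a :=
  X.evaluation_ne_zero_iff_mem_basicOpen x hx a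

theorem exists_evalAt_mul_eq (hU : IsAffineOpen U) {x : X} (hx : x ∈ U) (z : X.residueField x) :
    ∃ a d : Γ(X, U), evalAt hx d ≠ 0 ∧ evalAt hx d * z = evalAt hx a := by
  obtain ⟨w, rfl⟩ := X.residue_surjective x z
  let _ := X.presheaf.algebra_section_stalk ⟨x, hx⟩
  have := hU.isLocalization_stalk ⟨x, hx⟩
  obtain ⟨⟨a, d⟩, had⟩ := IsLocalization.surj (hU.primeIdealOf ⟨x, hx⟩).asIdeal.primeCompl w
  refine ⟨a, d, ?_, ?_⟩
  · have h1 := IsLocalization.map_units (X.presheaf.stalk x) d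
    exact (h1.map (X.residue x).hom).ne_zero
  · have h2 := congr_arg (X.residue x).hom had
    rw [map_mul, mul_comm] at h2
    exact h2

theorem exists_evalAt_eq_zero_iff (hU : IsAffineOpen U) (P : Ideal Γ(X, U)) [hP : P.IsPrime] :
    ∃ (x : X) (hx : x ∈ U), ∀ a, evalAt hx a = 0 ↔ a ∈ P := by
  let y : PrimeSpectrum Γ(X, U) := ⟨P, hP⟩
  have hy : hU.fromSpec y ∈ U := by
    have h : hU.fromSpec y ∈ Set.range hU.fromSpec := ⟨y, rfl⟩
    rw [hU.range_fromSpec] at h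
    exact h
  refine ⟨hU.fromSpec y, hy, fun a => ?_⟩
  let _ := X.presheaf.algebra_section_stalk ⟨hU.fromSpec y, hy⟩
  have : IsLocalization.AtPrime (X.presheaf.stalk (hU.fromSpec y)) P :=
    hU.isLocalization_stalk' y hy
  rw [← IsLocalization.AtPrime.to_map_mem_maximal_iff (X.presheaf.stalk (hU.fromSpec y)) P a]
  exact IsLocalRing.residue_eq_zero_iff _

theorem exists_resO_eq_pow_mul (hU : IsAffineOpen U) (f : Γ(X, U)) (b : Γ(X, X.basicOpen f)) :
    ∃ (n : ℕ) (a : Γ(X, U)), resO (X.basicOpen_le f) a = resO (X.basicOpen_le f) f ^ n * b := by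
  have := hU.isLocalization_basicOpen f
  obtain ⟨n, a, ha⟩ := IsLocalization.Away.surj f b
  refine ⟨n, a, ?_⟩
  rw [mul_comm]
  exact ha.symm

end Evaluation

section Finiteness

variable {X : Scheme.{u}} {E F : X.Modules} {U W : X.Opens}

theorem exists_isFrame_basicOpen (hU : IsAffineOpen U) (hE : IsVectorBundle E)
    (hF : IsVectorBundle F) {x : X} (hx : x ∈ U) :
    ∃ g : Γ(X, U), x ∈ X.basicOpen g ∧ ∃ (m m' : ℕ) (e : Fin m → Γ(E, X.basicOpen g))
      (f : Fin m' → Γ(F, X.basicOpen g)), IsFrame E _ e ∧ IsFrame F _ f := by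
  obtain ⟨U₁, hx₁, m, e, he⟩ := hE.exists_isFrame x
  obtain ⟨U₂, hx₂, m', f, hf⟩ := hF.exists_isFrame x
  obtain ⟨g, hg, hxg⟩ := hU.exists_basicOpen_le (V := U₁ ⊓ U₂) ⟨x, hx₁, hx₂⟩ hx
  exact ⟨g, hxg, m, m', _, _, he.mono (hg.trans inf_le_left), hf.mono (hg.trans inf_le_right)⟩

/-- Morphisms of vector bundles, evaluated by functionals on their matrices in one chart, have
bounded denominators in every other affine chart. -/
theorem exists_evalAt_mul_frameMatrix_eq
    (hN : ∀ D : X.Opens, IsAffineOpen D → IsNoetherianRing Γ(X, D))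
    (hE : IsVectorBundle E) (hF : IsVectorBundle F) (hU : IsAffineOpen U) (hW : IsAffineOpen W)
    {m m' : ℕ} {e : Fin m → Γ(E, W)} {f : Fin m' → Γ(F, W)} (he : IsFrame E W e)
    (hf : IsFrame F W f) {x : X} (hxU : x ∈ U) (hxW : x ∈ W)
    (Y : Submodule Γ(X, W) (Fin m → Fin m' → Γ(X, W))) (l : Y →+ X.residueField x)
    (hl : ∀ a y, l (a • y) = evalAt hxW a * l y) :
    ∃ c : Γ(X, U), evalAt hxU c ≠ 0 ∧ ∀ (φ : E ⟶ F) (h : frameMatrix he hf le_rfl le_rfl φ ∈ Y),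
      ∃ a : Γ(X, U), evalAt hxU c * l ⟨frameMatrix he hf le_rfl le_rfl φ, h⟩ = evalAt hxU a := by
  -- Basic open sets that trivialize both bundles cover `U`. Denominators are bounded on each of
  -- them and then combined.
  let s : Set Γ(X, U) := {g | ∃ (m m' : ℕ) (e : Fin m → Γ(E, X.basicOpen g))
      (f : Fin m' → Γ(F, X.basicOpen g)), IsFrame E _ e ∧ IsFrame F _ f}
  have hs : Ideal.span s = ⊤ := by
    rw [← hU.self_le_iSup_basicOpen_iff]
    intro y hy
    obtain ⟨g, hyg, hg⟩ := exists_isFrame_basicOpen hU hE hF hy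
    exact TopologicalSpace.Opens.mem_iSup.2 ⟨⟨g, hg⟩, hyg⟩
  let G : Set (X.residueField x) :=
    {z | ∃ (φ : E ⟶ F) (h : frameMatrix he hf le_rfl le_rfl φ ∈ Y), l ⟨_, h⟩ = z}
  suffices H : ∀ g ∈ s, evalAt hxU g ≠ 0 → ∃ c : X.residueField x, c ≠ 0 ∧ ∀ z ∈ G,
      ∃ (n : ℕ) (a : Γ(X, U)), evalAt hxU g ^ n * (c * z) = evalAt hxU a by
    obtain ⟨c, hc, h⟩ := exists_mul_mem_range_of_span_eq_top (evalAt hxU)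
      (exists_evalAt_mul_eq hU hxU) s hs G H
    exact ⟨c, hc, fun φ hφ => h _ ⟨φ, hφ, rfl⟩⟩
  rintro g ⟨m₁, m₁', e₁, f₁, he₁, hf₁⟩ hg
  have hxD : x ∈ X.basicOpen g := (evalAt_ne_zero_iff hxU g).1 hg
  have hD := hU.basicOpen g
  have := hN _ hD
  let _ : Algebra Γ(X, W) (X.presheaf.stalk x) := (X.presheaf.germ W x hxW).hom.toAlgebra
  let _ : Algebra Γ(X, X.basicOpen g) (X.presheaf.stalk x) :=
    (X.presheaf.germ (X.basicOpen g) x hxD).hom.toAlgebra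
  let _ : Algebra (X.presheaf.stalk x) (X.residueField x) := (X.residue x).hom.toAlgebra
  let _ : Algebra Γ(X, W) (X.residueField x) := (evalAt hxW).toAlgebra
  let _ : Algebra Γ(X, X.basicOpen g) (X.residueField x) := (evalAt hxD).toAlgebra
  have : IsScalarTower Γ(X, W) (X.presheaf.stalk x) (X.residueField x) :=
    .of_algebraMap_eq fun _ => rfl
  have : IsScalarTower Γ(X, X.basicOpen g) (X.presheaf.stalk x) (X.residueField x) :=
    .of_algebraMap_eq fun _ => rfl
  have hloc : IsLocalization (hW.primeIdealOf ⟨x, hxW⟩).asIdeal.primeCompl (X.presheaf.stalk x) :=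
    hW.isLocalization_stalk ⟨x, hxW⟩
  let l' : Y →ₗ[Γ(X, W)] X.residueField x :=
    { toFun := l
      map_add' := map_add l
      map_smul' := fun a y => by
        rw [hl, RingHom.id_apply, Algebra.smul_def]
        rfl }
  let Q : X.Opens := X.basicOpen g ⊓ W
  have hQD : Q ≤ X.basicOpen g := inf_le_left
  have hQW : Q ≤ W := inf_le_right
  have hxQ : x ∈ Q := ⟨hxD, hxW⟩
  let γ : Γ(X, Q) →+* X.presheaf.stalk x := (X.presheaf.germ Q x hxQ).hom
  have hγD : ∀ a, γ (resO hQD a) = algebraMap Γ(X, X.basicOpen g) (X.presheaf.stalk x) a :=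
    fun a => congr($(X.presheaf.germ_res (homOfLE hQD) x hxQ).hom a)
  have hγW : ∀ a, γ (resO hQW a) = algebraMap Γ(X, W) (X.presheaf.stalk x) a :=
    fun a => congr($(X.presheaf.germ_res (homOfLE hQW) x hxQ).hom a)
  obtain ⟨c, hc, h⟩ := exists_denominator_of_transition (κ := X.residueField x)
    (hW.primeIdealOf ⟨x, hxW⟩).asIdeal.primeCompl
    ((frameMatrix he he₁ hQW hQD (𝟙 E)).map γ) ((frameMatrix hf₁ hf hQD hQW (𝟙 F)).map γ)
    (exists_evalAt_mul_eq hD hxD) Y l'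
  refine ⟨_, hc, ?_⟩
  rintro _ ⟨φ, hφ, rfl⟩
  -- On the overlap the two matrices of `φ` differ by the matrices of the identities between the two
  -- frames; taking germs gives the transition relation.
  obtain ⟨b, hb⟩ := h (frameMatrix he₁ hf₁ le_rfl le_rfl φ) ⟨_, hφ⟩ (by
    have h1 : frameMatrix he hf hQW hQW φ = frameMatrix he he₁ hQW hQD (𝟙 E) *
        frameMatrix he₁ hf₁ hQD hQD φ * frameMatrix hf₁ hf hQD hQW (𝟙 F) := by
      rw [← frameMatrix_comp, ← frameMatrix_comp, Category.id_comp, Category.comp_id]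
    have h2 := congr_arg (fun A => A.map γ) h1
    simp only [Matrix.map_mul] at h2
    rw [show frameMatrix he hf hQW hQW φ = _ from frameMatrix_res he hf le_rfl le_rfl hQW φ,
      show frameMatrix he₁ hf₁ hQD hQD φ = _ from frameMatrix_res he₁ hf₁ le_rfl le_rfl hQD φ,
      Matrix.map_map, Matrix.map_map] at h2
    rw [show (γ ∘ resO hQW : _ → _) = algebraMap Γ(X, W) (X.presheaf.stalk x) from funext hγW,
      show (γ ∘ resO hQD : _ → _) = algebraMap Γ(X, X.basicOpen g) (X.presheaf.stalk x) from
        funext hγD] at h2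
    exact h2.symm)
  -- The value obtained is regular only on the basic open set of `g`; a power of `g` extends it to
  -- `U`.
  obtain ⟨n, a, ha⟩ := exists_resO_eq_pow_mul hU g b
  refine ⟨n, a, ?_⟩
  have h3 := congr_arg (evalAt hxD) ha
  rw [map_mul, map_pow, evalAt_resO, evalAt_resO] at h3
  rw [h3]
  exact congr_arg (fun z => evalAt hxU g ^ n * z) hb

end Finiteness

end BondalQuiver

end

/-! ### Finiteness of spaces of morphisms -/

noncomputable section

namespace BondalQuiver

section Finiteness

variable {X : Scheme.{u}} {E F : X.Modules}

/-- Finiteness of a space of functions at a point: if it has bounded denominators in all charts of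
a projective scheme, it is finite over the base. -/
theorem fg_of_bounded_denominators {k B : Type*} [Field k] [PerfectField k] [CommRing B]
    [Algebra k B] [Algebra.FiniteType k B] (β : B →+* Γ(X, ⊤)) {m : ℕ} {U : Fin (m + 1) → X.Opens}
    {y : ∀ i, Fin (m + 1) → Γ(X, U i)} (hcov : ⨆ i, U i = ⊤) (hy1 : ∀ i, y i i = 1)
    (hy : ∀ (i j l : Fin (m + 1)) (W : X.Opens) (hi : W ≤ U i) (hj : W ≤ U j),
      resO hi (y i l) = resO hj (y j l) * resO hi (y i j))
    (hyU : ∀ i j, X.basicOpen (y i j) ≤ U j)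
    (hgen : ∀ i s, s ∈ Subring.closure
      (Set.range (fun b => resO (le_top : U i ≤ ⊤) (β b)) ∪ Set.range (y i)))
    (x : X) [Algebra B (X.residueField x)]
    (hβ : ∀ b, algebraMap B (X.residueField x) b = evalAt (U := ⊤) trivial (β b))
    (G : Submodule B (X.residueField x))
    (hG : ∀ i (hx : x ∈ U i), ∃ c : Γ(X, U i), evalAt hx c ≠ 0 ∧ ∀ z ∈ G, ∃ a : Γ(X, U i),
      evalAt hx c * z = evalAt hx a) : G.FG := by
  classical
  obtain ⟨i₀, hi₀⟩ : ∃ i, x ∈ U i := by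
    have : x ∈ ⨆ i, U i := hcov ▸ trivial
    exact TopologicalSpace.Opens.mem_iSup.1 this
  -- Homogeneous coordinates of the point, normalized to be `1` at `i₀`.
  let v : Fin (m + 1) → X.residueField x := fun l => evalAt hi₀ (y i₀ l)
  have hmem : ∀ i, v i ≠ 0 → x ∈ U i := fun i hi => hyU i₀ i ((evalAt_ne_zero_iff hi₀ _).1 hi)
  have hv : ∀ i (hi : v i ≠ 0) l, v l / v i = evalAt (hmem i hi) (y i l) := by
    intro i hi l
    rw [div_eq_iff hi]
    have hx' : x ∈ U i₀ ⊓ U i := ⟨hi₀, hmem i hi⟩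
    have h := congr_arg (evalAt hx')
      (hy i₀ i l _ inf_le_left inf_le_right)
    rw [map_mul, evalAt_resO, evalAt_resO, evalAt_resO] at h
    exact h
  have hadj : ∀ i (hi : v i ≠ 0) a, evalAt (hmem i hi) a ∈
      Algebra.adjoin B (Set.range fun l => v l / v i) := by
    intro i hi a
    induction hgen i a using Subring.closure_induction with
    | mem a ha =>
      rcases ha with ⟨b, rfl⟩ | ⟨l, rfl⟩
      · have : evalAt (hmem i hi) (resO (le_top : U i ≤ ⊤) (β b)) =
          algebraMap B (X.residueField x) b := by rw [evalAt_resO, hβ]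
        rw [this]
        exact Subalgebra.algebraMap_mem _ b
      · rw [← hv i hi l]
        exact Algebra.subset_adjoin ⟨l, rfl⟩
    | zero => simp
    | one => simp
    | add a b _ _ ha hb => rw [map_add]; exact add_mem ha hb
    | neg a _ ha => rw [map_neg]; exact neg_mem ha
    | mul a b _ _ ha hb => rw [map_mul]; exact mul_mem ha hb
  choose c hc hcG using hG
  refine Submodule.fg_of_mul_mem_adjoin_div k (x := v) ⟨i₀, ?_⟩ G
    (fun i => if hi : v i ≠ 0 then evalAt (hmem i hi) (c i (hmem i hi)) else 0) ?_ ?_ ?_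
  · simp only [v, hy1, map_one]
    exact one_ne_zero
  · intro i hi
    rw [dif_pos hi]
    exact hc i _
  · intro i hi
    rw [dif_pos hi]
    exact hadj i hi _
  · intro i hi z hz
    rw [dif_pos hi]
    obtain ⟨a, ha⟩ := hcG i (hmem i hi) z hz
    rw [ha]
    exact hadj i hi _

/-- Morphisms between vector bundles on a projective scheme form a finite module: the space of
matrices in one chart. -/
theorem fg_range_frameMatrix {k B : Type*} [Field k] [PerfectField k] [CommRing B]
    [Algebra k B] [Algebra.FiniteType k B] [Algebra B Γ(X, ⊤)] {m : ℕ} {U : Fin (m + 1) → X.Opens}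
    {y : ∀ i, Fin (m + 1) → Γ(X, U i)} (hU : ∀ i, IsAffineOpen (U i)) (hcov : ⨆ i, U i = ⊤)
    (hy1 : ∀ i, y i i = 1)
    (hy : ∀ (i j l : Fin (m + 1)) (W : X.Opens) (hi : W ≤ U i) (hj : W ≤ U j),
      resO hi (y i l) = resO hj (y j l) * resO hi (y i j))
    (hyU : ∀ i j, X.basicOpen (y i j) ≤ U j)
    (hgen : ∀ i s, s ∈ Subring.closure
      (Set.range (fun b => resO (le_top : U i ≤ ⊤) (algebraMap B Γ(X, ⊤) b)) ∪ Set.range (y i)))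
    (hN : ∀ D : X.Opens, IsAffineOpen D → IsNoetherianRing Γ(X, D))
    (hE : IsVectorBundle E) (hF : IsVectorBundle F) {W : X.Opens} (hW : IsAffineOpen W)
    {n n' : ℕ} {e : Fin n → Γ(E, W)} {f : Fin n' → Γ(F, W)} (he : IsFrame E W e)
    (hf : IsFrame F W f) [Algebra B Γ(X, W)]
    (hBW : ∀ b, algebraMap B Γ(X, W) b = resO le_top (algebraMap B Γ(X, ⊤) b))
    (G : Submodule B (Fin n → Fin n' → Γ(X, W)))
    (hG : ∀ g ∈ G, ∃ φ : E ⟶ F, frameMatrix he hf le_rfl le_rfl φ = g) : G.FG := by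
  have := hN W hW
  have : IsNoetherianRing B := Algebra.FiniteType.isNoetherianRing k B
  refine Submodule.fg_of_fg_prime_subquotients (C := Γ(X, W)) G fun P hP Y l => ?_
  -- The prime is a point of `W`, and the quotient embeds in its residue field, where denominators
  -- can be bounded chart by chart.
  obtain ⟨x, hxW, hx⟩ := exists_evalAt_eq_zero_iff hW P
  let _ : Algebra B (X.residueField x) :=
    ((evalAt (U := ⊤) (x := x) trivial).comp (algebraMap B Γ(X, ⊤))).toAlgebra
  let κ : Γ(X, W) ⧸ P →+* X.residueField x := Ideal.Quotient.lift P (evalAt hxW)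
    fun a ha => (hx a).2 ha
  have hκ : Function.Injective κ := by
    rw [injective_iff_map_eq_zero]
    intro a ha
    obtain ⟨a, rfl⟩ := Ideal.Quotient.mk_surjective a
    exact Ideal.Quotient.eq_zero_iff_mem.2 ((hx a).1 ha)
  have hκB : ∀ b, κ (algebraMap B _ b) = algebraMap B (X.residueField x) b := by
    intro b
    change evalAt hxW (algebraMap B Γ(X, W) b) = _
    rw [hBW, evalAt_resO]
    rfl
  let κ' : (Γ(X, W) ⧸ P) →ₗ[B] X.residueField x :=
    { toFun := κ
      map_add' := map_add κ
      map_smul' := fun b a => by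
        rw [Algebra.smul_def, map_mul, hκB, RingHom.id_apply, Algebra.smul_def] }
  refine Submodule.fg_of_fg_map_injective κ' hκ ?_
  refine fg_of_bounded_denominators (k := k) (algebraMap B Γ(X, ⊤)) hcov hy1 hy hyU hgen x
    (fun _ => rfl) _ fun i hxi => ?_
  obtain ⟨c, hc, h⟩ := exists_evalAt_mul_frameMatrix_eq hN hE hF (hU i) hW he hf hxi hxW Y
    (κ'.toAddMonoidHom.comp l.toAddMonoidHom) (fun a z => by
      change κ (l (a • z)) = evalAt hxW a * κ (l z)
      rw [map_smul, Algebra.smul_def, map_mul]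
      rfl)
  refine ⟨c, hc, ?_⟩
  rintro _ ⟨_, ⟨z, hz, rfl⟩, rfl⟩
  obtain ⟨φ, hφ⟩ := hG _ hz
  obtain ⟨z, hzY⟩ := z
  obtain rfl : _ = z := hφ
  exact h φ hzY

/-- Morphisms between vector bundles on a scheme that is projective over an affine scheme of
finite type form a finite module. -/
theorem finite_hom {k B : Type*} [Field k] [PerfectField k] [CommRing B]
    [Algebra k B] [Algebra.FiniteType k B] [Algebra B Γ(X, ⊤)] [CompactSpace X]
    {m : ℕ} {U : Fin (m + 1) → X.Opens}
    {y : ∀ i, Fin (m + 1) → Γ(X, U i)} (hU : ∀ i, IsAffineOpen (U i)) (hcov : ⨆ i, U i = ⊤)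
    (hy1 : ∀ i, y i i = 1)
    (hy : ∀ (i j l : Fin (m + 1)) (W : X.Opens) (hi : W ≤ U i) (hj : W ≤ U j),
      resO hi (y i l) = resO hj (y j l) * resO hi (y i j))
    (hyU : ∀ i j, X.basicOpen (y i j) ≤ U j)
    (hgen : ∀ i s, s ∈ Subring.closure
      (Set.range (fun b => resO (le_top : U i ≤ ⊤) (algebraMap B Γ(X, ⊤) b)) ∪ Set.range (y i)))
    (hN : ∀ D : X.Opens, IsAffineOpen D → IsNoetherianRing Γ(X, D))
    (hE : IsVectorBundle E) (hF : IsVectorBundle F) [Module B (E ⟶ F)]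
    [IsScalarTower B Γ(X, ⊤) (E ⟶ F)] : Module.Finite B (E ⟶ F) := by
  have : IsNoetherianRing B := Algebra.FiniteType.isNoetherianRing k B
  have hch : ∀ x : X, ∃ W : X.Opens, x ∈ W ∧ IsAffineOpen W ∧ ∃ (n n' : ℕ)
      (e : Fin n → Γ(E, W)) (f : Fin n' → Γ(F, W)), IsFrame E W e ∧ IsFrame F W f := by
    intro x
    obtain ⟨i, hi⟩ : ∃ i, x ∈ U i := by
      have : x ∈ ⨆ i, U i := hcov ▸ trivial
      exact TopologicalSpace.Opens.mem_iSup.1 this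
    obtain ⟨g, hg, h⟩ := exists_isFrame_basicOpen (hU i) hE hF hi
    exact ⟨_, hg, (hU i).basicOpen g, h⟩
  choose W hxW hW n n' e f he hf using hch
  obtain ⟨t, ht⟩ := isCompact_univ.elim_finite_subcover (fun x => (W x : Set X))
    (fun x => (W x).isOpen) (fun x _ => Set.mem_iUnion.2 ⟨x, hxW x⟩)
  let _ (x : X) : Algebra B Γ(X, W x) :=
    ((resO (le_top : W x ≤ ⊤)).comp (algebraMap B Γ(X, ⊤))).toAlgebra
  let Φ (x : X) : (E ⟶ F) →ₗ[B] (Fin (n x) → Fin (n' x) → Γ(X, W x)) :=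
    { toFun := frameMatrix (he x) (hf x) le_rfl le_rfl
      map_add' := frameMatrix_add (he x) (hf x) le_rfl le_rfl
      map_smul' := fun b φ => by
        rw [← algebraMap_smul Γ(X, ⊤) b φ, frameMatrix_smul]
        funext i j
        exact (Algebra.smul_def b (frameMatrix (he x) (hf x) le_rfl le_rfl φ i j)).symm }
  have hfin : ∀ x, Module.Finite B (LinearMap.range (Φ x)) := fun x =>
    Module.Finite.iff_fg.2 (fg_range_frameMatrix (k := k) hU hcov hy1 hy hyU hgen hN hE hF (hW x)
      (he x) (hf x) (fun _ => rfl) _ fun g ⟨φ, hφ⟩ => ⟨φ, hφ⟩)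
  have hno : ∀ x, IsNoetherian B (LinearMap.range (Φ x)) := fun x =>
    isNoetherian_of_isNoetherianRing_of_finite B _
  -- A morphism is determined by its matrices in finitely many charts, so `Hom` embeds in a
  -- Noetherian module.
  let Ψ : (E ⟶ F) →ₗ[B] (∀ x : t, LinearMap.range (Φ x)) := .pi fun x => (Φ x).rangeRestrict
  refine Module.Finite.of_injective Ψ fun φ ψ h => hom_ext_of_cover fun x => ?_
  obtain ⟨z, hz, hxz⟩ := Set.mem_iUnion₂.1 (ht (Set.mem_univ x))
  refine ⟨W z, hxz, fun W' hW' s => app_eq_of_frameMatrix_eq (he z) (hf z) le_rfl le_rfl ?_ hW' s⟩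
  exact congr_arg Subtype.val (congr_fun h ⟨z, hz⟩)

end Finiteness

end BondalQuiver

end

/-! ### The action of the multiplicative group on morphisms -/

noncomputable section

namespace BondalQuiver

section PullbackCongr

variable {X Y : Scheme.{u}} {M N : X.Modules}

theorem pullbackCongr_refl (f : Y ⟶ X) (h : f = f) (M : X.Modules) :
    (Scheme.Modules.pullbackCongr h).hom.app M = 𝟙 _ := rfl

theorem pullbackCongr_trans {f g h : Y ⟶ X} (h₁ : f = g) (h₂ : g = h) (M : X.Modules) :
    (Scheme.Modules.pullbackCongr h₁).hom.app M ≫ (Scheme.Modules.pullbackCongr h₂).hom.app M =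
      (Scheme.Modules.pullbackCongr (h₁.trans h₂)).hom.app M := by
  subst h₁ h₂
  rw [pullbackCongr_refl, Category.id_comp]

theorem pullbackComp_id (f : Y ⟶ X) (M : X.Modules) :
    (Scheme.Modules.pullbackComp f (𝟙 X)).hom.app M ≫
      (Scheme.Modules.pullbackCongr (Category.comp_id f)).hom.app M =
        (Scheme.Modules.pullback f).map ((Scheme.Modules.pullbackId X).hom.app M) := by
  have h := congr_arg (fun α => NatTrans.app α M) (Scheme.Modules.pseudofunctor_left_unitality f)
  have h' : (Scheme.Modules.pullbackComp f (𝟙 X)).inv.app M ≫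
      (Scheme.Modules.pullback f).map ((Scheme.Modules.pullbackId X).hom.app M) ≫ 𝟙 _ =
        (Scheme.Modules.pullbackCongr (Category.comp_id f)).hom.app M := h
  refine (congr_arg (fun α => (Scheme.Modules.pullbackComp f (𝟙 X)).hom.app M ≫ α) h').symm.trans ?_
  exact (Iso.hom_inv_id_app_assoc (Scheme.Modules.pullbackComp f (𝟙 X)) M _).trans
    (Category.comp_id _)

end PullbackCongr

variable {k : Type u} [Field k] {V : Scheme.{u}} [V.Over (Spec (.of k))] {σ : GmAction k V}

section Conj

variable {E F G : EquivariantVectorBundle σ} {T T' : Scheme.{u}}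

/-- The morphism `x^* E ⟶ x^* F` corresponding to `(t · x)^* φ`. -/
def conj (t : Γ(T, ⊤)ˣ) (x : T ⟶ V) (φ : E.sheaf ⟶ F.sheaf) :
    (Scheme.Modules.pullback x).obj E.sheaf ⟶ (Scheme.Modules.pullback x).obj F.sheaf :=
  (E.equivariant.iso t x).inv ≫ (Scheme.Modules.pullback (σ.act t x)).map φ ≫
    (F.equivariant.iso t x).hom

theorem mem_weightSpace_iff {r : ℤ} {φ : E.sheaf ⟶ F.sheaf} :
    φ ∈ weightSpace E F r ↔ ∀ {T : Scheme.{u}} (t : Γ(T, ⊤)ˣ) (x : T ⟶ V),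
      conj t x φ = ((t ^ r : Γ(T, ⊤)ˣ) : Γ(T, ⊤)) • (Scheme.Modules.pullback x).map φ := by
  refine forall_congr' fun T => forall_congr' fun t => forall_congr' fun x => ?_
  rw [conj, Iso.inv_comp_eq]

theorem conj_sum {ι : Type*} (s : Finset ι) (t : Γ(T, ⊤)ˣ) (x : T ⟶ V)
    (φ : ι → (E.sheaf ⟶ F.sheaf)) : conj t x (∑ i ∈ s, φ i) = ∑ i ∈ s, conj t x (φ i) := by
  simp only [conj, Functor.map_sum, Preadditive.sum_comp, Preadditive.comp_sum]

theorem conj_smul (t : Γ(T, ⊤)ˣ) (x : T ⟶ V) (g : Γ(V, ⊤)) (φ : E.sheaf ⟶ F.sheaf) :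
    conj t x (g • φ) = (σ.act t x).appTop g • conj t x φ := by
  simp only [conj, pullback_map_smul, Linear.smul_comp, Linear.comp_smul]

theorem conj_const_smul (t : Γ(T, ⊤)ˣ) (x : T ⟶ V) (c : k) (φ : E.sheaf ⟶ F.sheaf) :
    conj t x (c • φ) = x.appTop (constants k V c) • conj t x φ := by
  rw [smul_eq_constants_smul, conj_smul, appTop_constants]

theorem conj_comp_hom (t : Γ(T, ⊤)ˣ) (x : T ⟶ V) (φ : E.sheaf ⟶ F.sheaf) (ψ : F.sheaf ⟶ G.sheaf) :
    conj t x (φ ≫ ψ) = conj t x φ ≫ conj (F := G) t x ψ := by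
  simp only [conj, Functor.map_comp, Category.assoc, Iso.hom_inv_id_assoc]

theorem conj_id (t : Γ(T, ⊤)ˣ) (x : T ⟶ V) : conj (F := E) t x (𝟙 E.sheaf) = 𝟙 _ := by
  simp only [conj, CategoryTheory.Functor.map_id, Category.id_comp, Iso.inv_hom_id]

theorem iso_congr (E : EquivariantVectorBundle σ) {t t' : Γ(T, ⊤)ˣ} {x x' : T ⟶ V} (ht : t = t')
    (hx : x = x') :
    (E.equivariant.iso t x).hom ≫ (Scheme.Modules.pullbackCongr hx).hom.app E.sheaf =
      (Scheme.Modules.pullbackCongr (by rw [ht, hx])).hom.app E.sheaf ≫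
        (E.equivariant.iso t' x').hom := by
  subst ht hx
  rw [pullbackCongr_refl, pullbackCongr_refl, Category.id_comp, Category.comp_id]

theorem conj_congr {t t' : Γ(T, ⊤)ˣ} {x x' : T ⟶ V} (ht : t = t') (hx : x = x')
    (φ : E.sheaf ⟶ F.sheaf) :
    conj t x φ ≫ (Scheme.Modules.pullbackCongr hx).hom.app F.sheaf =
      (Scheme.Modules.pullbackCongr hx).hom.app E.sheaf ≫ conj t' x' φ := by
  subst ht hx
  rw [pullbackCongr_refl, pullbackCongr_refl, Category.id_comp, Category.comp_id]

theorem conj_mul (s t : Γ(T, ⊤)ˣ) (x : T ⟶ V) (φ : E.sheaf ⟶ F.sheaf) :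
    conj (s * t) x φ = (E.equivariant.iso t x).inv ≫ conj s (σ.act t x) φ ≫
      (F.equivariant.iso t x).hom := by
  rw [conj, Iso.inv_comp_eq, E.equivariant.iso_mul, F.equivariant.iso_mul, conj]
  simp only [Category.assoc, Iso.hom_inv_id_assoc]
  exact (Scheme.Modules.pullbackCongr (σ.mul_act s t x)).hom.naturality_assoc φ _

theorem conj_comp (q : T' ⟶ T) (t : Γ(T, ⊤)ˣ) (x : T ⟶ V) (φ : E.sheaf ⟶ F.sheaf) :
    (Scheme.Modules.pullback q).map (conj t x φ) ≫
        (Scheme.Modules.pullbackComp q x).hom.app F.sheaf =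
      (Scheme.Modules.pullbackComp q x).hom.app E.sheaf ≫
        conj (unitsPullback q t) (q ≫ x) φ := by
  have hE := E.equivariant.iso_comp q t x
  have hF := F.equivariant.iso_comp q t x
  have hE' : (Scheme.Modules.pullbackComp q x).hom.app E.sheaf ≫
      (E.equivariant.iso (unitsPullback q t) (q ≫ x)).inv =
      (Scheme.Modules.pullback q).map (E.equivariant.iso t x).inv ≫
        (Scheme.Modules.pullbackComp q (σ.act t x)).hom.app E.sheaf ≫
          (Scheme.Modules.pullbackCongr (σ.comp_act q t x)).hom.app E.sheaf := by
    rw [Iso.comp_inv_eq]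
    simp only [Category.assoc]
    rw [← hE, ← Functor.map_comp_assoc, Iso.inv_hom_id, CategoryTheory.Functor.map_id, Category.id_comp]
  rw [conj, conj, Functor.map_comp, Functor.map_comp, Category.assoc, Category.assoc, hF,
    reassoc_of% hE']
  have h1 := (Scheme.Modules.pullbackComp q (σ.act t x)).hom.naturality φ
  have h2 := (Scheme.Modules.pullbackCongr (σ.comp_act q t x)).hom.naturality φ
  rw [Functor.comp_map] at h1
  rw [← reassoc_of% h2, ← reassoc_of% h1]

/-- The abstract form of the argument that a cocycle is trivial at the unit: cancelling `i` in `h₁`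
makes `w` and `i₂` inverse, after which `h₂` compares `i` with `u`. -/
theorem eq_of_cocycle {C : Type*} [Category C] {b c d : C} {i u : c ⟶ d} [IsIso i] {i₂ z : b ⟶ c}
    {w : c ⟶ b} (h₁ : i = w ≫ i₂ ≫ i) (h₂ : i₂ ≫ u = z ≫ i) (h₃ : w ≫ z = 𝟙 c) : i = u := by
  have h₄ : 𝟙 c = w ≫ i₂ := by
    rw [← cancel_mono i, Category.id_comp, Category.assoc]
    exact h₁
  rw [← Category.id_comp u, h₄, Category.assoc, h₂, ← Category.assoc, h₃, Category.id_comp]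

/-- Freeing the product as a variable `w` lets the cocycle condition be read at `1 * 1 = 1` without
transporting along that equation. -/
theorem exists_iso_eq_of_mul_eq (E : EquivariantVectorBundle σ) {s t w : Γ(T, ⊤)ˣ} (h : s * t = w)
    (x : T ⟶ V) : ∃ h' : σ.act w x = σ.act s (σ.act t x), (E.equivariant.iso w x).hom =
      (Scheme.Modules.pullbackCongr h').hom.app E.sheaf ≫
        (E.equivariant.iso s (σ.act t x)).hom ≫ (E.equivariant.iso t x).hom := by
  subst h
  exact ⟨_, E.equivariant.iso_mul s t x⟩

theorem iso_one (E : EquivariantVectorBundle σ) (x : T ⟶ V) :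
    (E.equivariant.iso 1 x).hom =
      (Scheme.Modules.pullbackCongr (σ.one_act x)).hom.app E.sheaf := by
  obtain ⟨h, h₁⟩ := exists_iso_eq_of_mul_eq E (mul_one 1) x
  have h₂ := iso_congr E (rfl : (1 : Γ(T, ⊤)ˣ) = 1) (σ.one_act x)
  exact eq_of_cocycle h₁ h₂ ((pullbackCongr_trans _ _ _).trans (pullbackCongr_refl _ _ _))

theorem conj_one (x : T ⟶ V) (φ : E.sheaf ⟶ F.sheaf) :
    conj 1 x φ = (Scheme.Modules.pullback x).map φ := by
  rw [conj, Iso.inv_comp_eq, iso_one, iso_one]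
  exact (Scheme.Modules.pullbackCongr (σ.one_act x)).hom.naturality φ

/-- The action of a global unit on morphisms. -/
def unitAct (s : Γ(V, ⊤)ˣ) (φ : E.sheaf ⟶ F.sheaf) : E.sheaf ⟶ F.sheaf :=
  (Scheme.Modules.pullbackId V).inv.app E.sheaf ≫ conj s (𝟙 V) φ ≫
    (Scheme.Modules.pullbackId V).hom.app F.sheaf

/-- The action at an arbitrary point is pulled back from the identity point, by functoriality in
`T`. -/
theorem pullback_map_unitAct (x : T ⟶ V) (s : Γ(V, ⊤)ˣ) (φ : E.sheaf ⟶ F.sheaf) :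
    (Scheme.Modules.pullback x).map (unitAct s φ) = conj (unitsPullback x s) x φ := by
  rw [unitAct, Functor.map_comp, Functor.map_comp, ← pullbackComp_id]
  have h1 := conj_comp x s (𝟙 V) φ
  have h2 := conj_congr (rfl : unitsPullback x s = unitsPullback x s) (Category.comp_id x) φ
  rw [reassoc_of% h1, h2, reassoc_of% (pullbackComp_id x E.sheaf), ← Functor.map_comp_assoc]
  have h3 := (Scheme.Modules.pullbackId V).inv_hom_id_app E.sheaf
  rw [h3]
  have h4 : (Scheme.Modules.pullback x).map (𝟙 E.sheaf) ≫ conj (F := F) (unitsPullback x s) x φ =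
      conj (unitsPullback x s) x φ := by
    rw [CategoryTheory.Functor.map_id, Category.id_comp]
  exact h4

variable (V) in
/-- A nonzero constant as a global unit. -/
abbrev constUnit : kˣ →* Γ(V, ⊤)ˣ := Units.map (constants k V : k →* Γ(V, ⊤))

/-- The action law. Since `t` acts over `k`, a constant unit has the same pullback along `x` and
along `t · x`. -/
theorem conj_unitAct (t : Γ(T, ⊤)ˣ) (x : T ⟶ V) (a : kˣ) (φ : E.sheaf ⟶ F.sheaf) :
    conj t x (unitAct (constUnit V a) φ) =
      conj (unitsPullback x (constUnit V a) * t) x φ := by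
  have h : unitsPullback (σ.act t x) (constUnit V a) = unitsPullback x (constUnit V a) :=
    Units.ext (appTop_constants σ t x a)
  rw [conj_mul, conj, pullback_map_unitAct, h]

end Conj

end BondalQuiver

end

/-! ### The action in frames, at points with values in rings -/

noncomputable section

namespace BondalQuiver

section Frames

variable {X : Scheme.{u}} {M N M' N' : X.Modules} {U V W : X.Opens} {m n : ℕ}

theorem frameMatrix_of_square {e : Fin m → Γ(M, U)} {f : Fin n → Γ(N, V)} {e' : Fin m → Γ(M', U)}
    {f' : Fin n → Γ(N', V)} (he : IsFrame M U e) (hf : IsFrame N V f) (he' : IsFrame M' U e')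
    (hf' : IsFrame N' V f') (hU : W ≤ U) (hV : W ≤ V) {α : M ⟶ N} {α' : M' ⟶ N'} {a : M ⟶ M'}
    {b : N ⟶ N'} (h : α ≫ b = a ≫ α') (ha : ∀ j, a.app U (e j) = e' j)
    (hb : ∀ j, b.app V (f j) = f' j) :
    frameMatrix he' hf' hU hV α' = frameMatrix he hf hU hV α := by
  refine eq_frameMatrix he' hf' hU hV fun j => ?_
  rw [← ha, ← app_resM]
  have h' := congr_arg (fun β => Scheme.Modules.Hom.app β W (resM M hU (e j))) h
  refine Eq.trans h'.symm ?_
  change b.app W (α.app W _) = _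
  rw [app_eq_sum_frameMatrix he hf hU hV, map_sum]
  simp only [Scheme.Modules.Hom.app_smul, app_resM, hb]

theorem frameMatrix_pullback_appLE {Y : Scheme.{u}} {e : Fin m → Γ(M, U)} {f : Fin n → Γ(N, U)}
    (he : IsFrame M U e) (hf : IsFrame N U f) (hU : W ≤ U) (q : Y ⟶ X) {D : Y.Opens}
    (hD : D ≤ q ⁻¹ᵁ W) (hD' : D ≤ q ⁻¹ᵁ U) (α : M ⟶ N) :
    frameMatrix (he.pull q) (hf.pull q) hD' hD' ((Scheme.Modules.pullback q).map α) =
      (frameMatrix he hf hU hU α).map (q.appLE W D hD).hom := by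
  rw [show frameMatrix (he.pull q) (hf.pull q) hD' hD' ((Scheme.Modules.pullback q).map α) = _ from
    frameMatrix_res (he.pull q) (hf.pull q) (q.preimage_mono hU) (q.preimage_mono hU) hD _,
    frameMatrix_pullback, Matrix.map_map]
  rfl

end Frames

/-! ### Points with values in rings -/

section SpecPoint

variable {V : Scheme.{u}} {W : V.Opens} (hW : IsAffineOpen W) {S S' : CommRingCat.{u}}
  (h : Γ(V, W) ⟶ S)

include hW in
theorem top_le_fromSpec_preimage : (⊤ : (Spec Γ(V, W)).Opens) ≤ hW.fromSpec ⁻¹ᵁ W := by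
  rw [hW.fromSpec_preimage_self]

theorem fromSpec_appLE :
    hW.fromSpec.appLE W ⊤ (top_le_fromSpec_preimage hW) = (Scheme.ΓSpecIso Γ(V, W)).inv := by
  have h1 : hW.fromSpec.appLE W ⊤ (top_le_fromSpec_preimage hW) =
      hW.fromSpec.app W ≫ (Spec Γ(V, W)).presheaf.map
        (homOfLE (top_le_fromSpec_preimage hW)).op := rfl
  rw [h1, hW.fromSpec_app_self, Category.assoc, ← Functor.map_comp]
  exact (congr_arg (fun α => (Scheme.ΓSpecIso Γ(V, W)).inv ≫ α)
    ((Spec Γ(V, W)).presheaf.map_id (.op ⊤))).trans (Category.comp_id _)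

/-- The `S`-valued point of `W` given by a ring homomorphism `Γ(W) → S`. -/
def specPoint : Spec S ⟶ V := Spec.map h ≫ hW.fromSpec

theorem top_le_specPoint_preimage : (⊤ : (Spec S).Opens) ≤ specPoint hW h ⁻¹ᵁ W :=
  fun x _ => top_le_fromSpec_preimage hW (x := Spec.map h x) trivial

theorem specPoint_appLE :
    (specPoint hW h).appLE W ⊤ (top_le_specPoint_preimage hW h) ≫ (Scheme.ΓSpecIso S).hom = h := by
  have h1 : (specPoint hW h).appLE W ⊤ (top_le_specPoint_preimage hW h) =
      hW.fromSpec.appLE W ⊤ (top_le_fromSpec_preimage hW) ≫ (Spec.map h).appLE ⊤ ⊤ le_top :=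
    (Scheme.Hom.appLE_comp_appLE _ _ _ _ _ _ _).symm
  have h2 : (Spec.map h).appLE ⊤ ⊤ le_top = (Spec.map h).appTop := Scheme.Hom.appLE_eq_app _
  rw [h1, h2, fromSpec_appLE, Category.assoc, Scheme.ΓSpecIso_naturality, Iso.inv_hom_id_assoc]

theorem specPoint_appTop (g : Γ(V, ⊤)) :
    (specPoint hW h).appTop g = (Scheme.ΓSpecIso S).inv (h (res W g)) := by
  have h1 := specPoint_appLE hW h
  rw [← Iso.eq_comp_inv] at h1
  have h2 := congr($(Scheme.Hom.map_appLE (specPoint hW h) (top_le_specPoint_preimage hW h)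
    (homOfLE (le_top : W ≤ ⊤)).op) g)
  rw [h1] at h2
  refine Eq.trans ?_ h2.symm
  exact congr($(Scheme.Hom.app_eq_appLE (specPoint hW h) (U := ⊤)) g)

theorem map_comp_specPoint (g : S ⟶ S') : Spec.map g ≫ specPoint hW h = specPoint hW (h ≫ g) := by
  rw [specPoint, specPoint, Spec.map_comp, Category.assoc]

/-- A unit of `S` as a unit on `Spec S`. -/
def specUnit : Sˣ →* Γ(Spec S, ⊤)ˣ := Units.map ((Scheme.ΓSpecIso S).inv.hom : S →* Γ(Spec S, ⊤))

theorem unitsPullback_specUnit (g : S ⟶ S') (t : Sˣ) :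
    unitsPullback (Spec.map g) (specUnit t) = specUnit (Units.map (g.hom : S →* S') t) :=
  Units.ext congr($(Scheme.ΓSpecIso_inv_naturality g).hom (t : S)).symm

end SpecPoint

variable {k : Type u} [Field k] {V : Scheme.{u}} [V.Over (Spec (.of k))] {σ : GmAction k V}

section ActMatrix

variable {E F : EquivariantVectorBundle σ} {T T' : Scheme.{u}} {W : V.Opens} {m n : ℕ}
  {e : Fin m → Γ(E.sheaf, W)} {f : Fin n → Γ(F.sheaf, W)} (he : IsFrame E.sheaf W e)
  (hf : IsFrame F.sheaf W f)

theorem frameMatrix_conj_comp (q : T' ⟶ T) {t : Γ(T, ⊤)ˣ} {t' : Γ(T', ⊤)ˣ} {x : T ⟶ V} {x' : T' ⟶ V}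
    (hx : q ≫ x = x') (ht : unitsPullback q t = t') (φ : E.sheaf ⟶ F.sheaf) {D : T.Opens}
    (hD : D ≤ x ⁻¹ᵁ W) {D' : T'.Opens} (hD' : D' ≤ q ⁻¹ᵁ D) (h : D' ≤ x' ⁻¹ᵁ W) :
    frameMatrix (he.pull x') (hf.pull x') h h (conj t' x' φ) =
      (frameMatrix (he.pull x) (hf.pull x) hD hD (conj t x φ)).map (q.appLE D D' hD').hom := by
  subst hx ht
  rw [← frameMatrix_pullback_appLE (he.pull x) (hf.pull x) hD q hD' h]
  exact frameMatrix_of_square ((he.pull x).pull q) ((hf.pull x).pull q) (he.pull (q ≫ x))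
    (hf.pull (q ≫ x)) h h (conj_comp q t x φ) (fun j => pullbackComp_pull q x (e j))
    (fun j => pullbackComp_pull q x (f j))

variable (hW : IsAffineOpen W) {S S' : CommRingCat.{u}}

/-- The matrix of the action of a unit of `S` on a morphism, at an `S`-valued point. -/
def actMatrix (h : Γ(V, W) ⟶ S) (t : Sˣ) (φ : E.sheaf ⟶ F.sheaf) : Matrix (Fin m) (Fin n) S :=
  (frameMatrix (he.pull (specPoint hW h)) (hf.pull (specPoint hW h))
    (top_le_specPoint_preimage hW h) (top_le_specPoint_preimage hW h)
      (conj (specUnit t) (specPoint hW h) φ)).map (Scheme.ΓSpecIso S).hom.hom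

theorem actMatrix_comp (h : Γ(V, W) ⟶ S) (t : Sˣ) (φ : E.sheaf ⟶ F.sheaf) (g : S ⟶ S') :
    actMatrix he hf hW (h ≫ g) (Units.map (g.hom : S →* S') t) φ =
      (actMatrix he hf hW h t φ).map g.hom := by
  rw [actMatrix, frameMatrix_conj_comp he hf (Spec.map g) (map_comp_specPoint hW h g)
    (unitsPullback_specUnit g t) φ (top_le_specPoint_preimage hW h) (le_top : ⊤ ≤ _), actMatrix,
    Matrix.map_map, Matrix.map_map]
  congr 1
  have h2 : (Spec.map g).appLE ⊤ ⊤ le_top = (Spec.map g).appTop := Scheme.Hom.appLE_eq_app _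
  funext a
  have h3 := congr($(Scheme.ΓSpecIso_naturality g).hom a)
  rw [← h2] at h3
  exact h3

/-- An affine open subset of `T` that maps into `W` is a ring-valued point of `W`, so arbitrary test
schemes reduce to rings. -/
theorem frameMatrix_conj_eq_actMatrix (t : Γ(T, ⊤)ˣ) (x : T ⟶ V) (φ : E.sheaf ⟶ F.sheaf)
    {D : T.Opens} (hD : IsAffineOpen D) (h : D ≤ x ⁻¹ᵁ W) :
    frameMatrix (he.pull x) (hf.pull x) h h (conj t x φ) =
      actMatrix he hf hW (x.appLE W D h)
        (Units.map (resO (le_top : D ≤ ⊤) : Γ(T, ⊤) →* Γ(T, D)) t) φ := by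
  have ht : unitsPullback hD.fromSpec t =
      specUnit (Units.map (resO (le_top : D ≤ ⊤) : Γ(T, ⊤) →* Γ(T, D)) t) := by
    refine Units.ext ?_
    have h1 := hD.fromSpec_app_of_le ⊤ le_top
    refine congr($(h1).hom (t : Γ(T, ⊤))).trans ?_
    exact congr($((Spec Γ(T, D)).presheaf.map_id (.op ⊤)).hom _)
  have hx : hD.fromSpec ≫ x = specPoint hW (x.appLE W D h) :=
    (hW.SpecMap_appLE_fromSpec x hD h).symm
  rw [actMatrix, frameMatrix_conj_comp he hf hD.fromSpec hx ht φ h (top_le_fromSpec_preimage hD), Matrix.map_map,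
    fromSpec_appLE]
  have h2 : ((Scheme.ΓSpecIso Γ(T, D)).hom.hom ∘ (Scheme.ΓSpecIso Γ(T, D)).inv.hom) = id := by
    funext a
    exact congr($((Scheme.ΓSpecIso Γ(T, D)).inv_hom_id).hom a)
  rw [h2, Matrix.map_id]

theorem actMatrix_const (h : Γ(V, W) ⟶ S) (a : kˣ) (φ : E.sheaf ⟶ F.sheaf) {t : Sˣ}
    (ht : (t : S) = h (res W (constants k V a))) :
    actMatrix he hf hW h t φ =
      (frameMatrix he hf le_rfl le_rfl (unitAct (constUnit V a) φ)).map h.hom := by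
  have ht' : unitsPullback (specPoint hW h) (constUnit V a) = specUnit t := by
    refine Units.ext ((specPoint_appTop hW h (constants k V a)).trans ?_)
    rw [← ht]
    rfl
  rw [actMatrix, ← ht', ← pullback_map_unitAct,
    frameMatrix_pullback_appLE he hf le_rfl _ (top_le_specPoint_preimage hW h), Matrix.map_map]
  congr 1
  funext b
  exact congr($(specPoint_appLE hW h).hom b)

end ActMatrix

end BondalQuiver

end

/-! ### Separation of characters over an infinite field -/

section Separation

variable {k : Type*} [Field k]

theorem exists_zpow_ne_one [Infinite k] {n : ℤ} (hn : n ≠ 0) : ∃ a : kˣ, a ^ n ≠ 1 := by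
  by_contra! h
  have h1 : ∀ a : kˣ, a ^ n.natAbs = 1 := by
    intro a
    rcases Int.natAbs_eq n with h' | h'
    · have := h a
      rw [h', zpow_natCast] at this
      exact this
    · have := h a
      rw [h', zpow_neg, zpow_natCast, inv_eq_one] at this
      exact this
  have hm : n.natAbs ≠ 0 := Int.natAbs_ne_zero.2 hn
  let p : Polynomial k := Polynomial.X * (Polynomial.X ^ n.natAbs - 1)
  have hp : p ≠ 0 := mul_ne_zero Polynomial.X_ne_zero
    (Polynomial.X_pow_sub_C_ne_zero (Nat.pos_of_ne_zero hm) 1)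
  refine hp (Polynomial.eq_zero_of_infinite_isRoot p (Set.infinite_univ.mono fun x _ => ?_))
  change p.IsRoot x
  by_cases hx : x = 0
  · simp [p, hx]
  · have := congr_arg Units.val (h1 (Units.mk0 x hx))
    simp only [Units.val_pow_eq_pow_val, Units.val_mk0, Units.val_one] at this
    simp [p, this]

/-- Finitely many characters of `kˣ` can be separated by a linear combination of evaluations. -/
theorem exists_separating [Infinite k] (S : Finset ℤ) (r : ℤ) :
    ∃ w : kˣ →₀ k, ∀ s, (s = r ∨ s ∈ S) →
      (w.sum fun a c => c * ((a ^ s : kˣ) : k)) = if s = r then 1 else 0 := by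
  classical
  -- On the group algebra the characters extend to ring homomorphisms, so separating elements can be
  -- built as products.
  let χ (s : ℤ) : MonoidAlgebra k kˣ →ₐ[k] k :=
    MonoidAlgebra.lift k k kˣ ((Units.coeHom k).comp (zpowGroupHom s))
  have hχ : ∀ s a, χ s (MonoidAlgebra.single a 1) = ((a ^ s : kˣ) : k) := by
    intro s a
    simp [χ, MonoidAlgebra.lift_single]
  suffices H : ∃ w : MonoidAlgebra k kˣ, ∀ s, (s = r ∨ s ∈ S) → χ s w = if s = r then 1 else 0 by
    obtain ⟨w, hw⟩ := H
    refine ⟨w.coeff, fun s hs => (hw s hs).symm.trans ?_ |>.symm⟩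
    simp only [χ, MonoidAlgebra.lift_apply]
    rfl
  induction S using Finset.induction_on with
  | empty => exact ⟨1, fun s hs => by
      rcases hs with rfl | hs
      · rw [map_one, if_pos rfl]
      · simp at hs⟩
  | insert q S _ ih =>
    obtain ⟨w, hw⟩ := ih
    by_cases hq : q = r
    · exact ⟨w, fun s hs => hw s (by simp only [Finset.mem_insert] at hs; grind)⟩
    obtain ⟨a, ha⟩ := exists_zpow_ne_one (k := k) (sub_ne_zero.2 hq)
    have ha' : ((a ^ r : kˣ) : k) - ((a ^ q : kˣ) : k) ≠ 0 := by
      rw [sub_ne_zero]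
      intro h
      rw [zpow_sub, ← Units.ext h, mul_inv_cancel] at ha
      exact ha rfl
    -- The new factor vanishes under the character `q`; the scalar restores the value one at `r`.
    refine ⟨(((a ^ r : kˣ) : k) - ((a ^ q : kˣ) : k))⁻¹ •
      (w * (MonoidAlgebra.single a 1 - algebraMap k _ ((a ^ q : kˣ) : k))), fun s hs => ?_⟩
    rw [map_smul, map_mul, map_sub, hχ, AlgHom.commutes, Algebra.algebraMap_self_apply, smul_eq_mul]
    by_cases hsr : s = r
    · subst hsr
      rw [hw s (Or.inl rfl), if_pos rfl, one_mul, inv_mul_cancel₀ ha']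
    · rw [if_neg hsr]
      by_cases hsq : s = q
      · rw [hsq, sub_self, mul_zero, mul_zero]
      · rw [hw s (Or.inr (by simp only [Finset.mem_insert] at hs; grind)), if_neg hsr, zero_mul,
          mul_zero]

theorem sum_separating {S : Finset ℤ} {r : ℤ} {w : kˣ →₀ k}
    (hw : ∀ s, (s = r ∨ s ∈ S) →
      (w.sum fun a c => c * ((a ^ s : kˣ) : k)) = if s = r then 1 else 0)
    {M : Type*} [AddCommGroup M] [Module k M] (v : ℤ → M) :
    (w.sum fun a c => c • ∑ s ∈ S, ((a ^ s : kˣ) : k) • v s) = if r ∈ S then v r else 0 := by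
  have h1 : (w.sum fun a c => c • ∑ s ∈ S, ((a ^ s : kˣ) : k) • v s) =
      ∑ s ∈ S, (w.sum fun a c => c * ((a ^ s : kˣ) : k)) • v s := by
    simp only [Finsupp.sum, Finset.smul_sum, Finset.sum_smul, smul_smul]
    exact Finset.sum_comm
  rw [h1, Finset.sum_congr rfl fun s hs => by rw [hw s (Or.inr hs), ite_smul, one_smul, zero_smul],
    Finset.sum_ite_eq']

end Separation

theorem LaurentPolynomial.eval₂_eq_sum {R A : Type*} [CommRing R] [CommRing A] (g : R →+* A)
    (t : Aˣ) {S : Finset ℤ} (p : LaurentPolynomial R) (hp : p.coeff.support ⊆ S) :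
    LaurentPolynomial.eval₂ g t p = ∑ r ∈ S, g (p.coeff r) * ((t ^ r : Aˣ) : A) := by
  have h1 : ∀ p : LaurentPolynomial R, LaurentPolynomial.eval₂ g t p =
      p.coeff.sum fun r a => g a * ((t ^ r : Aˣ) : A) := by
    intro p
    induction p using LaurentPolynomial.induction_on' with
    | add p q hp hq =>
      rw [map_add, hp, hq, AddMonoidAlgebra.coeff_add, Finsupp.sum_add_index'] <;>
        simp [add_mul]
    | C_mul_T n a =>
      rw [LaurentPolynomial.eval₂_C_mul_T, ← LaurentPolynomial.single_eq_C_mul_T]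
      exact (Finsupp.sum_single_index (h := fun r a => g a * ((t ^ r : Aˣ) : A)) (by simp)).symm
  rw [h1, Finsupp.sum_of_support_subset _ hp]
  simp

/-! ### Weight components of a morphism -/

noncomputable section

namespace BondalQuiver

variable {k : Type u} [Field k] {V : Scheme.{u}} [V.Over (Spec (.of k))] {σ : GmAction k V}
  {E F : EquivariantVectorBundle σ}

section Coefficients

variable {T T' : Scheme.{u}} {W : V.Opens} {m n : ℕ}
  {e : Fin m → Γ(E.sheaf, W)} {f : Fin n → Γ(F.sheaf, W)} (he : IsFrame E.sheaf W e)
  (hf : IsFrame F.sheaf W f) (hW : IsAffineOpen W) {S : CommRingCat.{u}}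

/-- The matrix of the universal action on a morphism, with entries in Laurent polynomials. -/
def univMatrix (φ : E.sheaf ⟶ F.sheaf) :
    Matrix (Fin m) (Fin n) (LaurentPolynomial Γ(V, W)) :=
  actMatrix he hf hW (S := .of (LaurentPolynomial Γ(V, W)))
    (CommRingCat.ofHom (LaurentPolynomial.C (R := Γ(V, W))))
    (LaurentPolynomial.isUnit_T 1).unit φ

/-- A ring-valued point together with a unit factors through the Laurent polynomial ring, where the
unit is the variable. -/
theorem actMatrix_eq_map_univMatrix (h : Γ(V, W) ⟶ S) (t : Sˣ) (φ : E.sheaf ⟶ F.sheaf) :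
    actMatrix he hf hW h t φ =
      (univMatrix he hf hW φ).map (LaurentPolynomial.eval₂ h.hom t) := by
  let g : CommRingCat.of (LaurentPolynomial Γ(V, W)) ⟶ S :=
    CommRingCat.ofHom (LaurentPolynomial.eval₂ h.hom t)
  have h1 : CommRingCat.ofHom (LaurentPolynomial.C (R := Γ(V, W))) ≫ g = h := by
    ext a
    exact LaurentPolynomial.eval₂_C h.hom t a
  have h2 : Units.map (g.hom : LaurentPolynomial Γ(V, W) →* S)
      (LaurentPolynomial.isUnit_T 1).unit = t := by
    refine Units.ext ((LaurentPolynomial.eval₂_T h.hom t 1).trans ?_)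
    rw [zpow_one]
  have h3 := actMatrix_comp he hf hW (S := .of (LaurentPolynomial Γ(V, W)))
    (CommRingCat.ofHom (LaurentPolynomial.C (R := Γ(V, W))))
    (LaurentPolynomial.isUnit_T 1).unit φ g
  rw [h1, h2] at h3
  exact h3

/-- The coefficient of `t ^ r` in the matrix of the universal action. -/
def coeffMatrix (φ : E.sheaf ⟶ F.sheaf) (r : ℤ) : Matrix (Fin m) (Fin n) Γ(V, W) :=
  (univMatrix he hf hW φ).map fun p => p.coeff r

/-- The weights that occur in the matrix of the universal action. -/
def weights (φ : E.sheaf ⟶ F.sheaf) : Finset ℤ :=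
  Finset.univ.biUnion fun i => Finset.univ.biUnion fun j => (univMatrix he hf hW φ i j).coeff.support

theorem actMatrix_eq_sum (h : Γ(V, W) ⟶ S) (t : Sˣ) (φ : E.sheaf ⟶ F.sheaf) {R : Finset ℤ}
    (hR : weights he hf hW φ ⊆ R) :
    actMatrix he hf hW h t φ =
      ∑ r ∈ R, ((t ^ r : Sˣ) : S) • (coeffMatrix he hf hW φ r).map h.hom := by
  rw [actMatrix_eq_map_univMatrix]
  ext i j
  rw [Matrix.map_apply, LaurentPolynomial.eval₂_eq_sum h.hom t (S := R), Matrix.sum_apply]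
  · refine Finset.sum_congr rfl fun r _ => ?_
    rw [Matrix.smul_apply, smul_eq_mul, mul_comm]
    rfl
  · refine Finset.Subset.trans ?_ hR
    intro r hr
    exact Finset.mem_biUnion.2 ⟨i, Finset.mem_univ _, Finset.mem_biUnion.2 ⟨j, Finset.mem_univ _, hr⟩⟩

theorem frameMatrix_sum {X : Scheme.{u}} {M N : X.Modules} {U U' D : X.Opens}
    {e : Fin m → Γ(M, U)} {f : Fin n → Γ(N, U')} (he : IsFrame M U e) (hf : IsFrame N U' f)
    (hU : D ≤ U) (hU' : D ≤ U') {ι : Type*} (s : Finset ι) (α : ι → (M ⟶ N)) :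
    frameMatrix he hf hU hU' (∑ i ∈ s, α i) = ∑ i ∈ s, frameMatrix he hf hU hU' (α i) :=
  map_sum (AddMonoidHom.mk' (frameMatrix he hf hU hU') (frameMatrix_add he hf hU hU')) α s

theorem frameMatrix_unitAct (a : kˣ) (φ : E.sheaf ⟶ F.sheaf) {R : Finset ℤ}
    (hR : weights he hf hW φ ⊆ R) :
    frameMatrix he hf le_rfl le_rfl (unitAct (constUnit V a) φ) =
      ∑ r ∈ R, res W (constants k V ((a ^ r : kˣ) : k)) • coeffMatrix he hf hW φ r := by
  let g : k →* Γ(V, W) := ((V.presheaf.map (homOfLE (le_top : W ≤ ⊤)).op).hom.comp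
    (constants k V) : k →+* Γ(V, W))
  have h1 := actMatrix_const he hf hW (𝟙 Γ(V, W)) a φ (t := Units.map g a) rfl
  have h2 := actMatrix_eq_sum he hf hW (𝟙 Γ(V, W)) (Units.map g a) φ hR
  have h3 : ∀ A : Matrix (Fin m) (Fin n) Γ(V, W), A.map (𝟙 Γ(V, W) : Γ(V, W) ⟶ _).hom = A :=
    fun A => Matrix.map_id A
  simp only [h3] at h1 h2
  rw [← h1, h2]
  refine Finset.sum_congr rfl fun r _ => ?_
  rw [← map_zpow]
  rfl

/-- The component of weight `r` of a morphism, extracted by a separating combination. -/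
def weightPart (w : kˣ →₀ k) (φ : E.sheaf ⟶ F.sheaf) : E.sheaf ⟶ F.sheaf :=
  w.sum fun a c => c • unitAct (constUnit V a) φ

/-- A constant `a` acts in frames as the sum of the coefficient matrices weighted by `a ^ s`, so the
separating combination leaves a single one. The combination itself is global, so the local
coefficients come from one morphism. -/
theorem frameMatrix_weightPart (φ : E.sheaf ⟶ F.sheaf) {R : Finset ℤ}
    (hR : weights he hf hW φ ⊆ R) {r : ℤ} {w : kˣ →₀ k}
    (hw : ∀ s, (s = r ∨ s ∈ R) →
      (w.sum fun a c => c * ((a ^ s : kˣ) : k)) = if s = r then 1 else 0) (hr : r ∈ R) :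
    frameMatrix he hf le_rfl le_rfl (weightPart w φ) = coeffMatrix he hf hW φ r := by
  let g : k →+* Γ(V, W) := (V.presheaf.map (homOfLE (le_top : W ≤ ⊤)).op).hom.comp
    (constants k V)
  let _ : Module k (Matrix (Fin m) (Fin n) Γ(V, W)) := Module.compHom _ g
  have h1 := sum_separating hw (coeffMatrix he hf hW φ)
  rw [if_pos hr] at h1
  rw [← h1, weightPart, Finsupp.sum, Finsupp.sum, frameMatrix_sum]
  refine Finset.sum_congr rfl fun a _ => ?_
  rw [smul_eq_constants_smul, frameMatrix_smul, frameMatrix_unitAct he hf hW a φ hR]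
  rfl

end Coefficients

/-- Finitely many framed affine charts suffice, so one finite set of weights and one family of
separating combinations serve everywhere. The equality is then checked on matrices near each point
of `T`. -/
theorem exists_conj_eq_sum [Infinite k] [CompactSpace V] (φ : E.sheaf ⟶ F.sheaf) :
    ∃ (R : Finset ℤ) (w : ℤ → (kˣ →₀ k)), (∀ r s, (s = r ∨ s ∈ R) →
      ((w r).sum fun a c => c * ((a ^ s : kˣ) : k)) = if s = r then 1 else 0) ∧
      ∀ {T : Scheme.{u}} (t : Γ(T, ⊤)ˣ) (x : T ⟶ V), conj t x φ =
        ∑ r ∈ R, ((t ^ r : Γ(T, ⊤)ˣ) : Γ(T, ⊤)) •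
          (Scheme.Modules.pullback x).map (weightPart (w r) φ) := by
  classical
  have hch : ∀ x : V, ∃ W : V.Opens, x ∈ W ∧ IsAffineOpen W ∧ ∃ (n n' : ℕ)
      (e : Fin n → Γ(E.sheaf, W)) (f : Fin n' → Γ(F.sheaf, W)),
        IsFrame E.sheaf W e ∧ IsFrame F.sheaf W f := by
    intro x
    obtain ⟨U, hU, hxU, -⟩ := exists_isAffineOpen_mem_and_subset (x := x) (U := ⊤) trivial
    obtain ⟨g, hg, h⟩ := exists_isFrame_basicOpen hU E.isVectorBundle F.isVectorBundle hxU
    exact ⟨_, hg, hU.basicOpen g, h⟩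
  choose W hxW hW n n' e f he hf using hch
  obtain ⟨z, hz⟩ := isCompact_univ.elim_finite_subcover (fun x => (W x : Set V))
    (fun x => (W x).isOpen) (fun x _ => Set.mem_iUnion.2 ⟨x, hxW x⟩)
  let R : Finset ℤ := z.biUnion fun x => weights (he x) (hf x) (hW x) φ
  choose w hw using exists_separating (k := k) R
  refine ⟨R, w, hw, fun {T} t x => hom_ext_of_cover fun y => ?_⟩
  obtain ⟨v, hv, hyv⟩ := Set.mem_iUnion₂.1 (hz (Set.mem_univ (x y)))
  obtain ⟨D, hD, hyD, hDx⟩ := exists_isAffineOpen_mem_and_subset (x := y) (U := x ⁻¹ᵁ W v) hyv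
  have hR : weights (he v) (hf v) (hW v) φ ⊆ R :=
    Finset.subset_biUnion_of_mem (fun x => weights (he x) (hf x) (hW x) φ) hv
  have hDx' : D ≤ x ⁻¹ᵁ W v := hDx
  refine ⟨D, hyD, fun D' hD' s => app_eq_of_frameMatrix_eq ((he v).pull x) ((hf v).pull x)
    hDx' hDx' ?_ hD' s⟩
  rw [frameMatrix_conj_eq_actMatrix (he v) (hf v) (hW v) t x φ hD hDx',
    actMatrix_eq_sum (he v) (hf v) (hW v) _ _ φ hR, frameMatrix_sum]
  refine Finset.sum_congr rfl fun r hr => ?_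
  rw [frameMatrix_smul, frameMatrix_pullback_appLE (he v) (hf v) le_rfl x hDx',
    frameMatrix_weightPart (he v) (hf v) (hW v) φ hR (hw r) hr, ← map_zpow]
  rfl

end BondalQuiver

end

/-! ### Weight decompositions of morphisms and of functions -/

noncomputable section

section Internal

variable {R M ι : Type*} [Ring R] [AddCommGroup M] [Module R M] [DecidableEq ι]

/-- The projection to a summand of an internal direct sum. -/
theorem DirectSum.IsInternal.exists_projection {A : ι → Submodule R M} (h : DirectSum.IsInternal A)
    (i : ι) : ∃ P : M →ₗ[R] M, (∀ x ∈ A i, P x = x) ∧ ∀ j ≠ i, ∀ x ∈ A j, P x = 0 := by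
  let e := LinearEquiv.ofBijective (DirectSum.coeLinearMap A) h
  refine ⟨(A i).subtype ∘ₗ DirectSum.component R ι (fun i => A i) i ∘ₗ e.symm.toLinearMap,
    fun x hx => ?_, fun j hj x hx => ?_⟩
  · have h1 : e.symm x = DirectSum.lof R ι (fun i => A i) i ⟨x, hx⟩ := by
      rw [LinearEquiv.symm_apply_eq]
      exact (DirectSum.coeLinearMap_lof A i ⟨x, hx⟩).symm
    change ((e.symm x i : A i) : M) = x
    rw [h1, DirectSum.lof_apply]
  · have h1 : e.symm x = DirectSum.lof R ι (fun i => A i) j ⟨x, hx⟩ := by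
      rw [LinearEquiv.symm_apply_eq]
      exact (DirectSum.coeLinearMap_lof A j ⟨x, hx⟩).symm
    change ((e.symm x i : A i) : M) = 0
    rw [h1, DirectSum.lof_eq_of, DirectSum.of_eq_of_ne _ _ _ hj.symm, Submodule.coe_zero]

/-- Submodules of the summands that together span everything are the summands. -/
theorem DirectSum.IsInternal.eq_of_le_of_iSup_eq_top {A D : ι → Submodule R M}
    (h : DirectSum.IsInternal A) (hD : ∀ i, D i ≤ A i) (htop : ⨆ i, D i = ⊤) (i : ι) :
    D i = A i := by
  refine (hD i).antisymm fun x hx => ?_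
  obtain ⟨P, hP, hP'⟩ := h.exists_projection i
  rw [← hP x hx]
  have h1 : ⨆ j, D j ≤ (D i).comap P := iSup_le fun j y hy => by
    by_cases hj : j = i
    · subst hj
      rw [Submodule.mem_comap, hP y (hD j hy)]
      exact hy
    · rw [Submodule.mem_comap, hP' j hj y (hD j hy)]
      exact zero_mem _
  exact h1 (htop ▸ Submodule.mem_top)

end Internal

namespace BondalQuiver

variable {k : Type u} [Field k] {V : Scheme.{u}} [V.Over (Spec (.of k))] {σ : GmAction k V}

section Weights

variable {E F G : EquivariantVectorBundle σ} {T : Scheme.{u}}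

theorem pullback_id_map_injective {M N : V.Modules} {φ ψ : M ⟶ N}
    (h : (Scheme.Modules.pullback (𝟙 V)).map φ = (Scheme.Modules.pullback (𝟙 V)).map ψ) :
    φ = ψ := by
  have h1 := (Scheme.Modules.pullbackId V).hom.naturality φ
  have h2 := (Scheme.Modules.pullbackId V).hom.naturality ψ
  rw [h, h2] at h1
  exact ((cancel_epi ((Scheme.Modules.pullbackId V).hom.app M)).1 h1).symm

theorem pullback_map_const_smul (x : T ⟶ V) (c : k) {M N : V.Modules} (φ : M ⟶ N) :
    (Scheme.Modules.pullback x).map (c • φ) =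
      x.appTop (constants k V c) • (Scheme.Modules.pullback x).map φ := by
  rw [smul_eq_constants_smul, pullback_map_smul]

theorem unitAct_of_mem {r : ℤ} {φ : E.sheaf ⟶ F.sheaf} (hφ : φ ∈ weightSpace E F r) (a : kˣ) :
    unitAct (constUnit V a) φ = ((a ^ r : kˣ) : k) • φ := by
  apply pullback_id_map_injective
  rw [pullback_map_unitAct, pullback_map_const_smul, mem_weightSpace_iff.1 hφ, ← map_zpow,
    ← map_zpow]
  rfl

theorem unitAct_sum (s : Γ(V, ⊤)ˣ) {ι : Type*} (I : Finset ι) (φ : ι → (E.sheaf ⟶ F.sheaf)) :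
    unitAct s (∑ i ∈ I, φ i) = ∑ i ∈ I, unitAct s (φ i) := by
  simp only [unitAct, conj_sum, Preadditive.sum_comp, Preadditive.comp_sum]

/-- Acting by constants and taking the separating combination recovers each summand from the sum. -/
theorem iSupIndep_weightSpace [Infinite k] : iSupIndep (weightSpace E F) := by
  rw [iSupIndep_iff_finsetSum_eq_zero_imp_eq_zero]
  intro S v hv h0 r hr
  obtain ⟨w, hw⟩ := exists_separating (k := k) S r
  have h1 := sum_separating hw v
  rw [if_pos hr] at h1
  rw [← h1]
  refine Finset.sum_eq_zero fun a _ => ?_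
  have h2 : ∑ s ∈ S, ((a ^ s : kˣ) : k) • v s = 0 := by
    rw [← Finset.sum_congr rfl fun s hs => unitAct_of_mem (hv s hs) a, ← unitAct_sum, h0]
    exact unitAct_sum (E := E) (F := F) (constUnit V a) (∅ : Finset ℕ) fun _ => 0
  change w a • _ = 0
  rw [h2, smul_zero]

/-- Translating `a · φ` by `t` is translating `φ` by `a t`, whose expansion has terms in `a ^ s t ^
s`. The separating combination in `a` keeps only the term in `t ^ r`. -/
theorem weightPart_mem {R : Finset ℤ} {w : kˣ →₀ k} {r : ℤ} (hr : r ∈ R)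
    (hw : ∀ s, (s = r ∨ s ∈ R) →
      (w.sum fun a c => c * ((a ^ s : kˣ) : k)) = if s = r then 1 else 0)
    {φ : E.sheaf ⟶ F.sheaf} {v : ℤ → (E.sheaf ⟶ F.sheaf)} (hv : v r = weightPart w φ)
    (h : ∀ {T : Scheme.{u}} (t : Γ(T, ⊤)ˣ) (x : T ⟶ V), conj t x φ =
      ∑ r ∈ R, ((t ^ r : Γ(T, ⊤)ˣ) : Γ(T, ⊤)) • (Scheme.Modules.pullback x).map (v r)) :
    weightPart w φ ∈ weightSpace E F r := by
  rw [mem_weightSpace_iff]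
  intro T t x
  let g : k →+* Γ(T, ⊤) := x.appTop.hom.comp (constants k V)
  let _ : Module k ((Scheme.Modules.pullback x).obj E.sheaf ⟶
    (Scheme.Modules.pullback x).obj F.sheaf) := Module.compHom _ g
  have h1 := sum_separating hw
    fun s => ((t ^ s : Γ(T, ⊤)ˣ) : Γ(T, ⊤)) • (Scheme.Modules.pullback x).map (v s)
  rw [if_pos hr, hv] at h1
  rw [← h1, weightPart, Finsupp.sum, Finsupp.sum, conj_sum]
  refine Finset.sum_congr rfl fun a _ => ?_
  rw [conj_const_smul, conj_unitAct, h]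
  refine congr_arg (fun y => g (w a) • y) (Finset.sum_congr rfl fun s _ => ?_)
  rw [mul_zpow, Units.val_mul, mul_smul, ← map_zpow, ← map_zpow]
  rfl

theorem iSup_weightSpace [Infinite k] [CompactSpace V] : ⨆ r, weightSpace E F r = ⊤ := by
  rw [eq_top_iff]
  rintro φ -
  obtain ⟨R, w, hw, h⟩ := exists_conj_eq_sum φ
  have h1 : φ = ∑ r ∈ R, weightPart (w r) φ := by
    apply pullback_id_map_injective
    rw [← conj_one, h, Functor.map_sum]
    refine Finset.sum_congr rfl fun r _ => ?_
    rw [one_zpow, Units.val_one, one_smul]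
  rw [h1]
  exact Submodule.sum_mem _ fun r hr => Submodule.mem_iSup_of_mem r
    (weightPart_mem hr (hw r) (v := fun s => weightPart (w s) φ) rfl h)

theorem isInternal_weightSpace [Infinite k] [CompactSpace V] :
    DirectSum.IsInternal (weightSpace E F) :=
  DirectSum.isInternal_submodule_of_iSupIndep_of_iSup_eq_top iSupIndep_weightSpace iSup_weightSpace

theorem comp_mem_weightSpace {r s : ℤ} {φ : E.sheaf ⟶ F.sheaf} {ψ : F.sheaf ⟶ G.sheaf}
    (hφ : φ ∈ weightSpace E F r) (hψ : ψ ∈ weightSpace F G s) :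
    φ ≫ ψ ∈ weightSpace E G (r + s) := by
  rw [mem_weightSpace_iff] at hφ hψ ⊢
  intro T t x
  rw [conj_comp_hom, hφ, hψ, Linear.smul_comp, Linear.comp_smul, smul_smul, zpow_add,
    Units.val_mul, Functor.map_comp]

theorem id_mem_weightSpace : 𝟙 E.sheaf ∈ weightSpace E E 0 := by
  rw [mem_weightSpace_iff]
  intro T t x
  rw [conj_id, zpow_zero, Units.val_one, one_smul, CategoryTheory.Functor.map_id]

end Weights

section Functions

/-- A function on which `𝔾ₘ` acts with weight `r`. -/
def IsHomogeneousFunction (σ : GmAction k V) (r : ℕ) (g : Γ(V, ⊤)) : Prop :=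
  ∀ {T : Scheme.{u}} (t : Γ(T, ⊤)ˣ) (x : T ⟶ V),
    (σ.act t x).appTop g = (t : Γ(T, ⊤)) ^ r * x.appTop g

theorem IsHomogeneousFunction.pow {r : ℕ} {g : Γ(V, ⊤)} (hg : IsHomogeneousFunction σ r g) (n : ℕ) :
    IsHomogeneousFunction σ (n * r) (g ^ n) := by
  intro T t x
  rw [map_pow, hg, map_pow, mul_pow, ← pow_mul, mul_comm r]

theorem IsHomogeneousFunction.prod {ι : Type*} (s : Finset ι) {r : ι → ℕ} {g : ι → Γ(V, ⊤)}
    (hg : ∀ i ∈ s, IsHomogeneousFunction σ (r i) (g i)) :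
    IsHomogeneousFunction σ (∑ i ∈ s, r i) (∏ i ∈ s, g i) := by
  intro T t x
  rw [map_prod, map_prod, Finset.prod_congr rfl fun i hi => hg i hi t x, Finset.prod_mul_distrib,
    Finset.prod_pow_eq_pow_sum]

theorem IsHomogeneousFunction.smul_mem {E F : EquivariantVectorBundle σ} {r : ℕ} {g : Γ(V, ⊤)}
    (hg : IsHomogeneousFunction σ r g) {q : ℤ} {φ : E.sheaf ⟶ F.sheaf}
    (hφ : φ ∈ weightSpace E F q) : g • φ ∈ weightSpace E F (r + q) := by
  rw [mem_weightSpace_iff] at hφ ⊢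
  intro T t x
  rw [conj_smul, hg, hφ, pullback_map_smul, smul_smul, smul_smul, zpow_add, zpow_natCast,
    Units.val_mul, Units.val_pow_eq_pow_val]
  congr 1
  ring

variable {ρ : Γ(V, ⊤) →+* Polynomial Γ(V, ⊤)}

/-- Both `(a t) · x` and `a · (t · x)` expand `g` as a polynomial in the constant `a`. As `k` is
infinite, the coefficients of `a ^ r` agree. -/
theorem ExtendsAction.isHomogeneousFunction_coeff [Infinite k] (hρ : ExtendsAction σ ρ)
    (g : Γ(V, ⊤)) (r : ℕ) : IsHomogeneousFunction σ r ((ρ g).coeff r) := by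
  intro T t x
  rcases lt_or_ge (ρ g).natDegree r with hr | hr
  · rw [Polynomial.coeff_eq_zero_of_natDegree_lt hr, map_zero, map_zero, mul_zero]
  let c : k →+* Γ(T, ⊤) := x.appTop.hom.comp (constants k V)
  let _ : Module k Γ(T, ⊤) := Module.compHom _ c
  let S : Finset ℤ := (Finset.range ((ρ g).natDegree + 1)).map Nat.castEmbedding
  -- The defect of homogeneity of the coefficient `s`; summed against the powers of any constant
  -- `a`, the defects cancel.
  let v : ℤ → Γ(T, ⊤) := fun s => (t : Γ(T, ⊤)) ^ s.toNat * x.appTop ((ρ g).coeff s.toNat) -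
    (σ.act t x).appTop ((ρ g).coeff s.toNat)
  have hv : ∀ a : kˣ, ∑ s ∈ S, ((a ^ s : kˣ) : k) • v s = 0 := by
    intro a
    have h1 := hρ (unitsPullback x (constUnit V a)) (σ.act t x) g
    rw [← σ.mul_act, hρ, Polynomial.eval₂_eq_sum_range, Polynomial.eval₂_eq_sum_range, ← sub_eq_zero,
      ← Finset.sum_sub_distrib] at h1
    rw [← h1, Finset.sum_map]
    refine Finset.sum_congr rfl fun s _ => ?_
    change c _ * _ = _
    have h2 : c ((a ^ (Nat.castEmbedding s : ℤ) : kˣ) : k) = (c a) ^ s := by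
      rw [Nat.castEmbedding_apply, zpow_natCast, Units.val_pow_eq_pow_val, map_pow]
    rw [h2]
    simp only [v, Nat.castEmbedding_apply, Int.toNat_natCast]
    change _ = _ * (c a * t : Γ(T, ⊤)) ^ s - _ * (c a) ^ s
    ring_nf
  obtain ⟨w, hw⟩ := exists_separating (k := k) S r
  have h3 := sum_separating hw v
  have hrS : (r : ℤ) ∈ S := Finset.mem_map.2 ⟨r, Finset.mem_range.2 (Nat.lt_succ_of_le hr), rfl⟩
  rw [if_pos hrS] at h3
  have h4 : v r = 0 := by
    rw [← h3]
    refine Finset.sum_eq_zero fun a _ => ?_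
    change w a • _ = _
    rw [hv, smul_zero]
  exact (sub_eq_zero.1 h4).symm

theorem ExtendsAction.sum_coeff (hρ : ExtendsAction σ ρ) (g : Γ(V, ⊤)) :
    ∑ r ∈ Finset.range ((ρ g).natDegree + 1), (ρ g).coeff r = g := by
  have h1 := hρ 1 (𝟙 V) g
  rw [σ.one_act, Polynomial.eval₂_eq_sum_range] at h1
  simp only [Units.val_one, one_pow, mul_one] at h1
  exact h1.symm

end Functions

end BondalQuiver

end

/-! ### Finite dimensionality of the weight spaces -/

theorem Subring.exists_finset_mem_closure_image {A C : Type*} [CommRing A] [CommRing C] {f : A →+* C}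
    {Y : Set C} {s : C} (hs : s ∈ Subring.closure (Set.range f ∪ Y)) :
    ∃ S : Finset A, s ∈ Subring.closure (f '' S ∪ Y) := by
  classical
  have hmono : ∀ {S S' : Finset A}, S ⊆ S' →
      Subring.closure (f '' S ∪ Y) ≤ Subring.closure (f '' S' ∪ Y) := fun h =>
    Subring.closure_mono (Set.union_subset_union_left _ (Set.image_mono h))
  induction hs using Subring.closure_induction with
  | mem x hx =>
    rcases hx with ⟨a, rfl⟩ | hx
    · exact ⟨{a}, Subring.subset_closure (Or.inl ⟨a, by simp, rfl⟩)⟩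
    · exact ⟨∅, Subring.subset_closure (Or.inr hx)⟩
  | zero => exact ⟨∅, zero_mem _⟩
  | one => exact ⟨∅, one_mem _⟩
  | add x y _ _ hx hy =>
    obtain ⟨S, hS⟩ := hx
    obtain ⟨S', hS'⟩ := hy
    exact ⟨S ∪ S', add_mem (hmono Finset.subset_union_left hS) (hmono Finset.subset_union_right hS')⟩
  | neg x _ hx =>
    obtain ⟨S, hS⟩ := hx
    exact ⟨S, neg_mem hS⟩
  | mul x y _ _ hx hy =>
    obtain ⟨S, hS⟩ := hx
    obtain ⟨S', hS'⟩ := hy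
    exact ⟨S ∪ S', mul_mem (hmono Finset.subset_union_left hS) (hmono Finset.subset_union_right hS')⟩

/-- Each of finitely many algebra generators of `C` involves finitely many elements of `A`. No
finite generation of `A` itself, here the ring of global functions, is needed. -/
theorem RingHom.FiniteType.exists_finset_mem_closure {k A C : Type*} [CommRing k] [CommRing A]
    [CommRing C] {c : k →+* A} {f : A →+* C} (hc : (f.comp c).FiniteType) {Y : Set C}
    (hgen : ∀ s, s ∈ Subring.closure (Set.range f ∪ Y)) :
    ∃ S : Finset A, ∀ s, s ∈ Subring.closure (Set.range (f.comp c) ∪ f '' S ∪ Y) := by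
  classical
  choose S hS using fun s => Subring.exists_finset_mem_closure_image (hgen s)
  let _ : Algebra k C := (f.comp c).toAlgebra
  obtain ⟨G, hG⟩ := (hc : Algebra.FiniteType k C).out
  refine ⟨G.biUnion S, fun s => ?_⟩
  have hs : s ∈ (Algebra.adjoin k (G : Set C)).toSubring := by
    rw [hG]
    trivial
  rw [Algebra.adjoin_eq_ring_closure] at hs
  refine (Subring.closure_le.2 ?_) hs
  rintro x (⟨a, rfl⟩ | hx)
  · exact Subring.subset_closure (Or.inl (Or.inl ⟨a, rfl⟩))
  · refine Subring.closure_mono ?_ (hS x)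
    refine Set.union_subset_union_left _ (Set.Subset.trans (Set.image_mono ?_) Set.subset_union_right)
    exact Finset.subset_biUnion_of_mem S hx

noncomputable section

namespace BondalQuiver

variable {k : Type u} [Field k] {V : Scheme.{u}} [V.Over (Spec (.of k))] {σ : GmAction k V}

variable (k) in
theorem finiteType_res_constants [LocallyOfFiniteType (V ↘ Spec (.of k))] {D : V.Opens}
    (hD : IsAffineOpen D) : ((resO (le_top : D ≤ ⊤)).comp (constants k V)).FiniteType := by
  have h1 := (V ↘ Spec (.of k)).finiteType_appLE (isAffineOpen_top _) hD le_top
  have h2 : ((Scheme.ΓSpecIso (.of k)).inv.hom).FiniteType :=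
    RingHom.FiniteType.of_surjective _
      (Scheme.ΓSpecIso (.of k)).commRingCatIsoToRingEquiv.symm.surjective
  exact h1.comp h2

variable (k) in
theorem isNoetherianRing_of_isAffineOpen [LocallyOfFiniteType (V ↘ Spec (.of k))] {D : V.Opens}
    (hD : IsAffineOpen D) : IsNoetherianRing Γ(V, D) := by
  let _ : Algebra k Γ(V, D) := ((resO (le_top : D ≤ ⊤)).comp (constants k V)).toAlgebra
  have : Algebra.FiniteType k Γ(V, D) := finiteType_res_constants k hD
  exact Algebra.FiniteType.isNoetherianRing k _

theorem IsNearlyProjective.exists_homogeneous_generators [Infinite k] (hV : IsNearlyProjective σ)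
    (S : Finset Γ(V, ⊤)) : ∃ (I : Type u) (_ : Fintype I) (x : I → Γ(V, ⊤)) (d : I → ℕ),
      (∀ i, d i ≠ 0) ∧ (∀ i, IsHomogeneousFunction σ (d i) (x i)) ∧
        ∀ g ∈ S, g ∈ (MvPolynomial.eval₂Hom (constants k V) x).range := by
  obtain ⟨ρ, p, hρ, -, -, h0⟩ := hV.retracts
  -- The index is shifted by one to omit the component of weight zero, which the retraction makes
  -- constant.
  refine ⟨Σ g : S, Fin (ρ g).natDegree, inferInstance, fun i => (ρ i.1).coeff (i.2 + 1),
    fun i => i.2 + 1, fun i => Nat.succ_ne_zero _, fun i => hρ.isHomogeneousFunction_coeff _ _,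
    fun g hg => ?_⟩
  rw [← hρ.sum_coeff g, Finset.sum_range_succ']
  refine add_mem (sum_mem fun r hr => ?_) ?_
  · refine ⟨MvPolynomial.X ⟨⟨g, hg⟩, ⟨r, Finset.mem_range.1 hr⟩⟩, ?_⟩
    rw [MvPolynomial.coe_eval₂Hom, MvPolynomial.eval₂_X]
  · refine ⟨MvPolynomial.C (p g), ?_⟩
    rw [MvPolynomial.coe_eval₂Hom, MvPolynomial.eval₂_C, Polynomial.coeff_zero_eq_eval_zero, h0]

/-- The polynomial ring in sufficiently many homogeneous functions replaces `Γ(V)` as the base: its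
image still generates each chart ring together with the coordinates, and it is of finite type over
`k`. -/
theorem IsNearlyProjective.exists_finite_hom [IsAlgClosed k] [LocallyOfFiniteType (V ↘ Spec (.of k))]
    [CompactSpace V] (hV : IsNearlyProjective σ) {M N : V.Modules} (hM : IsVectorBundle M)
    (hN : IsVectorBundle N) : ∃ (I : Type u) (_ : Fintype I) (x : I → Γ(V, ⊤)) (d : I → ℕ),
      (∀ i, d i ≠ 0) ∧ (∀ i, IsHomogeneousFunction σ (d i) (x i)) ∧
        @Module.Finite (MvPolynomial I k) (M ⟶ N) _ _
          (Module.compHom _ (MvPolynomial.eval₂Hom (constants k V) x)) := by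
  classical
  obtain ⟨m, U, y, hU, hcov, hy1, hy, hyU, hgen⟩ := hV.projective.exists_charts
  choose S hS using fun i => RingHom.FiniteType.exists_finset_mem_closure
    (finiteType_res_constants k (hU i)) (hgen i)
  obtain ⟨I, hI, x, d, hd, hx, hSx⟩ :=
    hV.exists_homogeneous_generators (Finset.univ.biUnion S)
  refine ⟨I, hI, x, d, hd, hx, ?_⟩
  let _ : Algebra (MvPolynomial I k) Γ(V, ⊤) :=
    (MvPolynomial.eval₂Hom (constants k V) x).toAlgebra
  let _ : Module (MvPolynomial I k) (M ⟶ N) :=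
    Module.compHom _ (MvPolynomial.eval₂Hom (constants k V) x)
  have : IsScalarTower (MvPolynomial I k) Γ(V, ⊤) (M ⟶ N) :=
    ⟨fun b g φ => mul_smul (MvPolynomial.eval₂Hom (constants k V) x b) g φ⟩
  refine finite_hom (k := k) hU hcov hy1 hy hyU (fun i s => ?_)
    (fun D hD => isNoetherianRing_of_isAffineOpen k hD) hM hN
  refine Subring.closure_mono (Set.union_subset_union_left _ ?_) (hS i s)
  rintro _ (⟨c, rfl⟩ | ⟨g, hg, rfl⟩)
  · refine ⟨MvPolynomial.C c, congr_arg (resO (le_top : U i ≤ ⊤)) ?_⟩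
    exact MvPolynomial.eval₂_C _ _ _
  · obtain ⟨b, hb⟩ := hSx g (Finset.mem_biUnion.2 ⟨i, Finset.mem_univ _, hg⟩)
    exact ⟨b, congr_arg (resO (le_top : U i ≤ ⊤)) hb⟩

/-- Monomials times homogeneous generators span `Hom` over `k` and are themselves homogeneous. As
the variables have positive weight, only finitely many such products have weight `r`, and they span
the whole weight space. -/
theorem IsNearlyProjective.finite_weightSpace [IsAlgClosed k]
    [LocallyOfFiniteType (V ↘ Spec (.of k))] [CompactSpace V] (hV : IsNearlyProjective σ)
    (E F : EquivariantVectorBundle σ) (r : ℤ) : Module.Finite k (weightSpace E F r) := by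
  obtain ⟨I, hI, x, d, hd, hx, hfin⟩ :=
    hV.exists_finite_hom E.isVectorBundle F.isVectorBundle
  let _ : Module (MvPolynomial I k) (E.sheaf ⟶ F.sheaf) :=
    Module.compHom _ (MvPolynomial.eval₂Hom (constants k V) x)
  have hsmul : ∀ (b : MvPolynomial I k) (φ : E.sheaf ⟶ F.sheaf),
      b • φ = MvPolynomial.eval₂Hom (constants k V) x b • φ := fun _ _ => rfl
  have : IsScalarTower k (MvPolynomial I k) (E.sheaf ⟶ F.sheaf) := ⟨fun c b φ => by
    rw [hsmul, hsmul, smul_eq_constants_smul, smul_smul, MvPolynomial.smul_eq_C_mul, map_mul]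
    congr 2
    exact MvPolynomial.eval₂_C _ _ _⟩
  let W : Set (E.sheaf ⟶ F.sheaf) := ⋃ q, (weightSpace E F q : Set (E.sheaf ⟶ F.sheaf))
  have hW : Submodule.span (MvPolynomial I k) W = ⊤ := by
    rw [eq_top_iff]
    rintro φ -
    have hφ : φ ∈ ⨆ q, weightSpace E F q := by
      rw [iSup_weightSpace]
      exact Submodule.mem_top
    refine Submodule.span_subset_span k _ _ ?_
    rwa [Submodule.span_iUnion, iSup_congr fun q => Submodule.span_eq (weightSpace E F q)]
  -- Homogeneous morphisms span, so finitely many of them can be chosen as module generators.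
  obtain ⟨G, hGW, hG⟩ := (Submodule.fg_span_iff_fg_span_finset_subset W).1 (hW ▸ hfin.fg_top)
  rw [hW] at hG
  choose q hq using fun m : G => Set.mem_iUnion.1 (hGW m.2)
  let mon (α : I →₀ ℕ) : MvPolynomial I k := MvPolynomial.monomial α 1
  have hmon : ∀ (α : I →₀ ℕ) (m : G),
      mon α • (m : E.sheaf ⟶ F.sheaf) ∈ weightSpace E F (Finsupp.weight d α + q m) := by
    intro α m
    rw [hsmul]
    refine IsHomogeneousFunction.smul_mem ?_ (hq m)
    have h1 : MvPolynomial.eval₂Hom (constants k V) x (mon α) = ∏ i ∈ α.support, x i ^ α i := by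
      rw [MvPolynomial.coe_eval₂Hom, MvPolynomial.eval₂_monomial, map_one, one_mul]
      rfl
    rw [h1, Finsupp.weight_apply]
    intro T t z
    exact IsHomogeneousFunction.prod (σ := σ) α.support (r := fun i => α i • d i)
      (g := fun i => x i ^ α i) (fun i _ => IsHomogeneousFunction.pow (hx i) (α i)) t z
  let Z (s : ℤ) : Set ((I →₀ ℕ) × G) := {z | Finsupp.weight d z.1 + q z.2 = s}
  let D (s : ℤ) : Submodule k (E.sheaf ⟶ F.sheaf) :=
    Submodule.span k ((fun z : (I →₀ ℕ) × G => mon z.1 • (z.2 : E.sheaf ⟶ F.sheaf)) '' Z s)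
  have hD : ∀ s, D s ≤ weightSpace E F s := fun s => by
    refine Submodule.span_le.2 ?_
    rintro _ ⟨z, hz, rfl⟩
    have hz' : (Finsupp.weight d z.1 : ℤ) + q z.2 = s := hz
    rw [← hz', SetLike.mem_coe]
    exact hmon z.1 z.2
  have htop : ⨆ s, D s = ⊤ := by
    have h1 := Submodule.span_smul_of_span_eq_top (MvPolynomial.basisMonomials I k).span_eq
      (G : Set (E.sheaf ⟶ F.sheaf))
    rw [← hG, Submodule.restrictScalars_top] at h1
    rw [eq_top_iff, ← h1, Submodule.span_le]
    rintro _ ⟨_, ⟨α, rfl⟩, m, hm, rfl⟩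
    refine Submodule.mem_iSup_of_mem (Finsupp.weight d α + q ⟨m, hm⟩ : ℤ)
      (Submodule.subset_span ⟨(α, ⟨m, hm⟩), rfl, ?_⟩)
    simp only [MvPolynomial.coe_basisMonomials]
    rfl
  -- The spans `D s` lie in the weight spaces and jointly span, so by directness they fill them.
  rw [← isInternal_weightSpace.eq_of_le_of_iSup_eq_top hD htop r]
  have hZ : (Z r).Finite := by
    have h1 : Z r ⊆ ⋃ m : G, (fun α => (α, m)) ''
        {α | Finsupp.weight d α ≤ (r - q m).toNat} := by
      rintro ⟨α, m⟩ hz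
      refine Set.mem_iUnion.2 ⟨m, α, ?_, rfl⟩
      have : (Finsupp.weight d α : ℤ) + q m = r := hz
      simp only [Set.mem_ofPred_eq]
      omega
    exact (Set.finite_iUnion fun m =>
      (Finsupp.finite_of_nat_weight_le d hd _).image _).subset h1
  exact Module.Finite.iff_fg.2 (Submodule.fg_span (hZ.image _))

end BondalQuiver

end

/-! ### The grading of the algebra and its degree zero part -/

/-- Grouping the summands of an internal direct sum. -/
theorem DirectSum.IsInternal.iSup_fiber {R M ι κ : Type*} [Ring R] [AddCommGroup M] [Module R M]
    [DecidableEq ι] [DecidableEq κ] {A : ι → Submodule R M} (h : DirectSum.IsInternal A)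
    (f : ι → κ) : DirectSum.IsInternal fun d => ⨆ i, ⨆ (_ : f i = d), A i := by
  refine DirectSum.isInternal_submodule_of_iSupIndep_of_iSup_eq_top ?_ ?_
  · rw [iSupIndep_def]
    intro d
    refine Disjoint.mono_right ?_ (h.submodule_iSupIndep.disjoint_biSup_biSup
      (s := {i | f i = d}) (t := {i | f i ≠ d}) (Set.disjoint_left.2 fun i hi hi' => hi' hi))
    refine iSup₂_le fun d' hd' => iSup₂_le fun i hi => le_iSup₂_of_le i ?_ le_rfl
    exact fun h => hd' (hi.symm.trans h)
  · rw [eq_top_iff, ← h.submodule_iSup_eq_top]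
    exact iSup_le fun i => le_iSup_of_le (f i) (le_iSup₂_of_le i rfl le_rfl)

noncomputable section

namespace BondalQuiver

variable {k : Type u} [Field k] {V : Scheme.{u}} [V.Over (Spec (.of k))] {σ : GmAction k V}

section DegreeZero

/-- The projection to weight zero turns multiplication by `g` into multiplication by its value at
the fixed point, since the positive parts of `g` send non-negative weights to positive ones. Applied
to multiples of a generator, it shows that the weight zero part is spanned by the projection of the
generator, and the identity lies there too. -/
theorem IsNearlyProjective.weightSpace_zero_le [IsAlgClosed k] [CompactSpace V]
    (hV : IsNearlyProjective σ) {E : EquivariantVectorBundle σ}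
    (e : (E.sheaf ⟶ E.sheaf) ≃ₗ[Γ(V, ⊤)] Γ(V, ⊤)) (hE : ∀ r < 0, weightSpace E E r = ⊥) :
    weightSpace E E 0 ≤ Submodule.span k {𝟙 E.sheaf} := by
  obtain ⟨ρ, p, hρ, -, -, h0⟩ := hV.retracts
  obtain ⟨P, hP, hP'⟩ := (isInternal_weightSpace (E := E) (F := E)).exists_projection 0
  have hgP : ∀ (g : Γ(V, ⊤)) (m : E.sheaf ⟶ E.sheaf), P (g • m) = p g • P m := by
    intro g m
    have hm : m ∈ ⨆ q, weightSpace E E q := by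
      rw [iSup_weightSpace]
      exact Submodule.mem_top
    induction hm using Submodule.iSup_induction' with
    | mem q m hm =>
      rcases lt_or_ge q 0 with hq | hq
      · rw [hE q hq, Submodule.mem_bot] at hm
        rw [hm, smul_zero, map_zero, smul_zero]
      · have h1 : g • m = ∑ r ∈ Finset.range ((ρ g).natDegree + 1), (ρ g).coeff r • m := by
          rw [← Finset.sum_smul, hρ.sum_coeff]
        rw [h1, map_sum, Finset.sum_range_succ', Finset.sum_eq_zero, zero_add,
          Polynomial.coeff_zero_eq_eval_zero, h0, ← smul_eq_constants_smul, map_smul]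
        intro r _
        refine hP' ((r + 1 : ℕ) + q) (by omega) _ ?_
        exact IsHomogeneousFunction.smul_mem (hρ.isHomogeneousFunction_coeff g (r + 1)) hm
    | zero => rw [smul_zero, map_zero, smul_zero]
    | add m m' _ _ hm hm' => rw [smul_add, map_add, map_add, hm, hm', smul_add]
  have hspan : ∀ φ ∈ weightSpace E E 0, ∃ c : k, φ = c • P (e.symm 1) := by
    intro φ hφ
    refine ⟨p (e φ), ?_⟩
    rw [← hgP, ← map_smul, smul_eq_mul, mul_one, LinearEquiv.symm_apply_apply, hP φ hφ]
  intro φ hφ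
  obtain ⟨a, ha⟩ := hspan φ hφ
  obtain ⟨c, hc⟩ := hspan _ id_mem_weightSpace
  rw [Submodule.mem_span_singleton]
  -- If the coefficient vanishes, the identity is zero and so is every endomorphism.
  by_cases hc0 : c = 0
  · refine ⟨0, ?_⟩
    rw [hc0, zero_smul] at hc
    rw [zero_smul, ← Category.comp_id φ, hc, comp_zero]
  · refine ⟨a * c⁻¹, ?_⟩
    rw [hc, smul_smul, mul_assoc, inv_mul_cancel₀ hc0, mul_one, ha]

end DegreeZero

section Algebra

variable {n : ℕ} (E : Fin n → EquivariantVectorBundle σ)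

/-- The component in `Hom(Eᵢ, Eⱼ)` of an element of `A`. -/
def homProjection (i j : Fin n) : endAlgebra E →ₗ[k] ((E i).sheaf ⟶ (E j).sheaf) where
  toFun a := biproduct.ι (fun i => (E i).sheaf) i ≫ End.asHom a.unop ≫
    biproduct.π (fun i => (E i).sheaf) j
  map_add' a b := by
    change _ ≫ (End.asHom a.unop + End.asHom b.unop) ≫ _ = _
    rw [Preadditive.add_comp, Preadditive.comp_add]
  map_smul' c a := by
    change _ ≫ (c • End.asHom a.unop) ≫ _ = _
    rw [Linear.smul_comp, Linear.comp_smul]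
    rfl

theorem homProjection_homInclusion (i j : Fin n) (φ : (E i).sheaf ⟶ (E j).sheaf) :
    homProjection E i j (homInclusion E i j φ) = φ := by
  change biproduct.ι (fun i => (E i).sheaf) i ≫ (biproduct.π (fun i => (E i).sheaf) i ≫ φ ≫
    biproduct.ι (fun i => (E i).sheaf) j) ≫ biproduct.π (fun i => (E i).sheaf) j = φ
  simp

theorem homProjection_homInclusion_of_ne {i j i' j' : Fin n} (h : ¬ (i = i' ∧ j = j'))
    (φ : (E i).sheaf ⟶ (E j).sheaf) : homProjection E i' j' (homInclusion E i j φ) = 0 := by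
  change biproduct.ι (fun i => (E i).sheaf) i' ≫ (biproduct.π (fun i => (E i).sheaf) i ≫ φ ≫
    biproduct.ι (fun i => (E i).sheaf) j) ≫ biproduct.π (fun i => (E i).sheaf) j' = 0
  by_cases hi : i = i'
  · have hj : j ≠ j' := fun hj => h ⟨hi, hj⟩
    simp only [Category.assoc, biproduct.ι_π_ne _ hj, comp_zero]
  · rw [Category.assoc, biproduct.ι_π_ne_assoc _ (Ne.symm hi), zero_comp]

theorem sum_homInclusion_homProjection (a : endAlgebra E) :
    ∑ i, ∑ j, homInclusion E i j (homProjection E i j a) = a := by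
  have h1 : ∀ f : (⨁ fun i => (E i).sheaf) ⟶ ⨁ fun i => (E i).sheaf,
      ∑ i, ∑ j, biproduct.π (fun i => (E i).sheaf) i ≫ (biproduct.ι (fun i => (E i).sheaf) i ≫
        f ≫ biproduct.π (fun i => (E i).sheaf) j) ≫ biproduct.ι (fun i => (E i).sheaf) j = f := by
    intro f
    have h2 := biproduct.total (f := fun i => (E i).sheaf)
    conv_rhs => rw [← Category.id_comp f, ← Category.comp_id f, ← h2]
    simp only [Preadditive.sum_comp, Preadditive.comp_sum, Category.assoc]
    exact Finset.sum_comm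
  refine MulOpposite.unop_injective (Eq.trans ?_ (h1 (End.asHom a.unop)))
  rw [Finset.unop_sum]
  refine Finset.sum_congr rfl fun i _ => ?_
  rw [Finset.unop_sum]
  rfl

/-- Passing to the opposite algebra makes the product the diagrammatic composition, so weights and
index differences both add. -/
theorem homInclusion_mul (i j l : Fin n) (φ : (E i).sheaf ⟶ (E j).sheaf)
    (ψ : (E j).sheaf ⟶ (E l).sheaf) :
    homInclusion E i j φ * homInclusion E j l ψ = homInclusion E i l (φ ≫ ψ) := by
  refine MulOpposite.unop_injective ?_
  change (biproduct.π (fun i => (E i).sheaf) i ≫ φ ≫ biproduct.ι (fun i => (E i).sheaf) j) ≫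
    (biproduct.π (fun i => (E i).sheaf) j ≫ ψ ≫ biproduct.ι (fun i => (E i).sheaf) l) =
    biproduct.π (fun i => (E i).sheaf) i ≫ (φ ≫ ψ) ≫ biproduct.ι (fun i => (E i).sheaf) l
  simp

theorem homInclusion_mul_of_ne {i j j' l : Fin n} (h : j ≠ j') (φ : (E i).sheaf ⟶ (E j).sheaf)
    (ψ : (E j').sheaf ⟶ (E l).sheaf) :
    homInclusion E i j φ * homInclusion E j' l ψ = 0 := by
  refine MulOpposite.unop_injective ?_
  change (biproduct.π (fun i => (E i).sheaf) i ≫ φ ≫ biproduct.ι (fun i => (E i).sheaf) j) ≫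
    (biproduct.π (fun i => (E i).sheaf) j' ≫ ψ ≫ biproduct.ι (fun i => (E i).sheaf) l) = 0
  simp only [Category.assoc, biproduct.ι_π_ne_assoc _ h, zero_comp, comp_zero]

theorem sum_idempotent : ∑ i, idempotent E i = 1 := by
  rw [← sum_homInclusion_homProjection E 1]
  refine Finset.sum_congr rfl fun i _ => ?_
  have h1 : ∀ j, homProjection E i j 1 = biproduct.ι (fun i => (E i).sheaf) i ≫
      biproduct.π (fun i => (E i).sheaf) j := fun j =>
    congr_arg (fun f => biproduct.ι (fun i => (E i).sheaf) i ≫ f) (Category.id_comp _)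
  rw [Finset.sum_eq_single i, h1, biproduct.ι_π_self]
  · rfl
  · intro j _ hj
    rw [h1, biproduct.ι_π_ne _ hj.symm, map_zero]
  · exact fun h => (h (Finset.mem_univ i)).elim

/-- The decomposition into matrix entries, refined by the weight decomposition of each entry. -/
theorem isInternal_component [Infinite k] [CompactSpace V] : DirectSum.IsInternal
    fun c : Fin n × Fin n × ℤ => component E c.1 c.2.1 c.2.2 := by
  refine DirectSum.isInternal_submodule_of_iSupIndep_of_iSup_eq_top ?_ ?_
  · rw [iSupIndep_iff_finsetSum_eq_zero_imp_eq_zero]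
    rintro S v hv h0 ⟨i, j, r⟩ hc
    obtain ⟨P, hP, hP'⟩ :=
      (isInternal_weightSpace (E := E i) (F := E j)).exists_projection r
    have h1 : P (homProjection E i j (∑ c ∈ S, v c)) = 0 := by
      rw [h0, map_zero, map_zero]
    rw [map_sum, map_sum, Finset.sum_eq_single_of_mem _ hc] at h1
    · obtain ⟨φ, hφ, h2⟩ := hv _ hc
      rw [← h2, homProjection_homInclusion, hP φ hφ] at h1
      rw [← h2, h1, map_zero]
    · rintro ⟨i', j', r'⟩ hc' hne
      obtain ⟨φ, hφ, h2⟩ := hv _ hc'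
      rw [← h2]
      by_cases h : i' = i ∧ j' = j
      · obtain ⟨rfl, rfl⟩ := h
        dsimp only
        rw [homProjection_homInclusion, hP' r' (fun h => hne (by rw [h])) φ hφ]
      · rw [homProjection_homInclusion_of_ne E h, map_zero]
  · rw [eq_top_iff]
    rintro a -
    rw [← sum_homInclusion_homProjection E a]
    refine sum_mem fun i _ => sum_mem fun j _ => ?_
    have h1 : homProjection E i j a ∈ ⨆ r, weightSpace (E i) (E j) r := by
      rw [iSup_weightSpace]
      exact Submodule.mem_top
    have h2 := Submodule.mem_map_of_mem (f := homInclusion E i j) h1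
    rw [Submodule.map_iSup] at h2
    have h3 : ⨆ r, component E i j r ≤ ⨆ c : Fin n × Fin n × ℤ, component E c.1 c.2.1 c.2.2 :=
      iSup_le fun r => le_iSup (fun c : Fin n × Fin n × ℤ => component E c.1 c.2.1 c.2.2) (i, j, r)
    exact h3 h2

theorem gradedPiece_eq_iSup (d : ℤ) : gradedPiece E d =
    ⨆ c : Fin n × Fin n × ℤ, ⨆ (_ : (c.2.1 : ℤ) - (c.1 : ℤ) + (n : ℤ) * c.2.2 = d),
      component E c.1 c.2.1 c.2.2 := by
  simp only [gradedPiece, iSup_prod]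

theorem isInternal_gradedPiece [Infinite k] [CompactSpace V] :
    DirectSum.IsInternal (gradedPiece E) := by
  have h := (isInternal_component E).iSup_fiber
    fun c => (c.2.1 : ℤ) - (c.1 : ℤ) + (n : ℤ) * c.2.2
  rwa [← funext (gradedPiece_eq_iSup E)] at h

variable {E}

theorem component_le_gradedPiece {i j : Fin n} {r d : ℤ}
    (h : (j : ℤ) - (i : ℤ) + (n : ℤ) * r = d) : component E i j r ≤ gradedPiece E d :=
  le_iSup_of_le i (le_iSup_of_le j (le_iSup_of_le r (le_iSup_of_le h le_rfl)))

theorem gradedPiece_le {d : ℤ} {W : Submodule k (endAlgebra E)}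
    (h : ∀ (i j : Fin n) (r : ℤ), (j : ℤ) - (i : ℤ) + (n : ℤ) * r = d → component E i j r ≤ W) :
    gradedPiece E d ≤ W :=
  iSup_le fun i => iSup_le fun j => iSup_le fun r => iSup_le fun hd => h i j r hd

theorem idempotent_mem (i : Fin n) : idempotent E i ∈ component E i i 0 :=
  Submodule.mem_map_of_mem id_mem_weightSpace

theorem gradedMonoid_gradedPiece : SetLike.GradedMonoid (gradedPiece E) where
  one_mem := by
    rw [← sum_idempotent]
    exact sum_mem fun i _ => component_le_gradedPiece (by ring) (idempotent_mem i)
  mul_mem := by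
    have key : ∀ d d', gradedPiece E d * gradedPiece E d' ≤ gradedPiece E (d + d') := by
      intro d d'
      rw [Submodule.mul_le]
      intro a ha b hb
      have h1 : gradedPiece E d ≤ (gradedPiece E (d + d')).comap (LinearMap.mulRight k b) := by
        refine gradedPiece_le ?_
        rintro i j r hd _ ⟨φ, hφ, rfl⟩
        have h2 : gradedPiece E d' ≤ (gradedPiece E (d + d')).comap
            (LinearMap.mulLeft k (homInclusion E i j φ)) := by
          refine gradedPiece_le ?_
          rintro j' l s hd' _ ⟨ψ, hψ, rfl⟩
          rw [Submodule.mem_comap, LinearMap.mulLeft_apply]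
          by_cases hj : j = j'
          · subst hj
            rw [homInclusion_mul]
            exact component_le_gradedPiece (by rw [← hd, ← hd']; ring)
              (Submodule.mem_map_of_mem (comp_mem_weightSpace hφ hψ))
          · rw [homInclusion_mul_of_ne E hj]
            exact zero_mem _
        exact h2 hb
      exact h1 ha
    exact fun {d d'} a b ha hb => key d d' (Submodule.mul_mem_mul ha hb)

theorem nonempty_gradedAlgebra [Infinite k] [CompactSpace V] :
    Nonempty (GradedAlgebra (gradedPiece E)) :=
  ⟨{ gradedMonoid_gradedPiece with toDecomposition := (isInternal_gradedPiece E).chooseDecomposition }⟩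

theorem IsDecent.component_eq_bot (hE : IsDecent E) {i j : Fin n} {r : ℤ}
    (h : (j : ℤ) - (i : ℤ) + (n : ℤ) * r < 0) : component E i j r = ⊥ := by
  suffices weightSpace (E i) (E j) r = ⊥ by rw [component, this, Submodule.map_bot]
  have hi := i.isLt
  rcases lt_or_ge r 0 with hr | hr
  · exact hE.nonneg i j r hr
  have hn : 0 ≤ (n : ℤ) * r := mul_nonneg (by omega) hr
  -- With `r ≥ 0` a negative degree forces `j < i`; and `r ≥ 1` would give degree at least `j - i +
  -- n > 0`.
  refine hE.pos i j r (Fin.lt_def.2 (by omega)) ?_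
  by_contra! hr'
  nlinarith

theorem IsDecent.gradedPiece_eq_bot (hE : IsDecent E) {d : ℤ} (hd : d < 0) : gradedPiece E d = ⊥ :=
  le_bot_iff.1 (gradedPiece_le fun _ _ _ h => (hE.component_eq_bot (h ▸ hd)).le)

theorem IsNearlyProjective.finite_gradedPiece [IsAlgClosed k]
    [LocallyOfFiniteType (V ↘ Spec (.of k))] [CompactSpace V] (hV : IsNearlyProjective σ) (d : ℤ) :
    Module.Finite k (gradedPiece E d) := by
  have h1 : ∀ i j r, Module.Finite k (component E i j r) := fun i j r => by
    have := hV.finite_weightSpace (E i) (E j) r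
    rw [component]
    infer_instance
  -- For given `i` and `j` the degree determines `r`, so only finitely many components contribute.
  have h2 : gradedPiece E d ≤
      ⨆ i : Fin n, ⨆ j : Fin n, component E i j ((d - ((j : ℤ) - (i : ℤ))) / n) := by
    refine gradedPiece_le fun i j r h => ?_
    have hn : (n : ℤ) ≠ 0 := by have := i.isLt; omega
    have hr : (d - ((j : ℤ) - (i : ℤ))) / n = r := by
      rw [← h, add_sub_cancel_left, Int.mul_ediv_cancel_left _ hn]
    exact le_iSup_of_le i (le_iSup_of_le j (by rw [hr]))
  exact Submodule.finiteDimensional_of_le h2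

theorem IsNearlyProjective.gradedPiece_zero [IsAlgClosed k] [CompactSpace V]
    (hV : IsNearlyProjective σ) (hE : IsDecent E) :
    gradedPiece E 0 = Submodule.span k (Set.range (idempotent E)) := by
  refine le_antisymm (gradedPiece_le fun i j r h => ?_) (Submodule.span_le.2 ?_)
  · have hi := i.isLt
    have hj := j.isLt
    rcases lt_or_ge r 0 with hr | hr
    · rw [component, hE.nonneg i j r hr, Submodule.map_bot]
      exact bot_le
    -- A weight `r ≥ 1` has degree at least `j - i + n > 0`. With `r = 0`, degree zero means `i =
    -- j`.
    have hr0 : r = 0 := by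
      by_contra hr'
      have : (n : ℤ) * 1 ≤ n * r := mul_le_mul_of_nonneg_left (by omega) (by omega)
      omega
    subst hr0
    obtain rfl : i = j := Fin.ext (by omega)
    obtain ⟨e⟩ := hE.end_iso i
    refine (Submodule.map_mono (hV.weightSpace_zero_le e (hE.nonneg i i))).trans ?_
    rw [Submodule.map_span, Set.image_singleton]
    exact Submodule.span_mono (Set.singleton_subset_iff.2 ⟨i, rfl⟩)
  · rintro _ ⟨i, rfl⟩
    exact component_le_gradedPiece (by ring) (idempotent_mem i)

end Algebra

end BondalQuiver

end

theorem proposition1 {k : Type u} [Field k] [IsAlgClosed k]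
    (V : Scheme.{u}) [V.Over (Spec (.of k))]
    [IsSeparated (V ↘ Spec (.of k))] [LocallyOfFiniteType (V ↘ Spec (.of k))]
    [QuasiCompact (V ↘ Spec (.of k))]
    (σ : BondalQuiver.GmAction k V) (hV : BondalQuiver.IsNearlyProjective σ)
    {n : ℕ} (E : Fin n → BondalQuiver.EquivariantVectorBundle σ)
    (hE : BondalQuiver.IsDecent E) :
    DirectSum.IsInternal
        (fun c : Fin n × Fin n × ℤ => BondalQuiver.component E c.1 c.2.1 c.2.2) ∧
      Nonempty (GradedAlgebra (BondalQuiver.gradedPiece E)) ∧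
      (∀ d : ℤ, d < 0 → BondalQuiver.gradedPiece E d = ⊥) ∧
      (∀ d : ℤ, Module.Finite k (BondalQuiver.gradedPiece E d)) ∧
      BondalQuiver.gradedPiece E 0 =
        Submodule.span k (Set.range (BondalQuiver.idempotent E)) := by
  have : CompactSpace V := QuasiCompact.compactSpace_of_compactSpace (V ↘ Spec (.of k))
  exact ⟨BondalQuiver.isInternal_component E, BondalQuiver.nonempty_gradedAlgebra,
    fun d hd => hE.gradedPiece_eq_bot hd, fun d => hV.finite_gradedPiece d,
    hV.gradedPiece_zero hE⟩
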